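/- Let $(\mathcal M,g)$ be a stably causal smooth spacetime: a connected, Hausdorff, second countable smooth manifold of dimension $d\ge 2$ with a smooth time-oriented Lorentzian metric such that, for some continuous future-directed timelike vector field $T$, the metric $g-T^\flat\otimes T^\flat$ admits no closed timelike curve. Assume that $(\mathcal M,g)$ is future null geodesically complete, i.e. every future-directed null geodesic extends to arbitrarily large values of its affine parameter. Terminology. A future-infinite causal worldline $W$ is (the image of) a piecewise $C^1$ future-directed causal curve that is infinite towards the future in generalized affine parameter: the integral of the Euclidean length of the components of its velocity in a parallel frame along it diverges towards the future. A null geodesic is future-infinite if its affine parameter is unbounded above. The causal horizon of $W$ is the topological boundary $\partial I^-(W)$ of the chronological past of $W$. The edge of an achronal set $A$ is the set of $p\in\mathrm{cl}(A)$ such that every open neighbourhood $O$ of $p$ contains some $q\in I^+(p,O)$, some $r\in I^-(p,O)$ and a timelike curve in $O$ from $r$ to $q$ that misses $A$. A slice is a closed achronal set with empty edge, and a hypersurface is a relatively open subset of a slice. An exterior of $\partial I^-(W)$ is a hypersurface $a\subseteq \mathrm{cl}(I^-(W))$ with $\mathrm{edge}(a)\subseteq\partial I^-(W)$. Two sets are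 Cauchy comparable if both are contained in some open set $N\subseteq\mathcal M$ that is globally hyperbolic as a spacetime of its own (it has a Cauchy surface; $N$ need not be connected). $D(a)$ denotes the domain of dependence of $a$ (with respect to inextendible causal curves). The generalized entropy $S_{\mathrm{gen}}$ enters only as a real-valued function on some class of sets; what follows holds for every such function, and $a,b$ below range over the sets on which it is defined. Generalized second law (GSL): let $W$ be a future-infinite causal worldline and let $a,b$ be Cauchy comparable exteriors of $\partial I^-(W)$ with $D(a)\subseteq D(b)$; suppose in addition that (*) through every point of $\mathrm{edge}(b)\setminus\mathrm{edge}(a)$ there passes a future-infinite null geodesic $\gamma\subseteq\partial I^-(W)$. Then $S_{\mathrm{gen}}(a)-S_{\mathrm{gen}}(b)\ge 0$. Claims. 1. For every future-infinite causal worldline $W$ and every $p\in\partial I^-(W)$ there is a future-infinite null geodesic $\gamma\subseteq\partial I^-(W)$ passing through $p$. 2. Hypothesis (*) of the GSL is redundant: it holds for every $W,a,b$ satisfying the other hypotheses of the GSL. 3. The GSL is equivalent to its restatement without (*): for every future-infinite causal worldline $W$ and all Cauchy comparable exteriors $a,b$ of $\partial I^-(W)$ with $D(a)\subseteq D(b)$,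 one has $S_{\mathrm{gen}}(a)-S_{\mathrm{gen}}(b)\ge 0$. -/

import Mathlib

open Set Filter Topology MeasureTheory
open scoped Manifold ContDiff

noncomputable section

namespace Spacetimes

/-- Coordinate space of dimension `d`. -/
abbrev Coord (d : ℕ) : Type := EuclideanSpace ℝ (Fin d)

/-- A smooth Lorentzian metric of signature `(-,+,…,+)` together with a time orientation, given by a
continuous timelike vector field. -/
structure LorentzStructure (d : ℕ) (M : Type*) [TopologicalSpace M] [ChartedSpace (Coord d) M]
    [IsManifold (𝓡 d) ∞ M] where
  /-- the metric tensor -/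
  metric (x : M) : TangentSpace (𝓡 d) x →L[ℝ] TangentSpace (𝓡 d) x →L[ℝ] ℝ
  symm (x : M) (v w : TangentSpace (𝓡 d) x) : metric x v w = metric x w v
  signature (x : M) : ∃ v : TangentSpace (𝓡 d) x, metric x v v < 0 ∧
    ∀ w : TangentSpace (𝓡 d) x, w ≠ 0 → metric x v w = 0 → 0 < metric x w w
  smooth : ContMDiff (𝓡 d) ((𝓡 d).prod 𝓘(ℝ, Coord d →L[ℝ] Coord d →L[ℝ] ℝ)) ∞
    (fun x => Bundle.TotalSpace.mk' (Coord d →L[ℝ] Coord d →L[ℝ] ℝ)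
      (E := fun x : M => TangentSpace (𝓡 d) x →L[ℝ] TangentSpace (𝓡 d) x →L[ℝ] ℝ) x (metric x))
  /-- the future-pointing timelike vector field that fixes the time orientation -/
  future (x : M) : TangentSpace (𝓡 d) x
  future_timelike (x : M) : metric x (future x) (future x) < 0
  future_continuous : Continuous (fun x => (⟨x, future x⟩ : TangentBundle (𝓡 d) M))

section

variable {d : ℕ} {M : Type*} [TopologicalSpace M] [ChartedSpace (Coord d) M]
  [IsManifold (𝓡 d) ∞ M]

/-! ### Cones and curves -/

/-- Future-directed timelike vectors at `x`. -/
def futureTimelike (g : LorentzStructure d M) (x : M) : Set (TangentSpace (𝓡 d) x) :=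
  {v | g.metric x v v < 0 ∧ g.metric x v (g.future x) < 0}

/-- Future-directed causal vectors at `x` (nonzero, timelike or null). -/
def futureCausal (g : LorentzStructure d M) (x : M) : Set (TangentSpace (𝓡 d) x) :=
  {v | g.metric x v v ≤ 0 ∧ g.metric x v (g.future x) < 0}

/-- Future-directed null vectors at `x` (nonzero). -/
def futureNull (g : LorentzStructure d M) (x : M) : Set (TangentSpace (𝓡 d) x) :=
  {v | g.metric x v v = 0 ∧ g.metric x v (g.future x) < 0}

/-- The velocity at `t` of the curve `γ`, differentiated within the parameter set `s`. -/
def velocity (γ : ℝ → M) (s : Set ℝ) (t : ℝ) : TangentSpace (𝓡 d) (γ t) :=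
  mfderivWithin 𝓘(ℝ, ℝ) (𝓡 d) γ s t (1 : ℝ)

/-- `B` has only finitely many points in each compact interval contained in `s`. -/
def LocallyFiniteIn (B s : Set ℝ) : Prop :=
  ∀ a b : ℝ, Icc a b ⊆ s → (B ∩ Icc a b).Finite

/-- `γ` is a piecewise `C¹` curve on the interval `s` all of whose velocities (both one-sided ones
at a break point) lie in the cone field `C`. -/
def IsCurveIn (C : ∀ x : M, Set (TangentSpace (𝓡 d) x)) (γ : ℝ → M) (s : Set ℝ) : Prop :=
  s.OrdConnected ∧ ContinuousOn γ s ∧ ∃ B : Set ℝ, LocallyFiniteIn B s ∧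
    ∀ a b : ℝ, a < b → Icc a b ⊆ s → Ioo a b ∩ B = ∅ →
      ContMDiffOn 𝓘(ℝ, ℝ) (𝓡 d) 1 γ (Icc a b) ∧
      ∀ t ∈ Icc a b, velocity γ (Icc a b) t ∈ C (γ t)

/-- Future-directed timelike curve on the parameter interval `s`. -/
def IsTimelikeCurve (g : LorentzStructure d M) (γ : ℝ → M) (s : Set ℝ) : Prop :=
  IsCurveIn (futureTimelike g) γ s

/-- Future-directed causal curve on the parameter interval `s`. -/
def IsCausalCurve (g : LorentzStructure d M) (γ : ℝ → M) (s : Set ℝ) : Prop :=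
  IsCurveIn (futureCausal g) γ s

/-! ### Causality -/

/-- A future-directed timelike curve runs from `p` to `q` inside `O`, off the set `A`. -/
def TimelikeJoined (g : LorentzStructure d M) (O A : Set M) (p q : M) : Prop :=
  ∃ (γ : ℝ → M) (a b : ℝ), a < b ∧ IsTimelikeCurve g γ (Icc a b) ∧ γ a = p ∧ γ b = q ∧
    ∀ t ∈ Icc a b, γ t ∈ O \ A

/-- `I⁺(p, O)`, the chronological future of `p` relative to `O`. -/
def chronFuture (g : LorentzStructure d M) (O : Set M) (p : M) : Set M :=
  {q | TimelikeJoined g O ∅ p q}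

/-- `I⁻(p, O)`, the chronological past of `p` relative to `O`. -/
def chronPast (g : LorentzStructure d M) (O : Set M) (p : M) : Set M :=
  {q | TimelikeJoined g O ∅ q p}

/-- `I⁻(A)`, the chronological past of a set. -/
def pastOf (g : LorentzStructure d M) (A : Set M) : Set M :=
  ⋃ p ∈ A, chronPast g univ p

/-- For a timelike vector field `T` the Lorentzian metric `g - T♭ ⊗ T♭` has a strictly wider cone
than `g`; these are its future-directed timelike vectors. -/
def widenedTimelike (g : LorentzStructure d M) (T : ∀ x : M, TangentSpace (𝓡 d) x) (x : M) :
    Set (TangentSpace (𝓡 d) x) :=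
  {v | g.metric x v v < (g.metric x (T x) v) ^ 2 ∧ g.metric x (T x) v < 0}

/-- Stable causality: for some continuous future-directed timelike vector field `T`, the metric
`g - T♭ ⊗ T♭` admits no closed timelike curve. -/
def StablyCausal (g : LorentzStructure d M) : Prop :=
  ∃ T : ∀ x : M, TangentSpace (𝓡 d) x,
    Continuous (fun x => (⟨x, T x⟩ : TangentBundle (𝓡 d) M)) ∧
    (∀ x, T x ∈ futureTimelike g x) ∧
    ¬ ∃ (γ : ℝ → M) (a b : ℝ), a < b ∧ IsCurveIn (widenedTimelike g T) γ (Icc a b) ∧ γ a = γ b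

/-- Achronality relative to `N`: no two points of `A` are joined by a timelike curve in `N`. -/
def IsAchronal (g : LorentzStructure d M) (N A : Set M) : Prop :=
  ∀ p ∈ A, ∀ q ∈ A, q ∉ chronFuture g N p

/-- The edge of an achronal set `A`: the points `p` of its closure such that every open
neighbourhood `O` of `p` contains points `q ∈ I⁺(p, O)` and `r ∈ I⁻(p, O)` and a timelike curve from
`r` to `q` in `O` that does not meet `A`. -/
def edge (g : LorentzStructure d M) (A : Set M) : Set M :=
  {p | p ∈ closure A ∧ ∀ O : Set M, IsOpen O → p ∈ O →
    ∃ q ∈ chronFuture g O p, ∃ r ∈ chronPast g O p, TimelikeJoined g O A r q}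

/-- A slice: a closed achronal set with empty edge. -/
def IsSlice (g : LorentzStructure d M) (A : Set M) : Prop :=
  IsClosed A ∧ IsAchronal g univ A ∧ edge g A = ∅

/-- A hypersurface: a relatively open subset of a slice. -/
def IsHypersurface (g : LorentzStructure d M) (A : Set M) : Prop :=
  ∃ S U : Set M, IsSlice g S ∧ IsOpen U ∧ A = S ∩ U

/-- `D⁺(A)` within the spacetime `N`: every past-inextendible causal curve of `N` that ends at `p`
meets `A`. -/
def futureDomain (g : LorentzStructure d M) (N A : Set M) : Set M :=
  {p | p ∈ N ∧ ∀ γ : ℝ → M, IsCausalCurve g γ (Iic 0) → γ 0 = p → (∀ t ∈ Iic (0 : ℝ), γ t ∈ N) →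
    (∀ x ∈ N, ¬ Tendsto γ atBot (𝓝 x)) → ∃ t ∈ Iic (0 : ℝ), γ t ∈ A}

/-- `D⁻(A)` within the spacetime `N`: every future-inextendible causal curve of `N` that starts at
`p` meets `A`. -/
def pastDomain (g : LorentzStructure d M) (N A : Set M) : Set M :=
  {p | p ∈ N ∧ ∀ γ : ℝ → M, IsCausalCurve g γ (Ici 0) → γ 0 = p → (∀ t ∈ Ici (0 : ℝ), γ t ∈ N) →
    (∀ x ∈ N, ¬ Tendsto γ atTop (𝓝 x)) → ∃ t ∈ Ici (0 : ℝ), γ t ∈ A}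

/-- The domain of dependence `D(A) = D⁺(A) ∪ D⁻(A)` within `N`. -/
def domainOfDependence (g : LorentzStructure d M) (N A : Set M) : Set M :=
  futureDomain g N A ∪ pastDomain g N A

/-- The open set `N`, as a spacetime of its own, is globally hyperbolic: it has a Cauchy surface,
that is, a relatively closed achronal set whose domain of dependence is all of `N`. -/
def IsGloballyHyperbolicOn (g : LorentzStructure d M) (N : Set M) : Prop :=
  IsOpen N ∧ ∃ S ⊆ N, closure S ∩ N ⊆ S ∧ IsAchronal g N S ∧ domainOfDependence g N S = N

/-- Two sets are Cauchy comparable if some globally hyperbolic open sub-spacetime contains both. -/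
def CauchyComparable (g : LorentzStructure d M) (A B : Set M) : Prop :=
  ∃ N : Set M, IsGloballyHyperbolicOn g N ∧ A ⊆ N ∧ B ⊆ N

/-! ### The Levi-Civita connection in charts, geodesics, parallel transport -/

/-- The metric in the coordinates of the chart at `x₀`, at the coordinate point `y`. -/
def coordMetric (g : LorentzStructure d M) (x₀ : M) (y : Coord d) :
    Coord d →L[ℝ] Coord d →L[ℝ] ℝ :=
  let G : Coord d →L[ℝ] Coord d →L[ℝ] ℝ := g.metric ((extChartAt (𝓡 d) x₀).symm y)
  let A : Coord d →L[ℝ] Coord d :=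
    mfderiv 𝓘(ℝ, Coord d) (𝓡 d) (extChartAt (𝓡 d) x₀).symm y
  G.bilinearComp A A

/-- Christoffel symbols of the first kind in the chart at `x₀`:
`Γ(u, v; w) = ½ (∂ᵤ g(v, w) + ∂ᵥ g(u, w) - ∂_w g(u, v))`. -/
def christoffel (g : LorentzStructure d M) (x₀ : M) (y u v w : Coord d) : ℝ :=
  (1 / 2 : ℝ) * (fderiv ℝ (coordMetric g x₀) y u v w + fderiv ℝ (coordMetric g x₀) y v u w
    - fderiv ℝ (coordMetric g x₀) y w u v)

/-- `γ` is an affinely parametrized geodesic on the interval `s`: in every chart of the atlas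
indexed by the points of `M` it solves the geodesic equation
`g(c'', w) + Γ(c', c'; w) = 0` for all `w`. -/
def IsGeodesic (g : LorentzStructure d M) (γ : ℝ → M) (s : Set ℝ) : Prop :=
  ContMDiffOn 𝓘(ℝ, ℝ) (𝓡 d) 2 γ s ∧
  ∀ t ∈ s, ∀ x₀ : M, γ t ∈ (chartAt (Coord d) x₀).source →
    let c : ℝ → Coord d := fun τ => extChartAt (𝓡 d) x₀ (γ τ)
    ∀ w : Coord d, coordMetric g x₀ (c t) (derivWithin (derivWithin c s) s t) w
      + christoffel g x₀ (c t) (derivWithin c s t) (derivWithin c s t) w = 0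

/-- `γ` is an affinely parametrized future-directed null geodesic on the interval `s`. -/
def IsNullGeodesic (g : LorentzStructure d M) (γ : ℝ → M) (s : Set ℝ) : Prop :=
  IsGeodesic g γ s ∧ ∀ t ∈ s, velocity γ s t ∈ futureNull g (γ t)

/-- Future null geodesic completeness: each future-directed null vector is the initial velocity of
a null geodesic that is defined for all affine parameters in `[0, ∞)`. -/
def FutureNullComplete (g : LorentzStructure d M) : Prop :=
  ∀ (p : M), ∀ v ∈ futureNull g p, ∃ γ : ℝ → M, IsNullGeodesic g γ (Ici 0) ∧
    (⟨γ 0, velocity γ (Ici 0) 0⟩ : TangentBundle (𝓡 d) M) = ⟨p, v⟩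

/-- Through `p` there passes a null geodesic contained in `H` whose affine parameter is unbounded
towards the future. -/
def HasFutureInfiniteNullGeodesic (g : LorentzStructure d M) (H : Set M) (p : M) : Prop :=
  ∃ (γ : ℝ → M) (s : Set ℝ), s.OrdConnected ∧ ¬ BddAbove s ∧ IsNullGeodesic g γ s ∧
    p ∈ γ '' s ∧ γ '' s ⊆ H

/-- `V` is a continuous vector field along the piecewise `C¹` curve `γ`, parallel off the break
points: in every chart it solves `g(V', w) + Γ(c', V; w) = 0` for all `w`. -/
def IsParallelAlong (g : LorentzStructure d M) (γ : ℝ → M) (s : Set ℝ)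
    (V : ∀ t : ℝ, TangentSpace (𝓡 d) (γ t)) : Prop :=
  ContinuousOn (fun t => (⟨γ t, V t⟩ : TangentBundle (𝓡 d) M)) s ∧
  ∃ B : Set ℝ, LocallyFiniteIn B s ∧ ∀ t ∈ interior s \ B, ∀ x₀ : M,
    γ t ∈ (chartAt (Coord d) x₀).source →
    let c : ℝ → Coord d := fun τ => extChartAt (𝓡 d) x₀ (γ τ)
    let ξ : ℝ → Coord d := fun τ =>
      mfderiv (𝓡 d) 𝓘(ℝ, Coord d) (extChartAt (𝓡 d) x₀) (γ τ) (V τ)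
    DifferentiableAt ℝ c t ∧ DifferentiableAt ℝ ξ t ∧
    ∀ w : Coord d, coordMetric g x₀ (c t) (deriv ξ t) w
      + christoffel g x₀ (c t) (deriv c t) (ξ t) w = 0

/-- The curve `γ` on `s` is infinite towards the future in (generalized) affine parameter: for a
parallel frame `e` along `γ`, the integral of the Euclidean length of the components of the velocity
in the frame diverges towards the future. Whether it diverges depends neither on the frame nor on
the starting parameter; on a geodesic the integral is a constant times the affine parameter. -/
def IsFutureInfinite (g : LorentzStructure d M) (γ : ℝ → M) (s : Set ℝ) : Prop :=
  ∃ e : ∀ t : ℝ, Coord d ≃L[ℝ] TangentSpace (𝓡 d) (γ t),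
    (∀ u : Coord d, IsParallelAlong g γ s (fun t => e t u)) ∧
    ∀ t₀ ∈ s, ∫⁻ t in s ∩ Ici t₀, ‖(e t).symm (velocity γ s t)‖ₑ = ⊤

/-- `W` is (the image of) a future-infinite causal worldline. -/
def IsFutureInfiniteWorldline (g : LorentzStructure d M) (W : Set M) : Prop :=
  ∃ (γ : ℝ → M) (s : Set ℝ), s.Nonempty ∧ IsCausalCurve g γ s ∧ IsFutureInfinite g γ s ∧
    W = γ '' s

/-! ### Horizons and the generalized second law -/

/-- The causal horizon `∂I⁻(W)`. -/
def horizon (g : LorentzStructure d M) (W : Set M) : Set M :=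
  frontier (pastOf g W)

/-- `a` is an exterior of the horizon `∂I⁻(W)`. -/
def IsExterior (g : LorentzStructure d M) (W a : Set M) : Prop :=
  IsHypersurface g a ∧ a ⊆ closure (pastOf g W) ∧ edge g a ⊆ horizon g W

/-- The geometric situation in which the GSL compares `a` with `b`: `W` is a future-infinite causal
worldline, and `a`, `b` are Cauchy comparable exteriors of `∂I⁻(W)` with `D(a) ⊆ D(b)`. -/
def IsGSLPair (g : LorentzStructure d M) (W a b : Set M) : Prop :=
  IsFutureInfiniteWorldline g W ∧ IsExterior g W a ∧ IsExterior g W b ∧ CauchyComparable g a b ∧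
    domainOfDependence g univ a ⊆ domainOfDependence g univ b

/-- The final hypothesis of the GSL. -/
def GeneratorCondition (g : LorentzStructure d M) (W a b : Set M) : Prop :=
  ∀ p ∈ edge g b \ edge g a, HasFutureInfiniteNullGeodesic g (horizon g W) p

/-- The generalized second law for a set function `S`, defined on the sets in `R`. -/
def GSL (g : LorentzStructure d M) (R : Set (Set M)) (S : Set M → ℝ) : Prop :=
  ∀ W : Set M, ∀ a ∈ R, ∀ b ∈ R, IsGSLPair g W a b → GeneratorCondition g W a b → 0 ≤ S a - S b

/-- The generalized second law restated without its final hypothesis. -/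
def SimplifiedGSL (g : LorentzStructure d M) (R : Set (Set M)) (S : Set M → ℝ) : Prop :=
  ∀ W : Set M, ∀ a ∈ R, ∀ b ∈ R, IsGSLPair g W a b → 0 ≤ S a - S b

end

end Spacetimes

end

namespace Spacetimes

/-! ### Lorentzian bilinear forms -/

section LorentzForm

variable {E : Type*} [NormedAddCommGroup E] [NormedSpace ℝ E]

/-- A symmetric bilinear form of signature `(-,+,…,+)`. -/
def IsLorentzForm (B : E →L[ℝ] E →L[ℝ] ℝ) : Prop :=
  (∀ v w, B v w = B w v) ∧ ∃ v, B v v < 0 ∧ ∀ w, w ≠ 0 → B v w = 0 → 0 < B w w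

/-- Timelike vectors in the cone singled out by `f`. -/
def timelikeCone (B : E →L[ℝ] E →L[ℝ] ℝ) (f : E) : Set E := {v | B v v < 0 ∧ B v f < 0}

/-- Causal vectors in the cone singled out by `f`. -/
def causalCone (B : E →L[ℝ] E →L[ℝ] ℝ) (f : E) : Set E := {v | B v v ≤ 0 ∧ B v f < 0}

variable {B : E →L[ℝ] E →L[ℝ] ℝ}

lemma IsLorentzForm.pos_of_orthogonal (hB : IsLorentzForm B) {u w : E} (hu : B u u < 0)
    (hw : w ≠ 0) (h : B u w = 0) : 0 < B w w := by
  obtain ⟨hs, e, he, hpos⟩ := hB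
  by_contra! hww
  have hue : B e u ≠ 0 := fun h0 => by
    have := hpos u (by rintro rfl; simp at hu) h0
    linarith
  have hz0 : B e w • u - B e u • w ≠ 0 := by
    intro h0
    have h1 : B u (B e w • u - B e u • w) = 0 := by rw [h0]; simp
    simp only [map_sub, map_smul, smul_eq_mul, h, mul_zero, sub_zero] at h1
    have h2 : B e w = 0 := by
      rcases mul_eq_zero.mp h1 with h2 | h2
      · exact h2
      · linarith
    rw [h2, zero_smul, zero_sub, neg_eq_zero] at h0
    rcases smul_eq_zero.mp h0 with h3 | h3
    · exact hue h3
    · exact hw h3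
  have h1 := hpos _ hz0 (by simp; ring)
  have h2 : B w u = 0 := by rw [hs, h]
  simp only [map_sub, map_smul, sub_apply, smul_apply,
    smul_eq_mul, h, h2] at h1
  nlinarith [mul_nonneg (sq_nonneg (B e w)) (neg_nonneg.2 hu.le),
    mul_nonneg (sq_nonneg (B e u)) (neg_nonneg.2 hww)]

lemma IsLorentzForm.ne_zero_of_causal (hB : IsLorentzForm B) {u w : E} (hu : B u u < 0)
    (hw : w ≠ 0) (hww : B w w ≤ 0) : B w u ≠ 0 := fun h => by
  have := hB.pos_of_orthogonal hu hw (by rw [hB.1, h])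
  linarith

lemma IsLorentzForm.neg_of_timelike_causal (hB : IsLorentzForm B) {f u w : E} (hf : B f f < 0)
    (hu : u ∈ timelikeCone B f) (hw : w ∈ causalCone B f) : B u w < 0 := by
  obtain ⟨hu1, hu2⟩ := hu
  obtain ⟨hw1, hw2⟩ := hw
  by_contra! h
  set z := B u f • w - B w f • u with hz
  have h0 : B f z = 0 := by simp [hz, hB.1 f w, hB.1 f u]; ring
  have hzz : B z z = (B u f) ^ 2 * B w w + (B w f) ^ 2 * B u u - 2 * (B u f * B w f) * B u w := by
    simp [hz, hB.1 w u]; ring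
  have h1 : B z z < 0 := by
    rw [hzz]
    have : 0 < B u f * B w f := mul_pos_of_neg_of_neg hu2 hw2
    have : 0 < (B w f) ^ 2 := by have := hw2.ne; positivity
    nlinarith [mul_nonneg (sq_nonneg (B u f)) (neg_nonneg.2 hw1)]
  have hz0 : z ≠ 0 := by rintro h2; rw [h2] at h1; simp at h1
  linarith [hB.pos_of_orthogonal hf hz0 h0]

/-- The sum of two non-proportional causal vectors of the same cone is timelike. -/
lemma IsLorentzForm.add_mem_timelikeCone (hB : IsLorentzForm B) {f u w : E} (hf : B f f < 0)
    (hu : u ∈ causalCone B f) (hw : w ∈ causalCone B f) (h : ∀ k : ℝ, 0 < k → w ≠ k • u) :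
    u + w ∈ timelikeCone B f := by
  obtain ⟨hu1, hu2⟩ := hu
  obtain ⟨hw1, hw2⟩ := hw
  have huw : B u w < 0 := by
    by_contra! h'
    set z := B u f • w - B w f • u with hz
    have h0 : B f z = 0 := by simp [hz, hB.1 f w, hB.1 f u]; ring
    have hzz : B z z = (B u f) ^ 2 * B w w + (B w f) ^ 2 * B u u
        - 2 * (B u f * B w f) * B u w := by
      simp [hz, hB.1 w u]; ring
    have h1 : B z z ≤ 0 := by
      rw [hzz]
      have : 0 < B u f * B w f := mul_pos_of_neg_of_neg hu2 hw2
      nlinarith [mul_nonneg (sq_nonneg (B u f)) (neg_nonneg.2 hw1),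
        mul_nonneg (sq_nonneg (B w f)) (neg_nonneg.2 hu1)]
    have hz0 : z ≠ 0 := by
      intro h2
      refine h (B w f / B u f) (div_pos_of_neg_of_neg hw2 hu2) ?_
      have h3 : B u f • w = B w f • u := sub_eq_zero.mp h2
      rw [div_eq_inv_mul, mul_smul, ← h3, smul_smul,
        inv_mul_cancel₀ hu2.ne, one_smul]
    linarith [hB.pos_of_orthogonal hf hz0 h0]
  refine ⟨?_, by simp; linarith⟩
  simp [hB.1 w u]; linarith

lemma IsLorentzForm.nondegenerate (hB : IsLorentzForm B) {v : E} (h : ∀ w, B v w = 0) : v = 0 := by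
  by_contra hv
  obtain ⟨e, he, hpos⟩ := hB.2
  have := hpos v hv (by rw [hB.1, h])
  rw [h v] at this
  exact lt_irrefl _ this

lemma smul_mem_timelikeCone {f v : E} {k : ℝ} (hk : 0 < k) (hv : v ∈ timelikeCone B f) :
    k • v ∈ timelikeCone B f := by
  obtain ⟨h1, h2⟩ := hv
  constructor
  · simp; rw [← mul_assoc]; exact mul_neg_of_pos_of_neg (by positivity) h1
  · simp; exact mul_neg_of_pos_of_neg hk h2

lemma smul_mem_causalCone {f v : E} {k : ℝ} (hk : 0 < k) (hv : v ∈ causalCone B f) :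
    k • v ∈ causalCone B f := by
  obtain ⟨h1, h2⟩ := hv
  constructor
  · simp; rw [← mul_assoc]; exact mul_nonpos_of_nonneg_of_nonpos (by positivity) h1
  · simp; exact mul_neg_of_pos_of_neg hk h2

lemma mem_timelikeCone_smul_iff {f v : E} {k : ℝ} (hk : 0 < k) :
    k • v ∈ timelikeCone B f ↔ v ∈ timelikeCone B f := by
  refine ⟨fun h => ?_, smul_mem_timelikeCone hk⟩
  have := smul_mem_timelikeCone (inv_pos.2 hk) h
  rwa [smul_smul, inv_mul_cancel₀ hk.ne', one_smul] at this

end LorentzForm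

end Spacetimes

set_option maxSynthPendingDepth 3

namespace Spacetimes

/-! ### The geodesic equation in coordinates -/

section Spray

variable {E : Type*} [NormedAddCommGroup E] [NormedSpace ℝ E]

/-- Christoffel symbols of the first kind of a metric in coordinates. -/
noncomputable def christoffelOf (G : E → E →L[ℝ] E →L[ℝ] ℝ) (y u v w : E) : ℝ :=
  (1 / 2 : ℝ) * (fderiv ℝ G y u v w + fderiv ℝ G y v u w - fderiv ℝ G y w u v)

/-- The linear form `w ↦ Γ(v, v; w)`. -/
noncomputable def christoffelForm (G : E → E →L[ℝ] E →L[ℝ] ℝ) (y v : E) : E →L[ℝ] ℝ :=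
  fderiv ℝ G y v v - (1 / 2 : ℝ) • ((fderiv ℝ G y).flip v).flip v

lemma christoffelForm_apply (G : E → E →L[ℝ] E →L[ℝ] ℝ) (y v w : E) :
    christoffelForm G y v w = christoffelOf G y v v w := by
  simp [christoffelForm, christoffelOf]; ring

/-- The acceleration prescribed by the geodesic equation. -/
noncomputable def spray (G : E → E →L[ℝ] E →L[ℝ] ℝ) (y v : E) : E :=
  -(G y).inverse (christoffelForm G y v)

/-- The geodesic equation as a first-order system. -/
noncomputable def geodesicField (G : E → E →L[ℝ] E →L[ℝ] ℝ) (z : E × E) : E × E :=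
  (z.2, spray G z.1 z.2)

/-- A smooth field of Lorentzian forms on an open set. -/
structure IsLorentzMetricOn (G : E → E →L[ℝ] E →L[ℝ] ℝ) (U : Set E) : Prop where
  isOpen : IsOpen U
  contDiffOn : ContDiffOn ℝ ∞ G U
  lorentz : ∀ y ∈ U, IsLorentzForm (G y)

lemma spray_zero (G : E → E →L[ℝ] E →L[ℝ] ℝ) (y : E) : spray G y 0 = 0 := by
  simp [spray, christoffelForm]

lemma spray_smul (G : E → E →L[ℝ] E →L[ℝ] ℝ) (y v : E) (k : ℝ) :
    spray G y (k • v) = (k * k) • spray G y v := by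
  have : christoffelForm G y (k • v) = (k * k) • christoffelForm G y v := by
    ext w
    simp [christoffelForm]; ring
  rw [spray, this, map_smul, spray, smul_neg]

variable [FiniteDimensional ℝ E] {G : E → E →L[ℝ] E →L[ℝ] ℝ} {U : Set E}

lemma IsLorentzForm.exists_equiv {B : E →L[ℝ] E →L[ℝ] ℝ} (hB : IsLorentzForm B) :
    ∃ e : E ≃L[ℝ] (E →L[ℝ] ℝ), (e : E →L[ℝ] (E →L[ℝ] ℝ)) = B := by
  have hinj : Function.Injective (B : E →ₗ[ℝ] (E →L[ℝ] ℝ)) := by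
    rw [injective_iff_map_eq_zero]
    intro v hv
    exact hB.nondegenerate fun w => by
      have : B v = 0 := hv
      rw [this]; rfl
  have hdim : Module.finrank ℝ E = Module.finrank ℝ (E →L[ℝ] ℝ) := by
    rw [← (LinearMap.toContinuousLinearMap (𝕜 := ℝ) (E := E) (F' := ℝ)).finrank_eq]
    exact (Subspace.dual_finrank_eq (K := ℝ) (V := E)).symm
  refine ⟨(LinearMap.linearEquivOfInjective _ hinj hdim).toContinuousLinearEquiv, ?_⟩
  ext v w
  rfl

lemma IsLorentzMetricOn.spray_spec (hG : IsLorentzMetricOn G U) {y : E} (hy : y ∈ U) (v w : E) :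
    G y (spray G y v) w = -christoffelOf G y v v w := by
  obtain ⟨e, he⟩ := (hG.lorentz y hy).exists_equiv
  rw [spray, map_neg, neg_apply, ← he, ContinuousLinearMap.inverse_equiv]
  simp [christoffelForm_apply]

lemma IsLorentzMetricOn.eq_spray (hG : IsLorentzMetricOn G U) {y : E} (hy : y ∈ U) {a v : E}
    (h : ∀ w, G y a w + christoffelOf G y v v w = 0) : a = spray G y v := by
  rw [← sub_eq_zero]
  refine (hG.lorentz y hy).nondegenerate fun w => ?_
  rw [map_sub, sub_apply, hG.spray_spec hy]
  linarith [h w]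

lemma IsLorentzMetricOn.contDiffOn_fderiv (hG : IsLorentzMetricOn G U) :
    ContDiffOn ℝ ∞ (fderiv ℝ G) U :=
  hG.contDiffOn.fderiv_of_isOpen hG.isOpen (by simp)

lemma IsLorentzMetricOn.contDiffOn_geodesicField [CompleteSpace E] (hG : IsLorentzMetricOn G U) :
    ContDiffOn ℝ ∞ (geodesicField G) (U ×ˢ univ) := by
  have hfst : ContDiffOn ℝ ∞ (Prod.fst : E × E → E) (U ×ˢ univ) := contDiffOn_fst
  have hsnd : ContDiffOn ℝ ∞ (Prod.snd : E × E → E) (U ×ˢ univ) := contDiffOn_snd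
  have hmaps : MapsTo (Prod.fst : E × E → E) (U ×ˢ univ) U := fun z hz => hz.1
  have hD : ContDiffOn ℝ ∞ (fun z : E × E => fderiv ℝ G z.1) (U ×ˢ univ) :=
    hG.contDiffOn_fderiv.comp hfst hmaps
  have hflip : ContDiffOn ℝ ∞ (fun z : E × E => (fderiv ℝ G z.1).flip) (U ×ˢ univ) :=
    (ContinuousLinearMap.flipₗᵢ ℝ E E (E →L[ℝ] ℝ)).toContinuousLinearEquiv.contDiff.comp_contDiffOn
      hD
  have hflip2 : ContDiffOn ℝ ∞ (fun z : E × E => ((fderiv ℝ G z.1).flip z.2).flip)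
      (U ×ˢ univ) :=
    (ContinuousLinearMap.flipₗᵢ ℝ E E ℝ).toContinuousLinearEquiv.contDiff.comp_contDiffOn
      (hflip.clm_apply hsnd)
  have hform : ContDiffOn ℝ ∞ (fun z : E × E => christoffelForm G z.1 z.2) (U ×ˢ univ) :=
    ((hD.clm_apply hsnd).clm_apply hsnd).sub ((hflip2.clm_apply hsnd).const_smul _)
  have hinv : ContDiffOn ℝ ∞ (fun z : E × E => (G z.1).inverse) (U ×ˢ univ) := by
    intro z hz
    obtain ⟨e, he⟩ := (hG.lorentz z.1 hz.1).exists_equiv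
    have h1 : ContDiffAt ℝ ∞ (ContinuousLinearMap.inverse : (E →L[ℝ] (E →L[ℝ] ℝ)) → _) (G z.1) :=
      he ▸ contDiffAt_map_inverse e
    exact h1.comp_contDiffWithinAt z ((hG.contDiffOn.comp hfst hmaps) z hz)
  exact hsnd.prodMk (hinv.clm_apply hform).neg

end Spray

end Spacetimes

set_option maxSynthPendingDepth 3

namespace Spacetimes

section Flow

set_option linter.unusedSectionVars false

variable {E : Type*} [NormedAddCommGroup E] [NormedSpace ℝ E]

/-- A flow of the geodesic equation for a short time `τ`, for initial data near `(y₀, 0)`, that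
differs from the flow of straight lines by a map with small Lipschitz constant. -/
structure LocalGeodesicFlow (G : E → E →L[ℝ] E →L[ℝ] ℝ) (U : Set E) (y₀ : E) (κ : ℝ) where
  /-- the time for which the flow is defined -/
  τ : ℝ
  /-- the radius of the ball in which the flow lives -/
  R : ℝ
  /-- a Lipschitz constant of the geodesic field -/
  K : NNReal
  /-- the flow -/
  Z : E × E → ℝ → E × E
  τ_pos : 0 < τ
  τ_le : τ ≤ 1
  R_pos : 0 < R
  ball_subset : Metric.closedBall y₀ R ⊆ U
  lipschitz : LipschitzOnWith K (geodesicField G) (Metric.closedBall (y₀, 0) R)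
  init : ∀ z ∈ Metric.closedBall (y₀, (0 : E)) (R / 2), Z z 0 = z
  mem : ∀ z ∈ Metric.closedBall (y₀, (0 : E)) (R / 2), ∀ t ∈ Icc 0 τ,
    Z z t ∈ Metric.closedBall (y₀, 0) R
  deriv : ∀ z ∈ Metric.closedBall (y₀, (0 : E)) (R / 2), ∀ t ∈ Icc 0 τ,
    HasDerivWithinAt (Z z) (geodesicField G (Z z t)) (Icc 0 τ) t
  dist_le : ∀ z ∈ Metric.closedBall (y₀, (0 : E)) (R / 2),
    ∀ z' ∈ Metric.closedBall (y₀, (0 : E)) (R / 2), ∀ t ∈ Icc 0 τ,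
      dist (Z z t) (Z z' t) ≤ 2 * dist z z'
  near : ∀ y ∈ Metric.closedBall y₀ (R / 2), ∀ v ∈ Metric.closedBall (0 : E) (R / 2),
    ∀ v' ∈ Metric.closedBall (0 : E) (R / 2),
      ‖(Z (y, v) τ).1 - (Z (y, v') τ).1 - τ • (v - v')‖ ≤ κ * τ * ‖v - v'‖

lemma mk_mem_closedBall {y₀ y v : E} {r : ℝ} (hy : y ∈ Metric.closedBall y₀ r)
    (hv : v ∈ Metric.closedBall (0 : E) r) : (y, v) ∈ Metric.closedBall (y₀, (0 : E)) r := by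
  rw [← closedBall_prod_same]; exact ⟨hy, hv⟩

lemma hasDerivWithinAt_fst {f : ℝ → E × E} {f' : E × E} {s : Set ℝ} {t : ℝ}
    (h : HasDerivWithinAt f f' s t) : HasDerivWithinAt (fun t => (f t).1) f'.1 s t :=
  (ContinuousLinearMap.fst ℝ E E).hasFDerivAt.comp_hasDerivWithinAt t h

lemma hasDerivWithinAt_snd {f : ℝ → E × E} {f' : E × E} {s : Set ℝ} {t : ℝ}
    (h : HasDerivWithinAt f f' s t) : HasDerivWithinAt (fun t => (f t).2) f'.2 s t :=
  (ContinuousLinearMap.snd ℝ E E).hasFDerivAt.comp_hasDerivWithinAt t h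

lemma exists_flow_of_lipschitzOnWith {F : Type*} [NormedAddCommGroup F] [NormedSpace ℝ F]
    [CompleteSpace F] {X : F → F} {z₀ : F} (h₀ : X z₀ = 0) {K : NNReal} {R τ : ℝ} (hR : 0 < R)
    (hτ : 0 < τ) (hKτ : K * τ ≤ 1 / 2) (hX : LipschitzOnWith K X (Metric.closedBall z₀ R)) :
    ∀ z ∈ Metric.closedBall z₀ (R / 2), ∃ α : ℝ → F, α 0 = z ∧ ∀ t ∈ Icc 0 τ,
      α t ∈ Metric.closedBall z₀ R ∧ HasDerivWithinAt α (X (α t)) (Icc 0 τ) t := by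
  intro z hz
  let R' : NNReal := ⟨R, hR.le⟩
  have hpl : IsPicardLindelof (fun _ => X) (tmin := 0) (tmax := τ) ⟨0, ⟨le_rfl, hτ.le⟩⟩ z₀
      R' (R' / 2) (K * R') K := by
    refine IsPicardLindelof.of_time_independent (fun x hx => ?_) hX ?_
    · have h1 := hX.norm_sub_le hx (Metric.mem_closedBall_self hR.le)
      rw [h₀, sub_zero] at h1
      refine h1.trans ?_
      rw [NNReal.coe_mul]
      gcongr
      exact mem_closedBall_iff_norm.1 hx
    · have : max (τ - 0) ((0 : ℝ) - 0) = τ := by simp [hτ.le]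
      have hR' : (R' : ℝ) = R := rfl
      simp only [this, NNReal.coe_mul, NNReal.coe_div, hR', NNReal.coe_ofNat]
      nlinarith
  have hz' : z ∈ Metric.closedBall z₀ (R' / 2 : NNReal) := hz
  obtain ⟨α, hα⟩ := ODE.FunSpace.exists_isFixedPt_next hpl hz'
  have h0 : α.compProj 0 = z := by
    have := ODE.FunSpace.compProj_val (α := α) (t := ⟨0, ⟨le_rfl, hτ.le⟩⟩)
    rw [show α.compProj 0 = α ⟨0, ⟨le_rfl, hτ.le⟩⟩ from this, ← hα, ODE.FunSpace.next_apply₀]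
  refine ⟨α.compProj, h0, fun t ht => ⟨α.compProj_mem_closedBall hpl.mul_max_le, ?_⟩⟩
  apply ODE.hasDerivWithinAt_picard_Icc (f := fun _ => X) ⟨le_rfl, hτ.le⟩ hpl.continuousOn_uncurry
    α.continuous_compProj.continuousOn (fun _ ht' ↦ α.compProj_mem_closedBall hpl.mul_max_le)
    z ht |>.congr_of_mem _ ht
  intro t' ht'
  nth_rw 1 [← hα]
  rw [ODE.FunSpace.compProj_of_mem ht', ODE.FunSpace.next_apply]

variable [FiniteDimensional ℝ E] {G : E → E →L[ℝ] E →L[ℝ] ℝ} {U : Set E}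

theorem IsLorentzMetricOn.exists_localGeodesicFlow [CompleteSpace E] (hG : IsLorentzMetricOn G U)
    {y₀ : E} (hy₀ : y₀ ∈ U) {κ : ℝ} (hκ : 0 < κ) {R₀ : ℝ} (hR₀ : 0 < R₀) :
    ∃ Φ : LocalGeodesicFlow G U y₀ κ, Φ.R ≤ R₀ := by
  have hU : U ×ˢ (univ : Set E) ∈ 𝓝 (y₀, (0 : E)) :=
    (hG.isOpen.prod isOpen_univ).mem_nhds ⟨hy₀, trivial⟩
  have hX : ContDiffAt ℝ 1 (geodesicField G) (y₀, 0) :=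
    (hG.contDiffOn_geodesicField.contDiffAt hU).of_le (by simp)
  obtain ⟨K, s, hs, hl⟩ := hX.exists_lipschitzOnWith
  obtain ⟨R₁, hR₁, hsub⟩ := Metric.nhds_basis_closedBall.mem_iff.1 (inter_mem hs hU)
  set R := min R₁ R₀ with hRdef
  have hR : 0 < R := lt_min hR₁ hR₀
  have hsub' : Metric.closedBall (y₀, (0 : E)) R ⊆ s ∩ U ×ˢ univ :=
    (Metric.closedBall_subset_closedBall (min_le_left _ _)).trans hsub
  have hl' := hl.mono (hsub'.trans inter_subset_left)
  set τ := min (1 / 8) (κ / 2) / (K + 1 : ℝ) with hτdef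
  have hK1 : (0 : ℝ) < K + 1 := by positivity
  have hτ : 0 < τ := by positivity
  have hτK : τ * (K + 1) = min (1 / 8) (κ / 2) := div_mul_cancel₀ _ hK1.ne'
  have hK0 : (0 : ℝ) ≤ K := K.2
  have hτ1 : τ ≤ 1 := by nlinarith [min_le_left (1 / 8 : ℝ) (κ / 2)]
  have hKτ : K * τ ≤ 1 / 8 := by nlinarith [min_le_left (1 / 8 : ℝ) (κ / 2)]
  have hKκ : 2 * K * τ ≤ κ := by nlinarith [min_le_right (1 / 8 : ℝ) (κ / 2)]
  have h₀ : geodesicField G (y₀, 0) = 0 := by simp [geodesicField, spray_zero]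
  have hex := exists_flow_of_lipschitzOnWith h₀ hR hτ (by linarith) hl'
  choose! Z hZ0 hZ using hex
  have hcont : ∀ z ∈ Metric.closedBall (y₀, (0 : E)) (R / 2), ContinuousOn (Z z) (Icc 0 τ) :=
    fun z hz t ht => (hZ z hz t ht).2.continuousWithinAt
  have hright : ∀ z ∈ Metric.closedBall (y₀, (0 : E)) (R / 2), ∀ t ∈ Ico 0 τ,
      HasDerivWithinAt (Z z) (geodesicField G (Z z t)) (Ici t) t := fun z hz t ht =>
    (hZ z hz t (Ico_subset_Icc_self ht)).2.mono_of_mem_nhdsWithin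
      (mem_of_superset (Icc_mem_nhdsGE ht.2) (Icc_subset_Icc_left ht.1))
  have hdist : ∀ z ∈ Metric.closedBall (y₀, (0 : E)) (R / 2),
      ∀ z' ∈ Metric.closedBall (y₀, (0 : E)) (R / 2), ∀ t ∈ Icc 0 τ,
      dist (Z z t) (Z z' t) ≤ 2 * dist z z' := by
    intro z hz z' hz' t ht
    have h1 := dist_le_of_trajectories_ODE_of_mem (v := fun _ => geodesicField G)
      (s := fun _ => Metric.closedBall (y₀, (0 : E)) R) (K := K) (fun _ _ => hl') (hcont z hz)
      (hright z hz) (fun t ht => (hZ z hz t (Ico_subset_Icc_self ht)).1) (hcont z' hz')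
      (hright z' hz') (fun t ht => (hZ z' hz' t (Ico_subset_Icc_self ht)).1)
      (δ := dist z z') (by rw [hZ0 z hz, hZ0 z' hz']) t ht
    have h2 : Real.exp (K * (t - 0)) ≤ 2 := by
      rw [← Real.le_log_iff_exp_le (by norm_num)]
      have := Real.log_two_gt_d9
      have : K * (t - 0) ≤ K * τ := by gcongr; linarith [ht.2]
      linarith
    nlinarith [dist_nonneg (x := z) (y := z')]
  refine ⟨⟨τ, R, K, Z, hτ, hτ1, hR, ?_, hl', hZ0, fun z hz t ht => (hZ z hz t ht).1,
    fun z hz t ht => (hZ z hz t ht).2, hdist, ?_⟩, min_le_right _ _⟩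
  · intro y hy
    exact (hsub' (mk_mem_closedBall hy (Metric.mem_closedBall_self hR.le))).2.1
  · intro y hy v hv v' hv'
    have hz := mk_mem_closedBall hy hv
    have hz' := mk_mem_closedBall hy hv'
    have hd : dist (y, v) (y, v') = ‖v - v'‖ := by
      rw [Prod.dist_eq, dist_self, dist_eq_norm]; simp
    have hvel : ∀ t ∈ Icc 0 τ, ‖((Z (y, v) t).2 - (Z (y, v') t).2) - (v - v')‖
        ≤ 2 * K * ‖v - v'‖ * τ := by
      intro t ht
      have h1 := norm_image_sub_le_of_norm_deriv_le_segment'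
        (f := fun t => (Z (y, v) t).2 - (Z (y, v') t).2)
        (f' := fun t => (geodesicField G (Z (y, v) t)).2 - (geodesicField G (Z (y, v') t)).2)
        (C := 2 * K * ‖v - v'‖) (a := 0) (b := τ)
        (fun t ht => (hasDerivWithinAt_snd (hZ _ hz t ht).2).sub
          (hasDerivWithinAt_snd (hZ _ hz' t ht).2))
        (fun t ht => by
          have ht' := Ico_subset_Icc_self ht
          have h2 := hl'.dist_le_mul _ (hZ _ hz t ht').1 _ (hZ _ hz' t ht').1
          have h3 := hdist _ hz _ hz' t ht'
          rw [dist_eq_norm] at h2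
          rw [hd] at h3
          calc _ ≤ _ := norm_snd_le (geodesicField G (Z (y, v) t) - geodesicField G (Z (y, v') t))
            _ ≤ _ := h2
            _ ≤ K * (2 * ‖v - v'‖) := by gcongr
            _ = _ := by ring) t ht
      simp only [hZ0 _ hz, hZ0 _ hz'] at h1
      refine h1.trans ?_
      have : 0 ≤ 2 * K * ‖v - v'‖ := by positivity
      nlinarith [ht.2]
    have h1 := norm_image_sub_le_of_norm_deriv_le_segment'
      (f := fun t => (Z (y, v) t).1 - (Z (y, v') t).1 - t • (v - v'))
      (f' := fun t => (Z (y, v) t).2 - (Z (y, v') t).2 - (1 : ℝ) • (v - v'))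
      (C := 2 * K * ‖v - v'‖ * τ) (a := 0) (b := τ)
      (fun t ht => ((hasDerivWithinAt_fst (hZ _ hz t ht).2).sub
        (hasDerivWithinAt_fst (hZ _ hz' t ht).2)).sub
        ((hasDerivWithinAt_id t _).smul_const _))
      (fun t ht => by rw [one_smul]; exact hvel t (Ico_subset_Icc_self ht)) τ ⟨hτ.le, le_rfl⟩
    simp only [hZ0 _ hz, hZ0 _ hz', sub_self, zero_smul, sub_zero] at h1
    refine h1.trans ?_
    have : 0 ≤ ‖v - v'‖ * τ := by positivity
    nlinarith

end Flow

end Spacetimes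

set_option maxSynthPendingDepth 3

namespace Spacetimes

section Gauss

set_option linter.unusedSectionVars false

lemma exists_taylor_bound {F : Type*} [NormedAddCommGroup F] [NormedSpace ℝ F] {f : F → ℝ}
    {Ω s : Set F} (hΩ : IsOpen Ω) (hf : ContDiffOn ℝ 2 f Ω) (hs : IsCompact s) (hc : Convex ℝ s)
    (hsΩ : s ⊆ Ω) :
    ∃ C : ℝ, 0 ≤ C ∧ ∀ x ∈ s, ∀ y ∈ s, |f y - f x - fderiv ℝ f x (y - x)| ≤ C * ‖y - x‖ ^ 2 := by
  have h1 : ContDiffOn ℝ 1 (fderiv ℝ f) Ω := hf.fderiv_of_isOpen hΩ (by norm_num)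
  have h2 : ContinuousOn (fderiv ℝ (fderiv ℝ f)) Ω := h1.continuousOn_fderiv_of_isOpen hΩ le_rfl
  obtain ⟨C, hC⟩ := hs.exists_bound_of_continuousOn (h2.mono hsΩ)
  have hlip : ∀ x ∈ s, ∀ y ∈ s, ‖fderiv ℝ f y - fderiv ℝ f x‖ ≤ C * ‖y - x‖ := fun x hx y hy =>
    hc.norm_image_sub_le_of_norm_fderiv_le (fun z hz => ((h1.differentiableOn one_ne_zero) z
      (hsΩ hz)).differentiableAt (hΩ.mem_nhds (hsΩ hz))) hC hx hy
  refine ⟨|C|, abs_nonneg _, fun x hx y hy => ?_⟩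
  have hseg : segment ℝ x y ⊆ s := hc.segment_subset hx hy
  have := (convex_segment x y).norm_image_sub_le_of_norm_fderiv_le' (f := f)
    (φ := fderiv ℝ f x) (C := |C| * ‖y - x‖)
    (fun z hz => ((hf.differentiableOn two_ne_zero) z
      (hsΩ (hseg hz))).differentiableAt (hΩ.mem_nhds (hsΩ (hseg hz)))) (fun z hz => by
      refine (hlip x hx z (hseg hz)).trans ?_
      have h3 : ‖z - x‖ ≤ ‖y - x‖ := by
        obtain ⟨θ, hθ, rfl⟩ := (segment_eq_image' ℝ x y ▸ hz)
        simp only [add_sub_cancel_left, norm_smul]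
        have : ‖θ‖ ≤ 1 := by rw [Real.norm_of_nonneg hθ.1]; exact hθ.2
        exact mul_le_of_le_one_left (norm_nonneg _) this
      calc C * ‖z - x‖ ≤ |C| * ‖z - x‖ := by gcongr; exact le_abs_self C
        _ ≤ _ := by gcongr) (left_mem_segment ℝ x y) (right_mem_segment ℝ x y)
  rw [Real.norm_eq_abs] at this
  linarith [this, sq (‖y - x‖), mul_assoc |C| ‖y - x‖ ‖y - x‖]

variable {E : Type*} [NormedAddCommGroup E] [NormedSpace ℝ E]
  {G : E → E →L[ℝ] E →L[ℝ] ℝ} {U : Set E}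

lemma IsLorentzMetricOn.hasFDerivAt (hG : IsLorentzMetricOn G U) {y : E} (hy : y ∈ U) :
    HasFDerivAt G (fderiv ℝ G y) y :=
  ((hG.contDiffOn.differentiableOn (by simp) y hy).differentiableAt
    (hG.isOpen.mem_nhds hy)).hasFDerivAt

lemma IsLorentzMetricOn.symm (hG : IsLorentzMetricOn G U) {y : E} (hy : y ∈ U) (v w : E) :
    G y v w = G y w v := (hG.lorentz y hy).1 v w

/-- Derivative of the product `g(a, b)` along a curve `x`. -/
lemma IsLorentzMetricOn.hasDerivWithinAt (hG : IsLorentzMetricOn G U) {x a b : ℝ → E}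
    {x' a' b' : E} {s : Set ℝ} {t : ℝ} (hx : x t ∈ U) (h : HasDerivWithinAt x x' s t)
    (ha : HasDerivWithinAt a a' s t) (hb : HasDerivWithinAt b b' s t) :
    HasDerivWithinAt (fun t => G (x t) (a t) (b t))
      (fderiv ℝ G (x t) x' (a t) (b t) + G (x t) a' (b t) + G (x t) (a t) b') s t := by
  have h1 := (((hG.hasFDerivAt hx).comp_hasDerivWithinAt t h).clm_apply ha).clm_apply hb
  simpa using h1

variable [FiniteDimensional ℝ E]

lemma IsLorentzMetricOn.contDiffOn_energy (hG : IsLorentzMetricOn G U) :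
    ContDiffOn ℝ ∞ (fun z : E × E => (1 / 2 : ℝ) * G z.1 z.2 z.2) (U ×ˢ univ) := by
  have h1 : ContDiffOn ℝ ∞ (fun z : E × E => G z.1) (U ×ˢ univ) :=
    hG.contDiffOn.comp contDiffOn_fst (fun z hz => hz.1)
  exact contDiffOn_const.mul ((h1.clm_apply contDiffOn_snd).clm_apply contDiffOn_snd)

lemma IsLorentzMetricOn.fderiv_energy (hG : IsLorentzMetricOn G U) {z : E × E} (hz : z.1 ∈ U)
    (w : E × E) : fderiv ℝ (fun z : E × E => (1 / 2 : ℝ) * G z.1 z.2 z.2) z w =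
      (1 / 2 : ℝ) * fderiv ℝ G z.1 w.1 z.2 z.2 + G z.1 z.2 w.2 := by
  have h1 : HasFDerivAt (fun z : E × E => G z.1)
      ((fderiv ℝ G z.1).comp (ContinuousLinearMap.fst ℝ E E)) z :=
    (hG.hasFDerivAt hz).comp z hasFDerivAt_fst
  have h2 := ((h1.clm_apply hasFDerivAt_snd).clm_apply hasFDerivAt_snd).const_mul (1 / 2 : ℝ)
  rw [h2.fderiv]
  simp [hG.symm hz w.2 z.2]
  ring

variable {y₀ : E} {κ : ℝ}

namespace LocalGeodesicFlow

variable (Φ : LocalGeodesicFlow G U y₀ κ)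

/-- The exponential map of the flow. -/
def exp (y v : E) : E := (Φ.Z (y, v) Φ.τ).1

/-- The end velocity of the geodesic that the exponential map follows. -/
def endVelocity (y v : E) : E := (Φ.Z (y, v) Φ.τ).2

variable {Φ}

lemma fst_mem {z : E × E} (hz : z ∈ Metric.closedBall (y₀, (0 : E)) (Φ.R / 2)) {t : ℝ}
    (ht : t ∈ Icc 0 Φ.τ) : (Φ.Z z t).1 ∈ U := by
  have := Φ.mem z hz t ht
  rw [← closedBall_prod_same] at this
  exact Φ.ball_subset this.1

lemma continuousOn {z : E × E} (hz : z ∈ Metric.closedBall (y₀, (0 : E)) (Φ.R / 2)) :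
    ContinuousOn (Φ.Z z) (Icc 0 Φ.τ) := fun t ht => (Φ.deriv z hz t ht).continuousWithinAt

lemma energy_eq (hG : IsLorentzMetricOn G U) {z : E × E}
    (hz : z ∈ Metric.closedBall (y₀, (0 : E)) (Φ.R / 2)) {t : ℝ} (ht : t ∈ Icc 0 Φ.τ) :
    G (Φ.Z z t).1 (Φ.Z z t).2 (Φ.Z z t).2 = G z.1 z.2 z.2 := by
  have hd : ∀ t ∈ Icc 0 Φ.τ, HasDerivWithinAt (fun t => G (Φ.Z z t).1 (Φ.Z z t).2 (Φ.Z z t).2) 0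
      (Icc 0 Φ.τ) t := by
    intro t ht
    have h1 := Φ.deriv z hz t ht
    have hU := fst_mem hz ht
    have h2 := hG.hasDerivWithinAt hU (hasDerivWithinAt_fst h1) (hasDerivWithinAt_snd h1)
      (hasDerivWithinAt_snd h1)
    convert h2 using 1
    simp only [geodesicField]
    rw [hG.symm hU (Φ.Z z t).2 (spray _ _ _), hG.spray_spec hU, christoffelOf]
    ring
  have := constant_of_has_deriv_right_zero (fun t ht => (hd t ht).continuousWithinAt)
    (fun t ht => (hd t (Ico_subset_Icc_self ht)).mono_of_mem_nhdsWithin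
      (mem_of_superset (Icc_mem_nhdsGE ht.2) (Icc_subset_Icc_left ht.1))) t ht
  rw [this, Φ.init z hz]

lemma mem_timelikeCone (hG : IsLorentzMetricOn G U) {F : E → E} (hF : ContinuousOn F U)
    (hFt : ∀ y ∈ U, G y (F y) (F y) < 0) {z : E × E}
    (hz : z ∈ Metric.closedBall (y₀, (0 : E)) (Φ.R / 2)) (hzt : z.2 ∈ timelikeCone (G z.1) (F z.1))
    {t : ℝ} (ht : t ∈ Icc 0 Φ.τ) :
    (Φ.Z z t).2 ∈ timelikeCone (G (Φ.Z z t).1) (F (Φ.Z z t).1) := by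
  have hen : ∀ t ∈ Icc 0 Φ.τ, G (Φ.Z z t).1 (Φ.Z z t).2 (Φ.Z z t).2 < 0 := fun t ht => by
    rw [energy_eq hG hz ht]; exact hzt.1
  refine ⟨hen t ht, ?_⟩
  have hmaps : MapsTo (fun t => (Φ.Z z t).1) (Icc 0 Φ.τ) U := fun t ht => fst_mem hz ht
  have hc : ContinuousOn (fun t => G (Φ.Z z t).1 (Φ.Z z t).2 (F (Φ.Z z t).1)) (Icc 0 Φ.τ) :=
    ((hG.contDiffOn.continuousOn.comp (continuousOn hz).fst hmaps).clm_apply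
      (continuousOn hz).snd).clm_apply (hF.comp (continuousOn hz).fst hmaps)
  by_contra! h
  have h0 : G (Φ.Z z 0).1 (Φ.Z z 0).2 (F (Φ.Z z 0).1) ≤ 0 := by
    rw [Φ.init z hz]; exact hzt.2.le
  obtain ⟨s, hs, hs0⟩ := intermediate_value_Icc ht.1 (hc.mono (Icc_subset_Icc_right ht.2)) ⟨h0, h⟩
  have hs' : s ∈ Icc 0 Φ.τ := Icc_subset_Icc_right ht.2 hs
  have hsU := fst_mem hz hs'
  refine (hG.lorentz _ hsU).ne_zero_of_causal (hFt _ hsU) ?_ (hen s hs').le hs0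
  rintro h2
  have := hen s hs'
  rw [h2] at this
  simp at this

lemma exp_zero {y : E} (hy : y ∈ Metric.closedBall y₀ (Φ.R / 2)) : Φ.exp y 0 = y := by
  have hR := Φ.R_pos
  have hz := mk_mem_closedBall hy (Metric.mem_closedBall_self (x := (0 : E)) (by positivity))
  have h0 : geodesicField G (y, 0) = 0 := by simp [geodesicField, spray_zero]
  have h := dist_le_of_trajectories_ODE_of_mem (v := fun _ => geodesicField G)
    (s := fun _ => Metric.closedBall (y₀, (0 : E)) Φ.R) (K := Φ.K) (f := Φ.Z (y, 0))
    (g := fun _ => (y, 0)) (a := 0) (b := Φ.τ) (δ := 0)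
    (fun _ _ => Φ.lipschitz) (continuousOn hz)
    (fun t ht => (Φ.deriv _ hz t (Ico_subset_Icc_self ht)).mono_of_mem_nhdsWithin
      (mem_of_superset (Icc_mem_nhdsGE ht.2) (Icc_subset_Icc_left ht.1)))
    (fun t ht => Φ.mem _ hz t (Ico_subset_Icc_self ht)) continuousOn_const
    (fun t ht => by rw [h0]; exact hasDerivWithinAt_const ..)
    (fun t ht => Metric.closedBall_subset_closedBall (by linarith) hz)
    (by rw [Φ.init _ hz, dist_self]) Φ.τ ⟨Φ.τ_pos.le, le_rfl⟩
  rw [zero_mul, dist_le_zero] at h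
  rw [exp, h]

lemma dist_exp_le {y y' v v' : E} (hy : y ∈ Metric.closedBall y₀ (Φ.R / 2))
    (hv : v ∈ Metric.closedBall (0 : E) (Φ.R / 2)) (hy' : y' ∈ Metric.closedBall y₀ (Φ.R / 2))
    (hv' : v' ∈ Metric.closedBall (0 : E) (Φ.R / 2)) :
    dist (Φ.exp y v) (Φ.exp y' v') ≤ 2 * dist (y, v) (y', v') :=
  (le_max_left _ _).trans (Φ.dist_le _ (mk_mem_closedBall hy hv) _ (mk_mem_closedBall hy' hv') Φ.τ
    ⟨Φ.τ_pos.le, le_rfl⟩)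

lemma norm_sub_le (hκ : κ ≤ 1 / 2) {y v v' : E} (hy : y ∈ Metric.closedBall y₀ (Φ.R / 2))
    (hv : v ∈ Metric.closedBall (0 : E) (Φ.R / 2))
    (hv' : v' ∈ Metric.closedBall (0 : E) (Φ.R / 2)) :
    ‖v - v'‖ ≤ 2 / Φ.τ * ‖Φ.exp y v - Φ.exp y v'‖ := by
  have h1 := Φ.near y hy v hv v' hv'
  have hτ := Φ.τ_pos
  have h2 : ‖Φ.τ • (v - v')‖ = Φ.τ * ‖v - v'‖ := by rw [norm_smul, Real.norm_of_nonneg hτ.le]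
  have h3 : ‖Φ.τ • (v - v')‖ ≤ ‖Φ.exp y v - Φ.exp y v'‖ + κ * Φ.τ * ‖v - v'‖ := by
    have := norm_sub_norm_le (Φ.τ • (v - v')) (Φ.exp y v - Φ.exp y v')
    rw [norm_sub_rev (Φ.τ • (v - v'))] at this
    simp only [exp] at this ⊢
    linarith
  have h4 : κ * Φ.τ * ‖v - v'‖ ≤ 1 / 2 * Φ.τ * ‖v - v'‖ := by gcongr
  rw [div_mul_eq_mul_div, le_div_iff₀ hτ]
  linarith

lemma surjOn_exp [CompleteSpace E] (hκ0 : 0 ≤ κ) (hκ : κ ≤ 1 / 2) {y : E}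
    (hy : y ∈ Metric.closedBall y₀ (Φ.R / 2)) :
    SurjOn (Φ.exp y) (Metric.closedBall 0 (Φ.R / 2)) (Metric.closedBall y (Φ.τ * Φ.R / 4)) := by
  have hτ := Φ.τ_pos
  have hR := Φ.R_pos
  let f' : E →L[ℝ] E := Φ.τ • ContinuousLinearMap.id ℝ E
  let c : NNReal := ⟨κ * Φ.τ, by positivity⟩
  let inv : f'.NonlinearRightInverse :=
    ⟨fun v => Φ.τ⁻¹ • v, ⟨Φ.τ⁻¹, by positivity⟩, fun v => by
      rw [norm_smul, Real.norm_of_nonneg (by positivity)]; rfl, fun v => by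
      simp [f', smul_smul, inv_mul_cancel₀ hτ.ne']⟩
  have happ : ApproximatesLinearOn (Φ.exp y) f' (Metric.closedBall 0 (Φ.R / 2)) c := by
    intro v hv v' hv'
    exact Φ.near y hy v hv v' hv'
  have h := happ.surjOn_closedBall_of_nonlinearRightInverse inv (ε := Φ.R / 2) (b := 0)
    (by positivity) subset_rfl
  rw [exp_zero hy] at h
  refine h.mono subset_rfl (Metric.closedBall_subset_closedBall ?_)
  have h1 : ((inv.nnnorm : ℝ))⁻¹ = Φ.τ := inv_inv _
  have h2 : (c : ℝ) = κ * Φ.τ := rfl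
  rw [h1, h2]
  nlinarith [mul_pos hτ hR]

/-- A form of the Gauss lemma that does not need differentiability of the exponential map. -/
theorem exists_gauss_bound (Φ : LocalGeodesicFlow G U y₀ κ) (hG : IsLorentzMetricOn G U) :
    ∃ C : ℝ, 0 ≤ C ∧ ∀ y ∈ Metric.closedBall y₀ (Φ.R / 2),
      ∀ v ∈ Metric.closedBall (0 : E) (Φ.R / 2), ∀ v' ∈ Metric.closedBall (0 : E) (Φ.R / 2),
      |Φ.τ * ((1 / 2 : ℝ) * G y v' v' - (1 / 2 : ℝ) * G y v v)
        - G (Φ.exp y v) (Φ.endVelocity y v) (Φ.exp y v' - Φ.exp y v)| ≤ C * ‖v' - v‖ ^ 2 := by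
  have hball : Metric.closedBall (y₀, (0 : E)) Φ.R ⊆ U ×ˢ univ := by
    rw [← closedBall_prod_same]
    exact prod_mono Φ.ball_subset (subset_univ _)
  obtain ⟨C, hC0, hC⟩ := exists_taylor_bound (hG.isOpen.prod isOpen_univ)
    (hG.contDiffOn_energy.of_le (show ((2 : ℕ∞) : WithTop ℕ∞) ≤ ∞ from WithTop.coe_le_coe.2 le_top)) (isCompact_closedBall (y₀, (0 : E)) Φ.R)
    (convex_closedBall _ _) hball
  refine ⟨4 * C, by positivity, fun y hy v hv v' hv' => ?_⟩
  have hz := mk_mem_closedBall hy hv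
  have hz' := mk_mem_closedBall hy hv'
  have hd : dist (y, v') (y, v) = ‖v' - v‖ := by
    rw [Prod.dist_eq, dist_self, dist_eq_norm]; simp
  set A := (1 / 2 : ℝ) * G y v' v' - (1 / 2 : ℝ) * G y v v with hA
  have key := norm_image_sub_le_of_norm_deriv_le_segment'
    (f := fun t => t * A - G (Φ.Z (y, v) t).1 (Φ.Z (y, v) t).2 ((Φ.Z (y, v') t).1 - (Φ.Z (y, v) t).1))
    (f' := fun t => 1 * A - ((1 / 2 : ℝ) * fderiv ℝ G (Φ.Z (y, v) t).1
        ((Φ.Z (y, v') t).1 - (Φ.Z (y, v) t).1) (Φ.Z (y, v) t).2 (Φ.Z (y, v) t).2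
        + G (Φ.Z (y, v) t).1 (Φ.Z (y, v) t).2 ((Φ.Z (y, v') t).2 - (Φ.Z (y, v) t).2)))
    (C := 4 * C * ‖v' - v‖ ^ 2) (a := 0) (b := Φ.τ) (fun t ht => ?_) (fun t ht => ?_)
    Φ.τ ⟨Φ.τ_pos.le, le_rfl⟩
  · have h1 : (Φ.Z (y, v') 0).1 - (Φ.Z (y, v) 0).1 = 0 := by
      rw [Φ.init _ hz, Φ.init _ hz', sub_self]
    simp only [h1, zero_mul, map_zero, sub_zero] at key
    refine key.trans ?_
    have : 0 ≤ 4 * C * ‖v' - v‖ ^ 2 := by positivity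
    nlinarith [Φ.τ_le]
  · have hU := fst_mem hz ht
    have h1 := Φ.deriv _ hz t ht
    have h2 := Φ.deriv _ hz' t ht
    have h3 := hG.hasDerivWithinAt hU (hasDerivWithinAt_fst h1) (hasDerivWithinAt_snd h1)
      ((hasDerivWithinAt_fst h2).sub (hasDerivWithinAt_fst h1))
    have h4 := ((hasDerivWithinAt_id t (Icc 0 Φ.τ)).mul_const A).sub h3
    refine h4.congr_deriv ?_
    simp only [geodesicField, Pi.sub_apply]
    rw [hG.spray_spec hU, christoffelOf]
    ring
  · have ht' := Ico_subset_Icc_self ht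
    have h1 := hC _ (Φ.mem _ hz t ht') _ (Φ.mem _ hz' t ht')
    rw [hG.fderiv_energy (fst_mem hz ht'), energy_eq hG hz ht', energy_eq hG hz' ht'] at h1
    rw [one_mul, Real.norm_eq_abs]
    refine h1.trans ?_
    have h2 := Φ.dist_le _ hz' _ hz t ht'
    rw [hd, dist_eq_norm] at h2
    calc C * _ ^ 2 ≤ C * (2 * ‖v' - v‖) ^ 2 := by gcongr
      _ = _ := by ring

end LocalGeodesicFlow

end Gauss

end Spacetimes

set_option maxSynthPendingDepth 3

namespace Spacetimes

section Propagation

variable {E : Type*} [NormedAddCommGroup E] [NormedSpace ℝ E] [FiniteDimensional ℝ E]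
  [CompleteSpace E] {G : E → E →L[ℝ] E →L[ℝ] ℝ} {U : Set E} {y₀ : E} {κ : ℝ}

namespace LocalGeodesicFlow

/-- The points reached from `y` along future timelike geodesics of the flow. -/
def timelikeImage (Φ : LocalGeodesicFlow G U y₀ κ) (F : E → E) (y : E) : Set E :=
  Φ.exp y '' (Metric.closedBall 0 (Φ.R / 2) ∩ timelikeCone (G y) (F y))

/-- The inverse of the exponential map at `y`. -/
noncomputable def log (Φ : LocalGeodesicFlow G U y₀ κ) (y : E) : E → E :=
  Function.invFunOn (Φ.exp y) (Metric.closedBall 0 (Φ.R / 2))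

variable {Φ : LocalGeodesicFlow G U y₀ κ}

lemma log_mem (hκ0 : 0 ≤ κ) (hκ : κ ≤ 1 / 2) {y z : E} (hy : y ∈ Metric.closedBall y₀ (Φ.R / 2))
    (hz : z ∈ Metric.closedBall y (Φ.τ * Φ.R / 4)) :
    Φ.log y z ∈ Metric.closedBall 0 (Φ.R / 2) :=
  Function.invFunOn_mem (surjOn_exp hκ0 hκ hy hz)

lemma exp_log (hκ0 : 0 ≤ κ) (hκ : κ ≤ 1 / 2) {y z : E} (hy : y ∈ Metric.closedBall y₀ (Φ.R / 2))
    (hz : z ∈ Metric.closedBall y (Φ.τ * Φ.R / 4)) : Φ.exp y (Φ.log y z) = z :=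
  Function.invFunOn_eq (surjOn_exp hκ0 hκ hy hz)

lemma norm_log_sub_le (hκ0 : 0 ≤ κ) (hκ : κ ≤ 1 / 2) {y z z' : E}
    (hy : y ∈ Metric.closedBall y₀ (Φ.R / 2)) (hz : z ∈ Metric.closedBall y (Φ.τ * Φ.R / 4))
    (hz' : z' ∈ Metric.closedBall y (Φ.τ * Φ.R / 4)) :
    ‖Φ.log y z - Φ.log y z'‖ ≤ 2 / Φ.τ * ‖z - z'‖ := by
  have := norm_sub_le hκ hy (log_mem hκ0 hκ hy hz) (log_mem hκ0 hκ hy hz')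
  rwa [exp_log hκ0 hκ hy hz, exp_log hκ0 hκ hy hz'] at this

lemma continuousOn_log (hκ0 : 0 ≤ κ) (hκ : κ ≤ 1 / 2) {y : E}
    (hy : y ∈ Metric.closedBall y₀ (Φ.R / 2)) :
    ContinuousOn (Φ.log y) (Metric.closedBall y (Φ.τ * Φ.R / 4)) := by
  have hτ := Φ.τ_pos
  refine (LipschitzOnWith.of_dist_le_mul (K := ⟨2 / Φ.τ, by positivity⟩) ?_).continuousOn
  intro z hz z' hz'
  rw [dist_eq_norm, dist_eq_norm]
  exact norm_log_sub_le hκ0 hκ hy hz hz'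

/-- The differential of the energy function `z ↦ ½ g(log z, log z)`. -/
theorem hasFDerivWithinAt_energy_log (hG : IsLorentzMetricOn G U) (hκ0 : 0 ≤ κ) (hκ : κ ≤ 1 / 2)
    {y z : E} (hy : y ∈ Metric.closedBall y₀ (Φ.R / 2))
    (hz : z ∈ Metric.closedBall y (Φ.τ * Φ.R / 4)) :
    HasFDerivWithinAt (fun z => (1 / 2 : ℝ) * G y (Φ.log y z) (Φ.log y z))
      (Φ.τ⁻¹ • G z (Φ.endVelocity y (Φ.log y z))) (Metric.closedBall y (Φ.τ * Φ.R / 4)) z := by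
  obtain ⟨C, hC0, hC⟩ := Φ.exists_gauss_bound hG
  have hτ := Φ.τ_pos
  rw [hasFDerivWithinAt_iff_isLittleO]
  refine Asymptotics.IsBigO.trans_isLittleO (g := fun x => ‖x - z‖ ^ 2) ?_
    ((Asymptotics.isLittleO_pow_sub_sub z one_lt_two).mono nhdsWithin_le_nhds)
  refine Asymptotics.IsBigO.of_bound (Φ.τ⁻¹ * (C * (2 / Φ.τ) ^ 2)) ?_
  filter_upwards [self_mem_nhdsWithin] with x hx
  have h1 := hC y hy _ (log_mem hκ0 hκ hy hz) _ (log_mem hκ0 hκ hy hx)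
  rw [exp_log hκ0 hκ hy hz, exp_log hκ0 hκ hy hx] at h1
  have h2 := norm_log_sub_le hκ0 hκ hy hx hz
  rw [Real.norm_eq_abs, Real.norm_of_nonneg (by positivity : 0 ≤ ‖x - z‖ ^ 2)]
  have h3 : (1 / 2 : ℝ) * G y (Φ.log y x) (Φ.log y x) - (1 / 2 : ℝ) * G y (Φ.log y z) (Φ.log y z)
      - (Φ.τ⁻¹ • G z (Φ.endVelocity y (Φ.log y z))) (x - z)
      = Φ.τ⁻¹ * (Φ.τ * ((1 / 2 : ℝ) * G y (Φ.log y x) (Φ.log y x)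
        - (1 / 2 : ℝ) * G y (Φ.log y z) (Φ.log y z))
        - G z (Φ.endVelocity y (Φ.log y z)) (x - z)) := by
    rw [mul_sub, ← mul_assoc Φ.τ⁻¹ Φ.τ, inv_mul_cancel₀ hτ.ne', one_mul]
    rfl
  rw [h3, abs_mul, abs_of_nonneg (by positivity : 0 ≤ Φ.τ⁻¹), mul_assoc]
  gcongr
  refine h1.trans ?_
  calc C * ‖Φ.log y x - Φ.log y z‖ ^ 2 ≤ C * (2 / Φ.τ * ‖x - z‖) ^ 2 := by gcongr
    _ = _ := by ring

/-- A causal curve that starts in the timelike image of `y` stays there. -/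
theorem propagate (hG : IsLorentzMetricOn G U) {F : E → E} (hF : ContinuousOn F U)
    (hFt : ∀ y ∈ U, G y (F y) (F y) < 0) (hκ0 : 0 ≤ κ) (hκ : κ ≤ 1 / 2) {y : E}
    (hy : y ∈ Metric.closedBall y₀ (Φ.τ * Φ.R / 8)) {c : ℝ → E} {a b : ℝ} (hab : a ≤ b)
    (hc : ContinuousOn c (Icc a b))
    (hmem : ∀ t ∈ Icc a b, c t ∈ Metric.closedBall y₀ (Φ.τ * Φ.R / 8))
    (hder : ∀ t ∈ Ico a b, ∃ c' ∈ causalCone (G (c t)) (F (c t)), HasDerivWithinAt c c' (Ici t) t)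
    (ha : c a ∈ Φ.timelikeImage F y) : c b ∈ Φ.timelikeImage F y := by
  have hτ := Φ.τ_pos
  have hR := Φ.R_pos
  have hτ1 := Φ.τ_le
  have hτR : Φ.τ * Φ.R ≤ Φ.R := by nlinarith
  have hy' : y ∈ Metric.closedBall y₀ (Φ.R / 2) :=
    Metric.closedBall_subset_closedBall (by linarith) hy
  have hz : ∀ t ∈ Icc a b, c t ∈ Metric.closedBall y (Φ.τ * Φ.R / 4) := fun t ht => by
    have h1 := hmem t ht
    rw [Metric.mem_closedBall] at h1 hy ⊢
    linarith [dist_triangle_right (c t) y y₀]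
  set w : ℝ → E := fun t => Φ.log y (c t) with hw
  have hwc : ContinuousOn w (Icc a b) := (continuousOn_log hκ0 hκ hy').comp hc hz
  have hwm : ∀ t ∈ Icc a b, w t ∈ Metric.closedBall (0 : E) (Φ.R / 2) := fun t ht =>
    log_mem hκ0 hκ hy' (hz t ht)
  have hyU : y ∈ U := Φ.ball_subset (Metric.closedBall_subset_closedBall (by linarith) hy')
  set h : ℝ → ℝ := fun t => (1 / 2 : ℝ) * G y (w t) (w t) with hh
  have hhc : ContinuousOn h (Icc a b) :=
    continuousOn_const.mul ((continuousOn_const.clm_apply hwc).clm_apply hwc)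
  have hdir : ContinuousOn (fun t => G y (w t) (F y)) (Icc a b) :=
    (continuousOn_const.clm_apply hwc).clm_apply continuousOn_const
  have haw : w a ∈ timelikeCone (G y) (F y) := by
    obtain ⟨v, ⟨hv, hvt⟩, hva⟩ := ha
    have h1 := norm_sub_le hκ hy' (hwm a ⟨le_rfl, hab⟩) hv
    rw [hw, exp_log hκ0 hκ hy' (hz a ⟨le_rfl, hab⟩), hva, sub_self, norm_zero, mul_zero,
      norm_le_zero_iff, sub_eq_zero] at h1
    rw [show w a = v from h1]; exact hvt
  have hha : h a < 0 := by have := haw.1; simp only [hh]; linarith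
  set S : Set ℝ := {t | w t ∈ timelikeCone (G y) (F y) ∧ h t ≤ h a} with hS
  have hSeq : S ∩ Icc a b = {t ∈ Icc a b | G y (w t) (F y) ≤ 0 ∧ h t ≤ h a} := by
    ext t
    constructor
    · rintro ⟨⟨h1, h2⟩, h3⟩
      exact ⟨h3, h1.2.le, h2⟩
    · rintro ⟨h3, h1, h2⟩
      have h4 : G y (w t) (w t) < 0 := by simp only [hh] at h2 hha; linarith
      refine ⟨⟨⟨h4, lt_of_le_of_ne h1 ?_⟩, h2⟩, h3⟩
      refine (hG.lorentz y hyU).ne_zero_of_causal (hFt y hyU) ?_ h4.le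
      intro h0
      rw [h0] at h4
      simp at h4
  have hclosed : IsClosed (S ∩ Icc a b) := by
    rw [hSeq]
    have h1 := (hdir.preimage_isClosed_of_isClosed isClosed_Icc (isClosed_Iic (a := (0 : ℝ))))
    have h2 := (hhc.preimage_isClosed_of_isClosed isClosed_Icc (isClosed_Iic (a := h a)))
    convert h1.inter h2 using 1
    ext t
    simp only [mem_ofPred_eq, mem_inter_iff, mem_preimage, mem_Iic]
    tauto
  have hsub : Icc a b ⊆ S := by
    refine hclosed.Icc_subset_of_forall_mem_nhdsWithin ⟨haw, le_rfl⟩ ?_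
    rintro x ⟨⟨hx1, hx2⟩, hx⟩
    have hxI := Ico_subset_Icc_self hx
    have hev : ∀ᶠ t in 𝓝[≥] x, w t ∈ timelikeCone (G y) (F y) := by
      have hle : 𝓝[≥] x ≤ 𝓝[Icc a b] x :=
        nhdsWithin_le_of_mem (mem_of_superset (Icc_mem_nhdsGE hx.2) (Icc_subset_Icc_left hx.1))
      have h1 : Tendsto h (𝓝[≥] x) (𝓝 (h x)) := (hhc x hxI).mono_left hle
      have h2 : Tendsto (fun t => G y (w t) (F y)) (𝓝[≥] x) (𝓝 (G y (w x) (F y))) :=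
        (hdir x hxI).mono_left hle
      filter_upwards [h1.eventually_lt_const (show h x < 0 by linarith),
        h2.eventually_lt_const hx1.2] with t ht1 ht2
      refine ⟨?_, ht2⟩
      simp only [hh] at ht1
      linarith
    obtain ⟨δ, hδ, hδsub⟩ := mem_nhdsGE_iff_exists_Icc_subset.1
      (inter_mem hev (Icc_mem_nhdsGE hx.2))
    have hδx : x < δ := hδ
    have hIcc : Icc x δ ⊆ Icc a b := fun t ht =>
      ⟨hx.1.trans ht.1, (hδsub ht).2.2⟩
    have hder' : ∀ t ∈ Ico x δ, ∃ h' ≤ (0 : ℝ), HasDerivWithinAt h h' (Ici t) t := by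
      intro t ht
      have htI : t ∈ Icc a b := hIcc (Ico_subset_Icc_self ht)
      have htb : t < b := ht.2.trans_le (hIcc ⟨hδx.le, le_rfl⟩).2
      obtain ⟨c', hc', hd⟩ := hder t ⟨htI.1, htb⟩
      have hfd := hasFDerivWithinAt_energy_log hG hκ0 hκ hy' (hz t htI)
      have hd' : HasDerivWithinAt c c' (Icc t b) t := hd.mono Icc_subset_Ici_self
      have hcomp := hfd.comp_hasDerivWithinAt t hd' (fun s hs => hz s ⟨htI.1.trans hs.1, hs.2⟩)
      refine ⟨_, ?_, hcomp.mono_of_mem_nhdsWithin (Icc_mem_nhdsGE htb)⟩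
      have hwt : w t ∈ timelikeCone (G y) (F y) := (hδsub (Ico_subset_Icc_self ht)).1
      have hzz := mk_mem_closedBall hy' (hwm t htI)
      have hend := mem_timelikeCone hG hF hFt hzz hwt (t := Φ.τ) ⟨hτ.le, le_rfl⟩
      have hexp : (Φ.Z (y, w t) Φ.τ).1 = c t := exp_log hκ0 hκ hy' (hz t htI)
      rw [hexp] at hend
      have hcU : c t ∈ U := hexp ▸ fst_mem hzz ⟨hτ.le, le_rfl⟩
      have := (hG.lorentz _ hcU).neg_of_timelike_causal (hFt _ hcU) hend hc'
      have h5 : 0 < Φ.τ⁻¹ := by positivity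
      exact (mul_neg_of_pos_of_neg h5 this).le
    choose! h' hh' hhd using hder'
    have hle := image_le_of_deriv_right_le_deriv_boundary (f := h) (f' := h') (hhc.mono hIcc)
      hhd (B := fun _ => h a) (B' := fun _ => 0) hx2 continuousOn_const
      (fun t _ => hasDerivWithinAt_const ..) hh'
    refine mem_of_superset (Ioc_mem_nhdsGT hδx) fun t ht => ?_
    have ht' := Ioc_subset_Icc_self ht
    exact ⟨(hδsub ht').1, hle ht'⟩
  have hb := hsub (right_mem_Icc.2 hab)
  exact ⟨w b, ⟨hwm b ⟨hab, le_rfl⟩, hb.1⟩, exp_log hκ0 hκ hy' (hz b ⟨hab, le_rfl⟩)⟩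

end LocalGeodesicFlow

end Propagation

end Spacetimes

set_option maxSynthPendingDepth 3

namespace Spacetimes

section Cones

set_option linter.unusedSectionVars false

variable {E : Type*} [NormedAddCommGroup E] [NormedSpace ℝ E]
  {G : E → E →L[ℝ] E →L[ℝ] ℝ} {F : E → E} {U : Set E}

lemma IsLorentzForm.mem_timelikeCone_of_mem {B : E →L[ℝ] E →L[ℝ] ℝ} (hB : IsLorentzForm B)
    {e f z : E} (hf : B f f < 0) (he : e ∈ timelikeCone B f) (hz : z ∈ timelikeCone B e) :
    z ∈ timelikeCone B f :=
  ⟨hz.1, hB.neg_of_timelike_causal he.1 hz ⟨hf.le, by rw [hB.1]; exact he.2⟩⟩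

/-- A smooth field of Lorentzian forms with a continuous time orientation on an open set. -/
structure IsOrientedLorentzOn (G : E → E →L[ℝ] E →L[ℝ] ℝ) (F : E → E) (U : Set E) : Prop
    extends IsLorentzMetricOn G U where
  future_continuousOn : ContinuousOn F U
  future_timelike : ∀ y ∈ U, G y (F y) (F y) < 0

variable (hG : IsOrientedLorentzOn G F U)
include hG

lemma IsOrientedLorentzOn.continuousAt_metric {y₀ : E} (hy₀ : y₀ ∈ U) : ContinuousAt G y₀ :=
  hG.contDiffOn.continuousOn.continuousAt (hG.isOpen.mem_nhds hy₀)

lemma IsOrientedLorentzOn.continuousAt_future {y₀ : E} (hy₀ : y₀ ∈ U) : ContinuousAt F y₀ :=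
  hG.future_continuousOn.continuousAt (hG.isOpen.mem_nhds hy₀)

lemma IsOrientedLorentzOn.continuousAt_sq {y₀ : E} (hy₀ : y₀ ∈ U) (v : E) :
    ContinuousAt (fun z : E × E => G z.1 z.2 z.2) (y₀, v) :=
  (((hG.continuousAt_metric hy₀).comp continuousAt_fst).clm_apply continuousAt_snd).clm_apply
    continuousAt_snd

lemma IsOrientedLorentzOn.continuousAt_future_prod {y₀ : E} (hy₀ : y₀ ∈ U) (v : E) :
    ContinuousAt (fun z : E × E => G z.1 z.2 (F z.1)) (y₀, v) :=
  (((hG.continuousAt_metric hy₀).comp continuousAt_fst).clm_apply continuousAt_snd).clm_apply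
    ((hG.continuousAt_future hy₀).comp continuousAt_fst)

lemma IsOrientedLorentzOn.exists_timelike_ball {y₀ e : E} (hy₀ : y₀ ∈ U)
    (he : e ∈ timelikeCone (G y₀) (F y₀)) :
    ∃ η > 0, ∀ y ∈ Metric.ball y₀ η, y ∈ U ∧
      ∀ v ∈ Metric.ball e η, v ∈ timelikeCone (G y) (F y) := by
  have h1 := (hG.continuousAt_sq hy₀ e).eventually_lt_const he.1
  have h2 := (hG.continuousAt_future_prod hy₀ e).eventually_lt_const he.2
  have h3 : ∀ᶠ z : E × E in 𝓝 (y₀, e), z.1 ∈ U :=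
    continuousAt_fst.eventually (hG.isOpen.mem_nhds hy₀)
  obtain ⟨η, hη, h⟩ := Metric.eventually_nhds_iff_ball.1 (h1.and (h2.and h3))
  refine ⟨η, hη, fun y hy => ⟨(h (y, e) ?_).2.2, fun v hv => ?_⟩⟩
  · rw [← ball_prod_same]; exact ⟨hy, Metric.mem_ball_self hη⟩
  · have := h (y, v) (by rw [← ball_prod_same]; exact ⟨hy, hv⟩)
    exact ⟨this.1, this.2.1⟩

lemma IsOrientedLorentzOn.future_mem {y : E} (hy : y ∈ U) : F y ∈ timelikeCone (G y) (F y) :=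
  ⟨hG.future_timelike y hy, hG.future_timelike y hy⟩

lemma IsOrientedLorentzOn.mem_causalCone_of_limit {y₀ v : E} (hy₀ : y₀ ∈ U) (hv : v ≠ 0)
    {y w : ℕ → E} (hy : Tendsto y atTop (𝓝 y₀)) (hw : Tendsto w atTop (𝓝 v))
    (h : ∀ n, w n ∈ timelikeCone (G (y n)) (F (y n))) : v ∈ causalCone (G y₀) (F y₀) := by
  have h1 := (hG.continuousAt_sq hy₀ v).tendsto.comp (hy.prodMk_nhds hw)
  have h2 := (hG.continuousAt_future_prod hy₀ v).tendsto.comp (hy.prodMk_nhds hw)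
  have h3 : G y₀ v v ≤ 0 := le_of_tendsto' h1 fun n => (h n).1.le
  refine ⟨h3, lt_of_le_of_ne (le_of_tendsto' h2 fun n => (h n).2.le) ?_⟩
  exact (hG.lorentz y₀ hy₀).ne_zero_of_causal (hG.future_timelike y₀ hy₀) hv h3

variable [FiniteDimensional ℝ E]

/-- Near a point, causal vectors grow at a definite rate along a time coordinate. -/
lemma IsOrientedLorentzOn.exists_time_function {y₀ : E} (hy₀ : y₀ ∈ U) :
    ∃ k > 0, ∀ᶠ y in 𝓝 y₀, ∀ v ∈ causalCone (G y) (F y), k * ‖v‖ ≤ (-G y₀ (F y₀)) v := by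
  have hB := hG.lorentz y₀ hy₀
  have hsph : IsCompact (Metric.sphere (0 : E) 1) := isCompact_sphere 0 1
  set A : Set E := Metric.sphere (0 : E) 1 ∩ {v | G y₀ v v ≤ 0 ∧ G y₀ v (F y₀) ≤ 0} with hA
  have hAc : IsCompact A := by
    refine hsph.inter_right ?_
    have h1 : Continuous fun v => G y₀ v v := by fun_prop
    have h2 : Continuous fun v => G y₀ v (F y₀) := by fun_prop
    exact (isClosed_le h1 continuous_const).inter (isClosed_le h2 continuous_const)
  have hpos : ∀ v ∈ A, 0 < (-G y₀ (F y₀)) v := by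
    rintro v ⟨hv, h1, h2⟩
    have hv0 : v ≠ 0 := by rintro rfl; simp at hv
    have h3 := hB.ne_zero_of_causal (hG.future_timelike y₀ hy₀) hv0 h1
    rw [neg_apply, hB.1, neg_pos]
    exact lt_of_le_of_ne h2 h3
  obtain ⟨k, hk, hkA⟩ := hAc.exists_forall_le' (-G y₀ (F y₀)).continuous.continuousOn hpos
  refine ⟨k / 2, by positivity, ?_⟩
  have hev : ∀ᶠ y in 𝓝 y₀, ∀ v ∈ Metric.sphere (0 : E) 1,
      v ∈ causalCone (G y) (F y) → k / 2 < (-G y₀ (F y₀)) v := by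
    refine hsph.eventually_forall_of_forall_eventually fun v hv => ?_
    by_cases h1 : G y₀ v v ≤ 0
    · by_cases h2 : G y₀ v (F y₀) ≤ 0
      · have h3 : k / 2 < (-G y₀ (F y₀)) v := by linarith [hkA v ⟨hv, h1, h2⟩]
        have h4 : ContinuousAt (fun z : E × E => (-G y₀ (F y₀)) z.2) (y₀, v) := by fun_prop
        filter_upwards [h4.eventually_const_lt h3] with z hz _ using hz
      · filter_upwards [(hG.continuousAt_future_prod hy₀ v).eventually_const_lt (not_le.1 h2)]
          with z hz hz' using absurd hz'.2 (not_lt.2 hz.le)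
    · filter_upwards [(hG.continuousAt_sq hy₀ v).eventually_const_lt (not_le.1 h1)]
        with z hz hz' using absurd hz'.1 (not_le.2 hz)
  filter_upwards [hev] with y hy v hv
  have hv0 : 0 < ‖v‖ := by
    rw [norm_pos_iff]
    rintro rfl
    simpa using hv.2
  have h1 := hy (‖v‖⁻¹ • v) (by simp [norm_smul, hv0.ne']) (smul_mem_causalCone (by positivity) hv)
  rw [map_smul, smul_eq_mul, inv_mul_eq_div, lt_div_iff₀ hv0] at h1
  exact h1.le

/-- A deformation that turns causal vectors into timelike ones. -/
theorem IsOrientedLorentzOn.exists_pushUp {y₀ : E} (hy₀ : y₀ ∈ U) :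
    ∃ (ℓ : E →L[ℝ] ℝ) (C : ℝ), ∃ ρ > 0, ∀ y ∈ Metric.ball y₀ ρ, ∀ s : ℝ, s ≠ 0 →
      y + s • F y₀ ∈ Metric.ball y₀ ρ → ∀ v ∈ causalCone (G y) (F y),
      v + (|s| * (C * ℓ v)) • F y₀ ∈ timelikeCone (G (y + s • F y₀)) (F (y + s • F y₀)) := by
  set e := F y₀ with he
  obtain ⟨k, hk, hcone⟩ := hG.exists_time_function hy₀
  set ℓ : E →L[ℝ] ℝ := -G y₀ e with hℓ
  obtain ⟨η, hη, hη'⟩ := hG.exists_timelike_ball hy₀ (hG.future_mem hy₀)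
  obtain ⟨Λ, sΛ, hsΛ, hΛ⟩ := ((hG.contDiffOn.contDiffAt (hG.isOpen.mem_nhds hy₀)).of_le
    (show (1 : WithTop ℕ∞) ≤ ∞ by simp)).exists_lipschitzOnWith
  have hcross : ∀ᶠ y in 𝓝 y₀, ‖G y e - G y₀ e‖ < k / 2 := by
    have h1 : ContinuousAt (fun y => ‖G y e - G y₀ e‖) y₀ :=
      (((hG.continuousAt_metric hy₀).clm_apply continuousAt_const).sub continuousAt_const).norm
    exact h1.eventually_lt_const (by simp; positivity)
  have hb : ∀ᶠ y in 𝓝 y₀, y ∈ Metric.ball y₀ η := Metric.ball_mem_nhds y₀ hη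
  have hs' : ∀ᶠ y in 𝓝 y₀, y ∈ sΛ := hsΛ
  obtain ⟨ρ, hρ, hball⟩ := Metric.eventually_nhds_iff_ball.1
    (hcone.and (hcross.and (hb.and hs')))
  set C : ℝ := (Λ * ‖e‖ + 1) / k ^ 2 with hC
  have hC0 : 0 < C := by positivity
  refine ⟨ℓ, C, ρ, hρ, fun y hy s hs0 hy' v hv => ?_⟩
  have hs : 0 < |s| := abs_pos.2 hs0
  set y' := y + s • e with hy'def
  obtain ⟨hy1, -, -, hy4⟩ := hball y hy
  obtain ⟨-, hy2', hy3', hy4'⟩ := hball y' hy'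
  have hℓv := hy1 v hv
  have hy'U := (hη' y' hy3').1
  have het : e ∈ timelikeCone (G y') (F y') := (hη' y' hy3').2 e (Metric.mem_ball_self hη)
  have hB := hG.lorentz y' hy'U
  have hv0 : 0 < ‖v‖ := by
    rw [norm_pos_iff]
    rintro rfl
    simpa using hv.2
  have hℓ0 : 0 < ℓ v := lt_of_lt_of_le (by positivity) hℓv
  have hev : G y' e v ≤ -(k / 2) * ‖v‖ := by
    have h1 : ‖(G y' e - G y₀ e) v‖ ≤ k / 2 * ‖v‖ :=
      ((G y' e - G y₀ e).le_opNorm v).trans (by gcongr)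
    rw [Real.norm_eq_abs] at h1
    have h2 := (abs_le.1 h1).2
    simp only [hℓ, sub_apply, neg_apply] at h2 hℓv
    linarith
  have hvv : G y' v v ≤ Λ * (|s| * ‖e‖) * ‖v‖ ^ 2 := by
    have h1 : ‖(G y' - G y) v v‖ ≤ ‖G y' - G y‖ * ‖v‖ * ‖v‖ := (G y' - G y).le_opNorm₂ v v
    have h2 : ‖G y' - G y‖ ≤ Λ * (|s| * ‖e‖) := by
      have := hΛ.norm_sub_le hy4' hy4
      rwa [hy'def, add_sub_cancel_left, norm_smul, Real.norm_eq_abs] at this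
    rw [Real.norm_eq_abs] at h1
    have h3 := (abs_le.1 h1).2
    simp only [sub_apply] at h3
    have h4 := hv.1
    have h5 : ‖G y' - G y‖ * ‖v‖ * ‖v‖ ≤ Λ * (|s| * ‖e‖) * ‖v‖ * ‖v‖ := by gcongr
    nlinarith
  refine hB.mem_timelikeCone_of_mem (hG.future_timelike y' hy'U) het ⟨?_, ?_⟩
  · have hexp : G y' (v + (|s| * (C * ℓ v)) • e) (v + (|s| * (C * ℓ v)) • e) =
        G y' v v + 2 * (|s| * (C * ℓ v)) * G y' e v + (|s| * (C * ℓ v)) ^ 2 * G y' e e := by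
      simp [hB.1 v e]; ring
    rw [hexp]
    have h1 : (|s| * (C * ℓ v)) ^ 2 * G y' e e ≤ 0 :=
      mul_nonpos_of_nonneg_of_nonpos (sq_nonneg _) het.1.le
    have h2 : 2 * (|s| * (C * ℓ v)) * G y' e v ≤ 2 * (|s| * (C * (k * ‖v‖))) * (-(k / 2) * ‖v‖) := by
      have h3 : 2 * (|s| * (C * ℓ v)) * G y' e v ≤ 2 * (|s| * (C * ℓ v)) * (-(k / 2) * ‖v‖) := by
        gcongr
      refine h3.trans (mul_le_mul_of_nonpos_right (by gcongr) ?_)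
      have : 0 ≤ k / 2 * ‖v‖ := by positivity
      linarith
    have h4 : 2 * (|s| * (C * (k * ‖v‖))) * (-(k / 2) * ‖v‖) = -(|s| * (C * k ^ 2) * ‖v‖ ^ 2) := by
      ring
    have h5 : C * k ^ 2 = Λ * ‖e‖ + 1 := div_mul_cancel₀ _ (by positivity)
    rw [h4, h5] at h2
    have h6 : 0 < |s| * ‖v‖ ^ 2 := by positivity
    nlinarith
  · have h1 : G y' v e < 0 := by
      rw [hB.1]
      have : 0 < k / 2 * ‖v‖ := by positivity
      linarith
    have h2 : |s| * (C * ℓ v) * G y' e e < 0 := mul_neg_of_pos_of_neg (by positivity) het.1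
    simp only [map_add, map_smul, add_apply, smul_apply, smul_eq_mul]
    linarith

omit hG in
/-- A point slightly to the future of `y'` in a timelike direction lies in its timelike image. -/
theorem LocalGeodesicFlow.mem_timelikeImage [CompleteSpace E] {y₀ e : E} {κ : ℝ}
    {Φ : LocalGeodesicFlow G U y₀ κ} (hκ0 : 0 ≤ κ) (hκ : κ ≤ 1 / 2) {η : ℝ}
    (hη : ∀ y ∈ Metric.ball y₀ η, ∀ v ∈ Metric.ball e η, v ∈ timelikeCone (G y) (F y))
    (hκη : 2 * κ * ‖e‖ < η) {y : E} {δ : ℝ} (hδ : 0 < δ) (hy : y ∈ Metric.closedBall y₀ (Φ.R / 2))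
    (hyη : y ∈ Metric.ball y₀ η) (hδe : δ * ‖e‖ ≤ Φ.τ * Φ.R / 4) :
    y + δ • e ∈ Φ.timelikeImage F y := by
  have hτ := Φ.τ_pos
  have hz : y + δ • e ∈ Metric.closedBall y (Φ.τ * Φ.R / 4) := by
    rw [mem_closedBall_iff_norm, add_sub_cancel_left, norm_smul, Real.norm_of_nonneg hδ.le]
    exact hδe
  set w := Φ.log y (y + δ • e) with hw
  have hwm := LocalGeodesicFlow.log_mem hκ0 hκ hy hz
  have hew := LocalGeodesicFlow.exp_log hκ0 hκ hy hz
  refine ⟨w, ⟨hwm, ?_⟩, hew⟩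
  have hR := Φ.R_pos
  have h1 := Φ.near y hy w hwm 0 (Metric.mem_closedBall_self (by positivity))
  have h2 : (Φ.Z (y, w) Φ.τ).1 = y + δ • e := hew
  have h3 : (Φ.Z (y, 0) Φ.τ).1 = y := LocalGeodesicFlow.exp_zero hy
  rw [h2, h3, add_sub_cancel_left, sub_zero] at h1
  have hpos : 0 < Φ.τ / δ := by positivity
  rw [← mem_timelikeCone_smul_iff hpos]
  refine hη y hyη _ ?_
  rw [mem_ball_iff_norm]
  have h4 : (Φ.τ / δ) • w - e = δ⁻¹ • (Φ.τ • w - δ • e) := by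
    rw [smul_sub, smul_smul, smul_smul, inv_mul_cancel₀ hδ.ne', one_smul, div_eq_inv_mul]
  have h5 : ‖(Φ.τ / δ) • w - e‖ ≤ κ * ‖(Φ.τ / δ) • w‖ := by
    rw [h4, norm_smul, norm_smul, norm_sub_rev, Real.norm_of_nonneg (by positivity),
      Real.norm_of_nonneg hpos.le]
    calc δ⁻¹ * ‖δ • e - Φ.τ • w‖ ≤ δ⁻¹ * (κ * Φ.τ * ‖w‖) := by gcongr
      _ = κ * (Φ.τ / δ * ‖w‖) := by ring
  have h6 : ‖(Φ.τ / δ) • w‖ ≤ ‖(Φ.τ / δ) • w - e‖ + ‖e‖ := norm_le_norm_sub_add _ _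
  have h7 : ‖(Φ.τ / δ) • w‖ ≤ 2 * ‖e‖ := by nlinarith [norm_nonneg ((Φ.τ / δ) • w)]
  nlinarith

end Cones

end Spacetimes

noncomputable section

namespace Spacetimes

/-! ### Spacetimes in charts -/

section Charts

variable {d : ℕ} {M : Type*} [TopologicalSpace M] [ChartedSpace (Coord d) M]
  [IsManifold (𝓡 d) ∞ M] (g : LorentzStructure d M)

lemma contMDiffOn_coordVector (x₀ : M) (v : Coord d) :
    ContMDiffOn 𝓘(ℝ, Coord d) (𝓡 d).tangent ∞ (fun y => (⟨(extChartAt (𝓡 d) x₀).symm y,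
      mfderiv 𝓘(ℝ, Coord d) (𝓡 d) (extChartAt (𝓡 d) x₀).symm y v⟩ : TangentBundle (𝓡 d) M))
      (extChartAt (𝓡 d) x₀).target := by
  have hT : IsOpen (extChartAt (𝓡 d) x₀).target := isOpen_extChartAt_target x₀
  have h1 := (contMDiffOn_extChartAt_symm (I := 𝓡 d) (n := ∞) x₀).contMDiffOn_tangentMapWithin
    (m := ∞) (by simp) hT.uniqueMDiffOn
  have h2 : ContMDiff 𝓘(ℝ, Coord d) 𝓘(ℝ, Coord d).tangent ∞
      (fun y : Coord d => (⟨y, v⟩ : TangentBundle 𝓘(ℝ, Coord d) (Coord d))) := by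
    refine contMDiff_vectorSpace_iff_contDiff.2 ?_
    exact contDiff_const
  have h3 := h1.comp (h2.contMDiffOn (s := (extChartAt (𝓡 d) x₀).target)) (fun y hy => hy)
  refine h3.congr fun y hy => ?_
  simp only [Function.comp, tangentMapWithin]
  rw [mfderivWithin_of_isOpen hT hy]

lemma contDiffOn_coordMetric (x₀ : M) :
    ContDiffOn ℝ ∞ (coordMetric g x₀) (extChartAt (𝓡 d) x₀).target := by
  rw [contDiffOn_clm_apply]
  intro v
  rw [contDiffOn_clm_apply]
  intro w
  have h1 : ContMDiffOn 𝓘(ℝ, Coord d) ((𝓡 d).prod 𝓘(ℝ, Coord d →L[ℝ] Coord d →L[ℝ] ℝ)) ∞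
    (fun y => Bundle.TotalSpace.mk' (Coord d →L[ℝ] Coord d →L[ℝ] ℝ)
      (E := fun x : M => TangentSpace (𝓡 d) x →L[ℝ] TangentSpace (𝓡 d) x →L[ℝ] ℝ)
      ((extChartAt (𝓡 d) x₀).symm y) (g.metric ((extChartAt (𝓡 d) x₀).symm y)))
    (extChartAt (𝓡 d) x₀).target :=
    g.smooth.comp_contMDiffOn (contMDiffOn_extChartAt_symm (I := 𝓡 d) (n := ∞) x₀)
  have h2 := ContMDiffOn.clm_bundle_apply₂ (F₁ := Coord d) (F₂ := Coord d) (F₃ := ℝ)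
    (E₁ := fun x : M => TangentSpace (𝓡 d) x) (E₂ := fun x : M => TangentSpace (𝓡 d) x)
    (E₃ := Bundle.Trivial M ℝ) (b := (extChartAt (𝓡 d) x₀).symm)
    (ψ := fun y => g.metric ((extChartAt (𝓡 d) x₀).symm y)) h1
    (contMDiffOn_coordVector x₀ v) (contMDiffOn_coordVector x₀ w)
  intro y hy
  have h3 := h2 y hy
  rw [Bundle.contMDiffWithinAt_totalSpace] at h3
  exact h3.2.contDiffWithinAt
/-- The differential of the chart at `x₀`. -/
def chartDeriv (x₀ x : M) : TangentSpace (𝓡 d) x →L[ℝ] Coord d :=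
  mfderiv (𝓡 d) 𝓘(ℝ, Coord d) (extChartAt (𝓡 d) x₀) x

/-- The differential of the inverse of the chart at `x₀`. -/
def chartSymmDeriv (x₀ : M) (y : Coord d) :
    Coord d →L[ℝ] TangentSpace (𝓡 d) ((extChartAt (𝓡 d) x₀).symm y) :=
  mfderiv 𝓘(ℝ, Coord d) (𝓡 d) (extChartAt (𝓡 d) x₀).symm y

lemma chartDeriv_chartSymmDeriv (x₀ : M) {y : Coord d} (hy : y ∈ (extChartAt (𝓡 d) x₀).target)
    (v : Coord d) :
    chartDeriv x₀ ((extChartAt (𝓡 d) x₀).symm y) (chartSymmDeriv x₀ y v) = v := by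
  have := mfderiv_extChartAt_comp_mfderivWithin_extChartAt_symm (I := 𝓡 d) hy
  rw [ModelWithCorners.range_eq_univ, mfderivWithin_univ] at this
  exact DFunLike.congr_fun this v

lemma chartSymmDeriv_chartDeriv (x₀ : M) {y : Coord d} (hy : y ∈ (extChartAt (𝓡 d) x₀).target)
    (v : TangentSpace (𝓡 d) ((extChartAt (𝓡 d) x₀).symm y)) :
    chartSymmDeriv x₀ y (chartDeriv x₀ ((extChartAt (𝓡 d) x₀).symm y) v) = v := by
  have := mfderivWithin_extChartAt_symm_comp_mfderiv_extChartAt (I := 𝓡 d) hy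
  rw [ModelWithCorners.range_eq_univ, mfderivWithin_univ] at this
  exact DFunLike.congr_fun this v

lemma coordMetric_apply (x₀ : M) (y v w : Coord d) :
    coordMetric g x₀ y v w = g.metric ((extChartAt (𝓡 d) x₀).symm y)
      (chartSymmDeriv x₀ y v) (chartSymmDeriv x₀ y w) := rfl

/-- The time orientation in the chart at `x₀`. -/
def coordFuture (x₀ : M) (y : Coord d) : Coord d :=
  chartDeriv x₀ ((extChartAt (𝓡 d) x₀).symm y) (g.future ((extChartAt (𝓡 d) x₀).symm y))

lemma coordMetric_chartDeriv (x₀ : M) {y : Coord d} (hy : y ∈ (extChartAt (𝓡 d) x₀).target)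
    (v w : TangentSpace (𝓡 d) ((extChartAt (𝓡 d) x₀).symm y)) :
    coordMetric g x₀ y (chartDeriv x₀ _ v) (chartDeriv x₀ _ w) = g.metric _ v w := by
  rw [coordMetric_apply, chartSymmDeriv_chartDeriv x₀ hy, chartSymmDeriv_chartDeriv x₀ hy]

lemma chartDeriv_mem_timelikeCone_iff (x₀ : M) {x : M} (hx : x ∈ (extChartAt (𝓡 d) x₀).source)
    (v : TangentSpace (𝓡 d) x) :
    chartDeriv x₀ x v ∈ timelikeCone (coordMetric g x₀ (extChartAt (𝓡 d) x₀ x))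
      (coordFuture g x₀ (extChartAt (𝓡 d) x₀ x)) ↔ v ∈ futureTimelike g x := by
  obtain ⟨y, hy, rfl⟩ : ∃ y ∈ (extChartAt (𝓡 d) x₀).target, (extChartAt (𝓡 d) x₀).symm y = x :=
    ⟨_, (extChartAt (𝓡 d) x₀).map_source hx, (extChartAt (𝓡 d) x₀).left_inv hx⟩
  rw [(extChartAt (𝓡 d) x₀).right_inv hy]
  simp only [timelikeCone, futureTimelike, mem_ofPred_eq, coordFuture,
    coordMetric_chartDeriv g x₀ hy]

lemma chartDeriv_mem_causalCone_iff (x₀ : M) {x : M} (hx : x ∈ (extChartAt (𝓡 d) x₀).source)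
    (v : TangentSpace (𝓡 d) x) :
    chartDeriv x₀ x v ∈ causalCone (coordMetric g x₀ (extChartAt (𝓡 d) x₀ x))
      (coordFuture g x₀ (extChartAt (𝓡 d) x₀ x)) ↔ v ∈ futureCausal g x := by
  obtain ⟨y, hy, rfl⟩ : ∃ y ∈ (extChartAt (𝓡 d) x₀).target, (extChartAt (𝓡 d) x₀).symm y = x :=
    ⟨_, (extChartAt (𝓡 d) x₀).map_source hx, (extChartAt (𝓡 d) x₀).left_inv hx⟩
  rw [(extChartAt (𝓡 d) x₀).right_inv hy]
  simp only [causalCone, futureCausal, mem_ofPred_eq, coordFuture,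
    coordMetric_chartDeriv g x₀ hy]

lemma continuousOn_chartDeriv (x₀ : M) :
    ContinuousOn (fun p : TangentBundle (𝓡 d) M => chartDeriv x₀ p.1 p.2)
      {p | p.1 ∈ (extChartAt (𝓡 d) x₀).source} := by
  have hS : IsOpen (extChartAt (𝓡 d) x₀).source := isOpen_extChartAt_source x₀
  have h0 := contMDiffOn_extChartAt (I := 𝓡 d) (n := 1) (x := x₀)
  rw [← extChartAt_source (𝓡 d)] at h0
  have h1 := h0.continuousOn_tangentMapWithin le_rfl hS.uniqueMDiffOn
  have h2 : Continuous fun p : TangentBundle 𝓘(ℝ, Coord d) (Coord d) => p.2 :=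
    (contMDiff_snd_tangentBundle_modelSpace (I := 𝓘(ℝ, Coord d)) (n := 0)).continuous
  refine (h2.comp_continuousOn h1).congr fun p hp => ?_
  simp only [Function.comp, tangentMapWithin, chartDeriv]
  rw [mfderivWithin_of_isOpen hS hp]
  rfl

theorem isOrientedLorentzOn_coord (x₀ : M) :
    IsOrientedLorentzOn (coordMetric g x₀) (coordFuture g x₀) (extChartAt (𝓡 d) x₀).target where
  isOpen := isOpen_extChartAt_target x₀
  contDiffOn := contDiffOn_coordMetric g x₀
  lorentz := fun y hy => by
    refine ⟨fun v w => g.symm _ _ _, ?_⟩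
    obtain ⟨v, hv, hpos⟩ := g.signature ((extChartAt (𝓡 d) x₀).symm y)
    refine ⟨chartDeriv x₀ _ v, by rwa [coordMetric_chartDeriv g x₀ hy], fun w hw hvw => ?_⟩
    rw [← chartDeriv_chartSymmDeriv x₀ hy w, coordMetric_chartDeriv g x₀ hy] at hvw ⊢
    refine hpos _ (fun h => hw ?_) hvw
    rw [← chartDeriv_chartSymmDeriv x₀ hy w, h, map_zero]
  future_continuousOn := by
    refine (continuousOn_chartDeriv x₀).comp (g.future_continuous.comp_continuousOn
      (continuousOn_extChartAt_symm x₀)) fun y hy => ?_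
    exact (extChartAt (𝓡 d) x₀).map_target hy
  future_timelike := fun y hy => by
    rw [coordFuture, coordMetric_chartDeriv g x₀ hy]
    exact g.future_timelike _

lemma hasDerivWithinAt_chart (x₀ : M) {γ : ℝ → M} {s : Set ℝ} {t : ℝ}
    (hγ : MDifferentiableWithinAt 𝓘(ℝ, ℝ) (𝓡 d) γ s t)
    (ht : γ t ∈ (extChartAt (𝓡 d) x₀).source) :
    HasDerivWithinAt (fun τ => extChartAt (𝓡 d) x₀ (γ τ))
      (chartDeriv x₀ (γ t) (velocity γ s t)) s t := by
  rw [extChartAt_source] at ht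
  have h1 := (hasMFDerivAt_extChartAt (I := 𝓡 d) ht).mdifferentiableAt.hasMFDerivAt
  have h2 := h1.comp_hasMFDerivWithinAt t hγ.hasMFDerivWithinAt
  have h3 : HasFDerivWithinAt (fun τ => extChartAt (𝓡 d) x₀ (γ τ))
      ((chartDeriv x₀ (γ t)).comp (mfderivWithin 𝓘(ℝ, ℝ) (𝓡 d) γ s t) : ℝ →L[ℝ] Coord d) s t :=
    h2.hasFDerivWithinAt
  exact h3.hasDerivWithinAt

lemma velocity_eq_of_hasDerivWithinAt (x₀ : M) {σ : ℝ → Coord d} {σ' : Coord d} {s : Set ℝ} {t : ℝ}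
    (hs : UniqueDiffWithinAt ℝ s t) (hσ : HasDerivWithinAt σ σ' s t)
    (ht : σ t ∈ (extChartAt (𝓡 d) x₀).target) :
    velocity (fun τ => (extChartAt (𝓡 d) x₀).symm (σ τ)) s t = chartSymmDeriv x₀ (σ t) σ' := by
  have h1 := mdifferentiableWithinAt_extChartAt_symm (I := 𝓡 d) ht
  rw [ModelWithCorners.range_eq_univ, mdifferentiableWithinAt_univ] at h1
  have h2 := h1.hasMFDerivAt.comp_hasMFDerivWithinAt t hσ.hasFDerivWithinAt.hasMFDerivWithinAt
  have h3 := h2.mfderivWithin hs.uniqueMDiffWithinAt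
  have h4 := DFunLike.congr_fun h3 (1 : ℝ)
  refine Eq.trans h4 ?_
  change chartSymmDeriv x₀ (σ t) ((1 : ℝ) • σ') = _
  rw [one_smul]

/-- A `C¹` coordinate curve with timelike velocity is a timelike curve. -/
theorem isTimelikeCurve_of_coord (x₀ : M) {σ σ' : ℝ → Coord d} {a b : ℝ}
    (hσ : ContDiffOn ℝ 1 σ (Icc a b)) (hT : ∀ t ∈ Icc a b, σ t ∈ (extChartAt (𝓡 d) x₀).target)
    (hd : ∀ t ∈ Icc a b, HasDerivWithinAt σ (σ' t) (Icc a b) t)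
    (hc : ∀ t ∈ Icc a b, σ' t ∈ timelikeCone (coordMetric g x₀ (σ t)) (coordFuture g x₀ (σ t))) :
    IsTimelikeCurve g (fun t => (extChartAt (𝓡 d) x₀).symm (σ t)) (Icc a b) := by
  have hsm : ContMDiffOn 𝓘(ℝ, ℝ) (𝓡 d) 1 (fun t => (extChartAt (𝓡 d) x₀).symm (σ t))
      (Icc a b) :=
    (contMDiffOn_extChartAt_symm (I := 𝓡 d) (n := 1) x₀).comp hσ.contMDiffOn hT
  refine ⟨ordConnected_Icc, hsm.continuousOn, ∅, fun _ _ _ => by simp, fun a' b' hab hsub _ => ?_⟩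
  refine ⟨hsm.mono hsub, fun t ht => ?_⟩
  have htT := hT t (hsub ht)
  rw [velocity_eq_of_hasDerivWithinAt x₀ (uniqueDiffOn_Icc hab t ht)
    ((hd t (hsub ht)).mono hsub) htT, ← chartDeriv_mem_timelikeCone_iff g x₀
    ((extChartAt (𝓡 d) x₀).map_target htT), chartDeriv_chartSymmDeriv x₀ htT,
    (extChartAt (𝓡 d) x₀).right_inv htT]
  exact hc t (hsub ht)

end Charts

end Spacetimes

end

noncomputable section

namespace Spacetimes

/-! ### Operations on curves -/

section Curves

variable {d : ℕ} {M : Type*} [TopologicalSpace M] [ChartedSpace (Coord d) M]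
  {C : ∀ x : M, Set (TangentSpace (𝓡 d) x)} {γ γ' : ℝ → M} {s s' : Set ℝ} {a b c t : ℝ}

lemma mem_cone_congr {x x' : M} (h : x = x') {v v' : Coord d} (hv : v = v')
    (hm : (v : TangentSpace (𝓡 d) x) ∈ C x) : (v' : TangentSpace (𝓡 d) x') ∈ C x' := by
  subst h hv; exact hm

lemma velocity_mem_congr (h : EqOn γ γ' s) (ht : t ∈ s) (hv : velocity (d := d) γ s t ∈ C (γ t)) :
    velocity (d := d) γ' s t ∈ C (γ' t) := by
  have h1 : (velocity (d := d) γ s t : Coord d) = velocity (d := d) γ' s t :=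
    DFunLike.congr_fun (mfderivWithin_congr (I := 𝓘(ℝ, ℝ)) (I' := 𝓡 d)
      (fun x hx => (h hx).symm) (h ht).symm).symm (1 : ℝ)
  exact mem_cone_congr (C := C) (h ht) h1 hv

lemma velocity_eq_of_subset (hγ : MDifferentiableWithinAt 𝓘(ℝ, ℝ) (𝓡 d) γ s t) (hs : s' ⊆ s)
    (hu : UniqueDiffWithinAt ℝ s' t) : velocity (d := d) γ s' t = velocity γ s t := by
  have h := (hγ.hasMFDerivWithinAt.mono hs).mfderivWithin hu.uniqueMDiffWithinAt
  exact DFunLike.congr_fun h (1 : ℝ)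

lemma LocallyFiniteIn.mono {B : Set ℝ} (h : LocallyFiniteIn B s) (hs : s' ⊆ s) :
    LocallyFiniteIn B s' := fun a b hab => h a b (hab.trans hs)

lemma IsCurveIn.mono (h : IsCurveIn C γ s) (hs : s' ⊆ s) (hs' : s'.OrdConnected) :
    IsCurveIn C γ s' := by
  obtain ⟨-, hc, B, hB, hp⟩ := h
  exact ⟨hs', hc.mono hs, B, hB.mono hs, fun a b hab hsub => hp a b hab (hsub.trans hs)⟩

lemma IsCurveIn.congr (h : IsCurveIn C γ s) (he : EqOn γ γ' s) : IsCurveIn C γ' s := by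
  obtain ⟨hs, hc, B, hB, hp⟩ := h
  refine ⟨hs, hc.congr fun t ht => (he ht).symm, B, hB, fun a b hab hsub hd => ?_⟩
  obtain ⟨h1, h2⟩ := hp a b hab hsub hd
  exact ⟨h1.congr fun t ht => (he (hsub ht)).symm, fun t ht =>
    velocity_mem_congr (he.mono hsub) ht (h2 t ht)⟩

lemma IsCurveIn.union (hab : a ≤ b) (hbc : b ≤ c) (h : IsCurveIn C γ (Icc a b))
    (h' : IsCurveIn C γ (Icc b c)) : IsCurveIn C γ (Icc a c) := by
  obtain ⟨-, hc, B, hB, hp⟩ := h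
  obtain ⟨-, hc', B', hB', hp'⟩ := h'
  refine ⟨ordConnected_Icc, ?_, (B ∩ Icc a b) ∪ (B' ∩ Icc b c) ∪ {b}, ?_, ?_⟩
  · rw [← Icc_union_Icc_eq_Icc hab hbc]
    exact hc.union_of_isClosed hc' isClosed_Icc isClosed_Icc
  · intro _ _ _
    exact (((hB a b subset_rfl).union (hB' b c subset_rfl)).union (finite_singleton b)).subset
      inter_subset_left
  · intro u v huv hsub hd
    have hu := hsub (left_mem_Icc.2 huv.le)
    have hv := hsub (right_mem_Icc.2 huv.le)
    have hb : ¬ (u < b ∧ b < v) := fun hb => by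
      have : b ∈ Ioo u v ∩ (B ∩ Icc a b ∪ B' ∩ Icc b c ∪ {b}) := ⟨hb, Or.inr rfl⟩
      rw [hd] at this
      exact this
    rcases le_or_gt v b with hvb | hvb
    · have hsub' : Icc u v ⊆ Icc a b := Icc_subset_Icc hu.1 hvb
      refine hp u v huv hsub' (eq_empty_of_forall_notMem fun x hx => ?_)
      have : x ∈ Ioo u v ∩ (B ∩ Icc a b ∪ B' ∩ Icc b c ∪ {b}) :=
        ⟨hx.1, Or.inl (Or.inl ⟨hx.2, hsub' (Ioo_subset_Icc_self hx.1)⟩)⟩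
      rw [hd] at this
      exact this
    · have hbu : b ≤ u := not_lt.1 fun h => hb ⟨h, hvb⟩
      have hsub' : Icc u v ⊆ Icc b c := Icc_subset_Icc hbu hv.2
      refine hp' u v huv hsub' (eq_empty_of_forall_notMem fun x hx => ?_)
      have : x ∈ Ioo u v ∩ (B ∩ Icc a b ∪ B' ∩ Icc b c ∪ {b}) :=
        ⟨hx.1, Or.inl (Or.inr ⟨hx.2, hsub' (Ioo_subset_Icc_self hx.1)⟩)⟩
      rw [hd] at this
      exact this

lemma IsCurveIn.translate (δ : ℝ) (h : IsCurveIn C γ (Icc a b)) :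
    IsCurveIn C (fun t => γ (t + δ)) (Icc (a - δ) (b - δ)) := by
  obtain ⟨-, hc, B, hB, hp⟩ := h
  have hmaps : ∀ u v : ℝ, MapsTo (fun t => t + δ) (Icc u v) (Icc (u + δ) (v + δ)) :=
    fun u v t ht => ⟨by simpa using ht.1, by simpa using ht.2⟩
  refine ⟨ordConnected_Icc, hc.comp (by fun_prop) ?_, (fun t => t + δ) ⁻¹' (B ∩ Icc a b), ?_, ?_⟩
  · convert hmaps (a - δ) (b - δ) using 2 <;> ring
  · intro _ _ _
    exact ((hB a b subset_rfl).preimage ((add_left_injective δ).injOn)).subset inter_subset_left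
  · intro u v huv hsub hd
    have hu := hsub (left_mem_Icc.2 huv.le)
    have hv := hsub (right_mem_Icc.2 huv.le)
    have huv' : u + δ < v + δ := by linarith
    have hsub' : Icc (u + δ) (v + δ) ⊆ Icc a b :=
      Icc_subset_Icc (by linarith [hu.1]) (by linarith [hv.2])
    obtain ⟨h1, h2⟩ := hp (u + δ) (v + δ) huv' hsub' (eq_empty_of_forall_notMem fun x hx => by
      have : x - δ ∈ Ioo u v ∩ (fun t => t + δ) ⁻¹' (B ∩ Icc a b) :=
        ⟨⟨by linarith [hx.1.1], by linarith [hx.1.2]⟩, by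
          rw [mem_preimage, sub_add_cancel]
          exact ⟨hx.2, hsub' (Ioo_subset_Icc_self hx.1)⟩⟩
      rw [hd] at this
      exact this)
    have hadd : ContMDiff 𝓘(ℝ, ℝ) 𝓘(ℝ, ℝ) 1 (fun t : ℝ => t + δ) :=
      (contDiff_id.add contDiff_const).contMDiff
    refine ⟨h1.comp hadd.contMDiffOn (hmaps u v), fun t ht => ?_⟩
    have ht' := hmaps u v ht
    have hd1 : HasMFDerivWithinAt 𝓘(ℝ, ℝ) 𝓘(ℝ, ℝ) (fun t : ℝ => t + δ) (Icc u v) t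
        (ContinuousLinearMap.id ℝ ℝ) :=
      ((hasFDerivWithinAt_id t (Icc u v)).add_const δ).hasMFDerivWithinAt
    have hd2 := ((h1.mdifferentiableOn one_ne_zero) (t + δ) ht').hasMFDerivWithinAt
    have hd3 := (HasMFDerivWithinAt.comp (f := fun t : ℝ => t + δ)
      (u := Icc (u + δ) (v + δ)) t hd2 hd1 (hmaps u v)).mfderivWithin
      (uniqueDiffOn_Icc huv t ht).uniqueMDiffWithinAt
    have hvel : velocity (fun t => γ (t + δ)) (Icc u v) t = velocity γ (Icc (u + δ) (v + δ)) (t + δ) :=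
      DFunLike.congr_fun hd3 (1 : ℝ)
    rw [hvel]
    exact h2 (t + δ) ht'

/-- A piecewise `C¹` curve is `C¹` for a short time after each of its points. -/
lemma IsCurveIn.exists_right (h : IsCurveIn C γ s) (hab : a < b) (hs : Icc a b ⊆ s) :
    ∃ c, a < c ∧ c ≤ b ∧ ContMDiffOn 𝓘(ℝ, ℝ) (𝓡 d) 1 γ (Icc a c) ∧
      ∀ t ∈ Icc a c, velocity γ (Icc a c) t ∈ C (γ t) := by
  obtain ⟨-, -, B, hB, hp⟩ := h
  have hfin := hB a b hs
  have hclosed : IsClosed ((B ∩ Icc a b) \ {a}) := (hfin.subset sdiff_subset).isClosed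
  have hnhds : ((B ∩ Icc a b) \ {a})ᶜ ∈ 𝓝 a := hclosed.isOpen_compl.mem_nhds (by simp)
  obtain ⟨l, u, hau, hlu⟩ := mem_nhds_iff_exists_Ioo_subset.1 hnhds
  refine ⟨min b u, lt_min hab hau.2, min_le_left _ _, ?_⟩
  refine hp a (min b u) (lt_min hab hau.2) ((Icc_subset_Icc_right (min_le_left _ _)).trans hs) ?_
  refine eq_empty_of_forall_notMem fun x hx => ?_
  have hxu : x ∈ Ioo l u := ⟨hau.1.trans hx.1.1, hx.1.2.trans_le (min_le_right _ _)⟩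
  exact hlu hxu ⟨⟨hx.2, hx.1.1.le, hx.1.2.le.trans (min_le_left _ _)⟩, hx.1.1.ne'⟩

lemma hasDerivWithinAt_Ici_of_Icc {E : Type*} [NormedAddCommGroup E] [NormedSpace ℝ E] {f : ℝ → E}
    {f' : E} (h : HasDerivWithinAt f f' (Icc a b) t) (hat : a ≤ t) (htb : t < b) :
    HasDerivWithinAt f f' (Ici t) t :=
  h.mono_of_mem_nhdsWithin (mem_of_superset (Icc_mem_nhdsGE htb) (Icc_subset_Icc_left hat))

end Curves

section Joined

variable {d : ℕ} {M : Type*} [TopologicalSpace M] [ChartedSpace (Coord d) M]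
  [IsManifold (𝓡 d) ∞ M] {g : LorentzStructure d M}

lemma TimelikeJoined.trans {x y z : M} (h : TimelikeJoined g univ ∅ x y)
    (h' : TimelikeJoined g univ ∅ y z) : TimelikeJoined g univ ∅ x z := by
  obtain ⟨γ, a, b, hab, hγ, rfl, rfl, -⟩ := h
  obtain ⟨γ', a', b', hab', hγ', hy, rfl, -⟩ := h'
  have h2 := IsCurveIn.translate (a' - b) hγ'
  rw [show a' - (a' - b) = b by ring] at h2
  set c := b' - (a' - b) with hc
  have hbc : b < c := by rw [hc]; linarith
  set β : ℝ → M := fun t => if t ≤ b then γ t else γ' (t + (a' - b)) with hβ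
  have e1 : EqOn γ β (Icc a b) := fun t ht => by simp only [hβ]; rw [if_pos ht.2]
  have e2 : EqOn (fun t => γ' (t + (a' - b))) β (Icc b c) := fun t ht => by
    rcases ht.1.eq_or_lt with rfl | h
    · simp [hβ, hy]
    · simp only [hβ]; rw [if_neg (not_le.2 h)]
  refine ⟨β, a, c, hab.trans hbc, ((hγ.congr e1).union hab.le hbc.le (h2.congr e2)), ?_, ?_,
    fun _ _ => ⟨trivial, id⟩⟩
  · exact (e1 ⟨le_rfl, hab.le⟩).symm
  · rw [← e2 ⟨hbc.le, le_rfl⟩, hc]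
    simp

lemma TimelikeJoined.of_curve {γ : ℝ → M} {a b : ℝ} (hab : a < b)
    (h : IsTimelikeCurve g γ (Icc a b)) : TimelikeJoined g univ ∅ (γ a) (γ b) :=
  ⟨γ, a, b, hab, h, rfl, rfl, fun _ _ => ⟨trivial, id⟩⟩

/-- The right derivative, in a chart, of a causal curve. -/
lemma IsCausalCurve.exists_right_deriv {γ : ℝ → M} {s : Set ℝ} (h : IsCausalCurve g γ s) (x₀ : M)
    {t u : ℝ} (htu : t < u) (hs : Icc t u ⊆ s) (ht : γ t ∈ (extChartAt (𝓡 d) x₀).source) :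
    ∃ c' ∈ causalCone (coordMetric g x₀ (extChartAt (𝓡 d) x₀ (γ t)))
      (coordFuture g x₀ (extChartAt (𝓡 d) x₀ (γ t))),
      HasDerivWithinAt (fun τ => extChartAt (𝓡 d) x₀ (γ τ)) c' (Ici t) t := by
  obtain ⟨v, htv, -, h1, h2⟩ := IsCurveIn.exists_right h htu hs
  have h3 := hasDerivWithinAt_chart x₀ ((h1.mdifferentiableOn one_ne_zero) t
    (left_mem_Icc.2 htv.le)) ht
  exact ⟨_, (chartDeriv_mem_causalCone_iff g x₀ ht _).2 (h2 t (left_mem_Icc.2 htv.le)),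
    hasDerivWithinAt_Ici_of_Icc h3 le_rfl htv⟩

lemma IsTimelikeCurve.isCausalCurve {γ : ℝ → M} {s : Set ℝ} (h : IsTimelikeCurve g γ s) :
    IsCausalCurve g γ s := by
  obtain ⟨h1, h2, B, hB, hp⟩ := h
  exact ⟨h1, h2, B, hB, fun a b hab hs hd => ⟨(hp a b hab hs hd).1, fun t ht =>
    ⟨((hp a b hab hs hd).2 t ht).1.le, ((hp a b hab hs hd).2 t ht).2⟩⟩⟩

end Joined

end Spacetimes

end

noncomputable section

namespace Spacetimes

/-! ### Past sets -/

section PastSets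

variable {d : ℕ} {M : Type*} [TopologicalSpace M] [ChartedSpace (Coord d) M]
  [IsManifold (𝓡 d) ∞ M] {g : LorentzStructure d M}

/-- An open set that contains the chronological past of each of its points. -/
structure IsPastSet (g : LorentzStructure d M) (L : Set M) : Prop where
  isOpen : IsOpen L
  down : ∀ x y, TimelikeJoined g univ ∅ x y → y ∈ L → x ∈ L

/-- Short coordinate segments in nearly the same timelike direction are timelike. -/
lemma exists_timelike_segment (g : LorentzStructure d M) (x₀ : M) {y₀ e : Coord d}
    (hy₀ : y₀ ∈ (extChartAt (𝓡 d) x₀).target)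
    (he : e ∈ timelikeCone (coordMetric g x₀ y₀) (coordFuture g x₀ y₀)) :
    ∃ η > 0, ∀ y ∈ Metric.ball y₀ η, ∀ y' ∈ Metric.ball y₀ η, ∀ s > (0 : ℝ),
      s⁻¹ • (y' - y) ∈ Metric.ball e η → TimelikeJoined g univ ∅
        ((extChartAt (𝓡 d) x₀).symm y) ((extChartAt (𝓡 d) x₀).symm y') := by
  obtain ⟨η, hη, h⟩ := (isOrientedLorentzOn_coord g x₀).exists_timelike_ball hy₀ he
  refine ⟨η, hη, fun y hy y' hy' s hs he' => ?_⟩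
  set e' := s⁻¹ • (y' - y) with he'def
  have hy'e : y' = y + s • e' := by
    rw [he'def, smul_smul, mul_inv_cancel₀ hs.ne', one_smul, add_sub_cancel]
  have hσ : ∀ t ∈ Icc 0 s, y + t • e' ∈ Metric.ball y₀ η := by
    intro t ht
    have h1 := (convex_ball y₀ η).add_smul_sub_mem hy hy' (t := t / s)
      ⟨by have := ht.1; positivity, (div_le_one hs).2 ht.2⟩
    rwa [he'def, smul_smul, ← div_eq_mul_inv]
  have hd : ∀ t ∈ Icc 0 s, HasDerivWithinAt (fun t : ℝ => y + t • e') e' (Icc 0 s) t := by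
    intro t _
    simpa using ((hasDerivWithinAt_id t (Icc 0 s)).smul_const e').const_add y
  have hsm : ContDiff ℝ 1 (fun t : ℝ => y + t • e') :=
    contDiff_const.add (contDiff_id.smul contDiff_const)
  have := TimelikeJoined.of_curve hs (isTimelikeCurve_of_coord g x₀ hsm.contDiffOn
    (fun t ht => (h _ (hσ t ht)).1) hd (fun t ht => (h _ (hσ t ht)).2 e' he'))
  simpa [← hy'e] using this

lemma tendsto_slope_of_hasDerivWithinAt {E : Type*} [NormedAddCommGroup E] [NormedSpace ℝ E]
    {f : ℝ → E} {f' : E} {t : ℝ} (h : HasDerivWithinAt f f' (Ici t) t) :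
    Tendsto (fun s => (s - t)⁻¹ • (f s - f t)) (𝓝[>] t) (𝓝 f') := by
  have := (hasDerivWithinAt_iff_tendsto_slope.1 h)
  rw [Ici_sdiff_left] at this
  exact this

/-- The chronological past of a set is open. -/
theorem isPastSet_pastOf (g : LorentzStructure d M) (W : Set M) : IsPastSet g (pastOf g W) := by
  have hdown : ∀ x y, TimelikeJoined g univ ∅ x y → y ∈ pastOf g W → x ∈ pastOf g W := by
    intro x y hxy hy
    simp only [pastOf, mem_iUnion] at hy ⊢
    obtain ⟨w, hw, hyw⟩ := hy
    exact ⟨w, hw, hxy.trans hyw⟩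
  refine ⟨?_, hdown⟩
  rw [isOpen_iff_mem_nhds]
  intro x hx
  simp only [pastOf, mem_iUnion] at hx
  obtain ⟨w, hw, γ, a, b, hab, hγ, rfl, rfl, -⟩ := hx
  set x := γ a with hxdef
  have hxs := mem_extChartAt_source (I := 𝓡 d) x
  obtain ⟨c, hac, hcb, h1, h2⟩ := IsCurveIn.exists_right hγ hab subset_rfl
  have hamem : a ∈ Icc a c := left_mem_Icc.2 hac.le
  have hd := hasDerivWithinAt_Ici_of_Icc (hasDerivWithinAt_chart x
    ((h1.mdifferentiableOn one_ne_zero) a hamem) hxs) le_rfl hac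
  set e : Coord d := chartDeriv x (γ a) (velocity (d := d) γ (Icc a c) a) with he
  have het : e ∈ timelikeCone (coordMetric g x (extChartAt (𝓡 d) x x))
      (coordFuture g x (extChartAt (𝓡 d) x x)) :=
    (chartDeriv_mem_timelikeCone_iff g x hxs _).2 (h2 a hamem)
  obtain ⟨η, hη, hseg⟩ := exists_timelike_segment g x ((extChartAt (𝓡 d) x).map_source hxs) het
  have hcont : Tendsto γ (𝓝[>] a) (𝓝 x) :=
    (h1.continuousOn a hamem).mono_left (nhdsWithin_le_of_mem (Icc_mem_nhdsGT hac))
  have hev1 : ∀ᶠ t in 𝓝[>] a, (t - a)⁻¹ • (extChartAt (𝓡 d) x (γ t) - extChartAt (𝓡 d) x (γ a)) ∈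
      Metric.ball e η := (tendsto_slope_of_hasDerivWithinAt hd).eventually
    (Metric.ball_mem_nhds e hη)
  have hev2 : ∀ᶠ t in 𝓝[>] a, extChartAt (𝓡 d) x (γ t) ∈
      Metric.ball (extChartAt (𝓡 d) x x) η :=
    ((continuousAt_extChartAt (I := 𝓡 d) x).tendsto.comp hcont).eventually
      (Metric.ball_mem_nhds _ hη)
  have hev3 : ∀ᶠ t in 𝓝[>] a, γ t ∈ (extChartAt (𝓡 d) x).source :=
    hcont.eventually (extChartAt_source_mem_nhds x)
  obtain ⟨t, ht1, ht2, ht3, ht4⟩ := (hev1.and (hev2.and (hev3.and (Ioo_mem_nhdsGT hab)))).exists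
  have htL : γ t ∈ pastOf g W := by
    simp only [pastOf, mem_iUnion]
    exact ⟨γ b, hw, TimelikeJoined.of_curve ht4.2
      (hγ.mono (Icc_subset_Icc_left ht4.1.le) ordConnected_Icc)⟩
  have hφ := continuousAt_extChartAt (I := 𝓡 d) x
  have hev4 : ∀ᶠ x' in 𝓝 x, (t - a)⁻¹ • (extChartAt (𝓡 d) x (γ t) - extChartAt (𝓡 d) x x') ∈
      Metric.ball e η :=
    ((continuousAt_const.sub hφ).const_smul ((t - a)⁻¹)).eventually (Metric.isOpen_ball.mem_nhds ht1)
  filter_upwards [hev4, hφ.eventually (Metric.ball_mem_nhds _ hη),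
    extChartAt_source_mem_nhds (I := 𝓡 d) x] with x' h5 h6 h7
  have := hseg _ h6 _ ht2 (t - a) (sub_pos.2 ht4.1) h5
  rw [(extChartAt (𝓡 d) x).left_inv h7, (extChartAt (𝓡 d) x).left_inv ht3] at this
  exact hdown _ _ this htL

end PastSets

end Spacetimes

end

noncomputable section

namespace Spacetimes

section PushUp

variable {d : ℕ} {M : Type*} [TopologicalSpace M] [ChartedSpace (Coord d) M]
  [IsManifold (𝓡 d) ∞ M] {g : LorentzStructure d M}

/-- A future-directed causal curve of class `C¹` on a compact interval. -/
structure IsC1Causal (g : LorentzStructure d M) (γ : ℝ → M) (a b : ℝ) : Prop where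
  contMDiffOn : ContMDiffOn 𝓘(ℝ, ℝ) (𝓡 d) 1 γ (Icc a b)
  velocity_mem : ∀ t ∈ Icc a b, velocity γ (Icc a b) t ∈ futureCausal g (γ t)

lemma IsC1Causal.mono {γ : ℝ → M} {a b a' b' : ℝ} (h : IsC1Causal g γ a b) (ha : a ≤ a')
    (hab : a' < b') (hb : b' ≤ b) : IsC1Causal g γ a' b' := by
  have hsub := Icc_subset_Icc ha hb
  refine ⟨h.contMDiffOn.mono hsub, fun t ht => ?_⟩
  rw [velocity_eq_of_subset ((h.contMDiffOn.mdifferentiableOn one_ne_zero) t (hsub ht)) hsub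
    (uniqueDiffOn_Icc hab t ht)]
  exact h.velocity_mem t (hsub ht)

/-- Deformation of a causal curve in a chart to timelike curves. -/
lemma exists_deformation (g : LorentzStructure d M) (x₀ : M) :
    ∃ e ∈ timelikeCone (coordMetric g x₀ (extChartAt (𝓡 d) x₀ x₀))
      (coordFuture g x₀ (extChartAt (𝓡 d) x₀ x₀)), ∃ r > 0, ∃ ε₀ > 0,
      ∃ f : ℝ → Coord d → ℝ, (∀ y, Tendsto (fun ε => f ε y) (𝓝 0) (𝓝 0)) ∧
      (∀ ε y, 0 < ε → 0 < f ε y) ∧ (∀ ε y, ε < 0 → f ε y < 0) ∧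
      ∀ ε, ε ≠ 0 → |ε| < ε₀ → ∀ (γ : ℝ → M) (a b : ℝ), a < b → IsC1Causal g γ a b →
      (∀ t ∈ Icc a b, γ t ∈ (extChartAt (𝓡 d) x₀).source ∧
        extChartAt (𝓡 d) x₀ (γ t) ∈ Metric.ball (extChartAt (𝓡 d) x₀ x₀) r) →
      TimelikeJoined g univ ∅
        ((extChartAt (𝓡 d) x₀).symm (extChartAt (𝓡 d) x₀ (γ a) +
          f ε (extChartAt (𝓡 d) x₀ (γ a)) • e))
        ((extChartAt (𝓡 d) x₀).symm (extChartAt (𝓡 d) x₀ (γ b) +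
          f ε (extChartAt (𝓡 d) x₀ (γ b)) • e)) := by
  have hG := isOrientedLorentzOn_coord g x₀
  set y₀ := extChartAt (𝓡 d) x₀ x₀ with hy₀def
  have hy₀ : y₀ ∈ (extChartAt (𝓡 d) x₀).target := mem_extChartAt_target x₀
  obtain ⟨ℓ, C, ρ₁, hρ₁, hpush⟩ := hG.exists_pushUp hy₀
  set e := coordFuture g x₀ y₀ with he
  obtain ⟨ρ₂, hρ₂, hball⟩ := Metric.isOpen_iff.1 hG.isOpen y₀ hy₀
  set ρ := min ρ₁ ρ₂ with hρdef
  have hρ : 0 < ρ := lt_min hρ₁ hρ₂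
  have hb1 : Metric.ball y₀ ρ ⊆ Metric.ball y₀ ρ₁ := Metric.ball_subset_ball (min_le_left _ _)
  have hb2 : Metric.ball y₀ ρ ⊆ (extChartAt (𝓡 d) x₀).target :=
    (Metric.ball_subset_ball (min_le_right _ _)).trans hball
  set K : ℝ := Real.exp (|C| * (‖ℓ‖ * ρ)) with hK
  have hK0 : 0 < K := Real.exp_pos _
  set f : ℝ → Coord d → ℝ := fun ε y => ε * Real.exp (SignType.sign ε * (C * ℓ (y - y₀))) with hf
  have hfbound : ∀ ε, ∀ y ∈ Metric.ball y₀ ρ, |f ε y| ≤ |ε| * K := by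
    intro ε y hy
    simp only [hf, abs_mul, Real.abs_exp]
    refine mul_le_mul_of_nonneg_left (Real.exp_le_exp.2 ?_) (abs_nonneg _)
    refine (le_abs_self _).trans ?_
    rw [abs_mul, abs_mul]
    have h1 : |((SignType.sign ε : SignType) : ℝ)| ≤ 1 := by
      rcases lt_trichotomy ε 0 with h | h | h <;> simp [h]
    have h2 : |ℓ (y - y₀)| ≤ ‖ℓ‖ * ρ :=
      (ℓ.le_opNorm _).trans (by gcongr; exact (mem_ball_iff_norm.1 hy).le)
    calc _ ≤ 1 * (|C| * (‖ℓ‖ * ρ)) := by gcongr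
      _ = _ := one_mul _
  refine ⟨e, hG.future_mem hy₀, ρ / 2, by positivity, ρ / (2 * K * (‖e‖ + 1)), by positivity, f,
    ?_, ?_, ?_, ?_⟩
  · intro y
    refine squeeze_zero_norm (a := fun ε => |ε| * Real.exp (|C * ℓ (y - y₀)|)) (fun ε => ?_) ?_
    · simp only [hf, norm_mul, Real.norm_eq_abs, Real.abs_exp]
      refine mul_le_mul_of_nonneg_left (Real.exp_le_exp.2 ?_) (abs_nonneg _)
      refine (le_abs_self _).trans ?_
      rw [abs_mul]
      refine mul_le_of_le_one_left (abs_nonneg _) ?_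
      rcases lt_trichotomy ε 0 with h | h | h <;> simp [h]
    · have : Continuous fun ε : ℝ => |ε| * Real.exp (|C * ℓ (y - y₀)|) := by fun_prop
      simpa using this.tendsto 0
  · intro ε y hε
    simp only [hf]; positivity
  · intro ε y hε
    exact mul_neg_of_neg_of_pos hε (Real.exp_pos _)
  · intro ε hε0 hε γ a b hab hγ hin
    set c : ℝ → Coord d := fun t => extChartAt (𝓡 d) x₀ (γ t) with hc
    have hcb : ∀ t ∈ Icc a b, c t ∈ Metric.ball y₀ ρ := fun t ht =>
      Metric.ball_subset_ball (by linarith) (hin t ht).2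
    have hcb' : ∀ t ∈ Icc a b, c t + f ε (c t) • e ∈ Metric.ball y₀ ρ := by
      intro t ht
      rw [mem_ball_iff_norm, add_sub_right_comm]
      have h1 := mem_ball_iff_norm.1 (hin t ht).2
      have h2 : ‖f ε (c t) • e‖ < ρ / 2 := by
        rw [norm_smul, Real.norm_eq_abs]
        have h3 := hfbound ε (c t) (hcb t ht)
        have h4 : |ε| * (2 * K * (‖e‖ + 1)) < ρ := by
          rwa [lt_div_iff₀ (by positivity)] at hε
        have h5 : |f ε (c t)| * ‖e‖ ≤ |ε| * K * ‖e‖ := by gcongr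
        have h6 : 0 < |ε| * K := by positivity
        nlinarith
      exact (norm_add_le _ _).trans_lt (by linarith)
    have hcsm : ContDiffOn ℝ 1 c (Icc a b) := by
      rw [← contMDiffOn_iff_contDiffOn]
      have h0 := contMDiffOn_extChartAt (I := 𝓡 d) (n := 1) (x := x₀)
      rw [← extChartAt_source (𝓡 d)] at h0
      exact h0.comp hγ.contMDiffOn fun t ht => (hin t ht).1
    have hσsm : ContDiffOn ℝ 1 (fun t => c t + f ε (c t) • e) (Icc a b) := by
      have h1 : ContDiffOn ℝ 1 (fun t => ℓ (c t - y₀)) (Icc a b) :=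
        ℓ.contDiff.comp_contDiffOn (hcsm.sub contDiffOn_const)
      have h2 : ContDiffOn ℝ 1 (fun t => f ε (c t)) (Icc a b) :=
        contDiffOn_const.mul (ContDiffOn.exp (contDiffOn_const.mul (contDiffOn_const.mul h1)))
      exact hcsm.add (h2.smul contDiffOn_const)
    set c' : ℝ → Coord d := fun t => chartDeriv x₀ (γ t) (velocity (d := d) γ (Icc a b) t) with hc'
    have hcd : ∀ t ∈ Icc a b, HasDerivWithinAt c (c' t) (Icc a b) t := fun t ht =>
      hasDerivWithinAt_chart x₀ ((hγ.contMDiffOn.mdifferentiableOn one_ne_zero) t ht) (hin t ht).1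
    have hcc : ∀ t ∈ Icc a b, c' t ∈ causalCone (coordMetric g x₀ (c t)) (coordFuture g x₀ (c t)) :=
      fun t ht => (chartDeriv_mem_causalCone_iff g x₀ (hin t ht).1 _).2 (hγ.velocity_mem t ht)
    have hfne : ∀ y, f ε y ≠ 0 := fun y => mul_ne_zero hε0 (Real.exp_pos _).ne'
    have hσd : ∀ t ∈ Icc a b, HasDerivWithinAt (fun t => c t + f ε (c t) • e)
        (c' t + (|f ε (c t)| * (C * ℓ (c' t))) • e) (Icc a b) t := by
      intro t ht
      have h1 : HasDerivWithinAt (fun t => ℓ (c t - y₀)) (ℓ (c' t)) (Icc a b) t :=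
        ℓ.hasFDerivAt.comp_hasDerivWithinAt t ((hcd t ht).sub_const y₀)
      have h2 := ((((h1.const_mul C).const_mul ((SignType.sign ε : SignType) : ℝ)).exp).const_mul
        ε).smul_const e
      refine ((hcd t ht).add h2).congr_deriv ?_
      congr 2
      simp only [hf, abs_mul, Real.abs_exp]
      rcases hε0.lt_or_gt with h | h
      · simp [h, abs_of_neg h]; ring
      · simp [h, abs_of_pos h]; ring
    exact TimelikeJoined.of_curve hab (isTimelikeCurve_of_coord g x₀ hσsm
      (fun t ht => hb2 (hcb' t ht)) hσd
      (fun t ht => hpush (c t) (hb1 (hcb t ht)) _ (hfne _) (hb1 (hcb' t ht)) _ (hcc t ht)))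

/-- Past sets and their closures are closed under short causal curves towards the past. -/
lemma exists_nhds_past_of_causal (g : LorentzStructure d M) (x₀ : M) :
    ∃ N, IsOpen N ∧ x₀ ∈ N ∧ ∀ L, IsPastSet g L → ∀ (γ : ℝ → M) (a b : ℝ), a < b →
      IsC1Causal g γ a b → (∀ t ∈ Icc a b, γ t ∈ N) →
      (γ b ∈ L → γ a ∈ L) ∧ (γ b ∈ closure L → γ a ∈ closure L) := by
  obtain ⟨e, he, r, hr, ε₀, hε₀, f, hf0, hfpos, hfneg, hdef⟩ := exists_deformation g x₀
  set y₀ := extChartAt (𝓡 d) x₀ x₀ with hy₀def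
  have hy₀ : y₀ ∈ (extChartAt (𝓡 d) x₀).target := mem_extChartAt_target x₀
  obtain ⟨η, hη, hseg⟩ := exists_timelike_segment g x₀ hy₀ he
  set N : Set M := (extChartAt (𝓡 d) x₀).source ∩
    extChartAt (𝓡 d) x₀ ⁻¹' Metric.ball y₀ (min r η) with hN
  have hNo : IsOpen N := (continuousOn_extChartAt x₀).isOpen_inter_preimage
    (isOpen_extChartAt_source x₀) Metric.isOpen_ball
  refine ⟨N, hNo, ⟨mem_extChartAt_source x₀, Metric.mem_ball_self (lt_min hr hη)⟩, ?_⟩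
  intro L hL γ a b hab hγ hin
  have hin' : ∀ t ∈ Icc a b, γ t ∈ (extChartAt (𝓡 d) x₀).source ∧
      extChartAt (𝓡 d) x₀ (γ t) ∈ Metric.ball y₀ r := fun t ht =>
    ⟨(hin t ht).1, Metric.ball_subset_ball (min_le_left _ _) (hin t ht).2⟩
  have hinη : ∀ t ∈ Icc a b, extChartAt (𝓡 d) x₀ (γ t) ∈ Metric.ball y₀ η := fun t ht =>
    Metric.ball_subset_ball (min_le_right _ _) (hin t ht).2
  have ha := left_mem_Icc.2 hab.le
  have hb := right_mem_Icc.2 hab.le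
  have hlim0 : ∀ t, Tendsto (fun ε => extChartAt (𝓡 d) x₀ (γ t) +
      f ε (extChartAt (𝓡 d) x₀ (γ t)) • e) (𝓝 0) (𝓝 (extChartAt (𝓡 d) x₀ (γ t))) := by
    intro t
    simpa using ((hf0 (extChartAt (𝓡 d) x₀ (γ t))).smul_const e).const_add
      (extChartAt (𝓡 d) x₀ (γ t))
  have hlim : ∀ t ∈ Icc a b, Tendsto (fun ε => (extChartAt (𝓡 d) x₀).symm
      (extChartAt (𝓡 d) x₀ (γ t) + f ε (extChartAt (𝓡 d) x₀ (γ t)) • e)) (𝓝 0) (𝓝 (γ t)) := by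
    intro t ht
    have h1 := continuousAt_extChartAt_symm'' (I := 𝓡 d)
      ((extChartAt (𝓡 d) x₀).map_source (hin t ht).1)
    have h2 := h1.tendsto.comp (hlim0 t)
    rwa [(extChartAt (𝓡 d) x₀).left_inv (hin t ht).1] at h2
  have hsmall : ∀ᶠ ε : ℝ in 𝓝 0, |ε| < ε₀ := by
    have : Tendsto (fun ε : ℝ => |ε|) (𝓝 0) (𝓝 0) := by simpa using (continuous_abs.tendsto (0 : ℝ))
    exact this.eventually_lt_const hε₀
  have hballev : ∀ t ∈ Icc a b, ∀ᶠ ε in 𝓝 0, extChartAt (𝓡 d) x₀ (γ t) +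
      f ε (extChartAt (𝓡 d) x₀ (γ t)) • e ∈ Metric.ball y₀ η := fun t ht =>
    (hlim0 t).eventually (Metric.isOpen_ball.mem_nhds (hinη t ht))
  constructor
  · intro hbL
    have hev : ∀ᶠ ε in 𝓝 0, (extChartAt (𝓡 d) x₀).symm
        (extChartAt (𝓡 d) x₀ (γ b) + f ε (extChartAt (𝓡 d) x₀ (γ b)) • e) ∈ L :=
      (hlim b hb).eventually (hL.isOpen.mem_nhds hbL)
    have hpos : ∀ᶠ ε : ℝ in 𝓝[>] 0, 0 < ε := self_mem_nhdsWithin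
    obtain ⟨ε, hε, h1, h2, h3⟩ := (hpos.and ((hev.and (hsmall.and (hballev a ha))).filter_mono
      nhdsWithin_le_nhds)).exists
    have h4 := hL.down _ _ (hdef ε hε.ne' h2 γ a b hab hγ hin') h1
    have hfp := hfpos ε (extChartAt (𝓡 d) x₀ (γ a)) hε
    have h5 := hseg _ (hinη a ha) _ h3 _ hfp (by
      rw [add_sub_cancel_left, smul_smul, inv_mul_cancel₀ hfp.ne', one_smul]
      exact Metric.mem_ball_self hη)
    rw [(extChartAt (𝓡 d) x₀).left_inv (hin a ha).1] at h5
    exact hL.down _ _ h5 h4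
  · intro hbL
    refine mem_closure_of_tendsto ((hlim a ha).mono_left (nhdsWithin_le_nhds (s := Iio 0))) ?_
    have hneg : ∀ᶠ ε : ℝ in 𝓝[<] 0, ε < 0 := self_mem_nhdsWithin
    filter_upwards [hneg, (hsmall.and (hballev b hb)).filter_mono nhdsWithin_le_nhds]
      with ε hε ⟨h2, h3⟩
    refine hL.down _ _ (hdef ε hε.ne h2 γ a b hab hγ hin') ?_
    set z := extChartAt (𝓡 d) x₀ (γ b) + f ε (extChartAt (𝓡 d) x₀ (γ b)) • e with hz
    have hfn := hfneg ε (extChartAt (𝓡 d) x₀ (γ b)) hε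
    set s := -f ε (extChartAt (𝓡 d) x₀ (γ b)) with hs
    have hs0 : 0 < s := neg_pos.2 hfn
    have hcont : ContinuousAt (fun p => s⁻¹ • (extChartAt (𝓡 d) x₀ p - z)) (γ b) :=
      ((continuousAt_extChartAt' (I := 𝓡 d) (hin b hb).1).sub
        (continuousAt_const (y := z))).const_smul s⁻¹
    have hval : s⁻¹ • (extChartAt (𝓡 d) x₀ (γ b) - z) = e := by
      rw [hz, sub_add_cancel_left, ← neg_smul, ← hs, smul_smul, inv_mul_cancel₀ hs0.ne', one_smul]
    have hev1 : ∀ᶠ p in 𝓝 (γ b), s⁻¹ • (extChartAt (𝓡 d) x₀ p - z) ∈ Metric.ball e η :=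
      hcont.eventually (Metric.isOpen_ball.mem_nhds (by simp only [hval]; exact Metric.mem_ball_self hη))
    have hev2 : ∀ᶠ p in 𝓝 (γ b), p ∈ N := hNo.mem_nhds (hin b hb)
    obtain ⟨p, ⟨h5, h6⟩, h7⟩ := mem_closure_iff_nhds.1 hbL _ (hev1.and hev2)
    have h8 := hseg z h3 (extChartAt (𝓡 d) x₀ p)
      (Metric.ball_subset_ball (min_le_right _ _) h6.2) s hs0 h5
    rw [(extChartAt (𝓡 d) x₀).left_inv h6.1] at h8
    exact hL.down _ _ h8 h7

/-- Past sets and their closures are closed under causal curves towards the past. -/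
theorem IsPastSet.of_causal {L : Set M} (hL : IsPastSet g L) {γ : ℝ → M} {a b : ℝ} (hab : a ≤ b)
    (hγ : IsC1Causal g γ a b) :
    (γ b ∈ L → γ a ∈ L) ∧ (γ b ∈ closure L → γ a ∈ closure L) := by
  choose N hNo hN hNL using exists_nhds_past_of_causal g
  have hcont := hγ.contMDiffOn.continuousOn
  obtain ⟨t, ht0, htm, ⟨m, hm⟩, ht⟩ := exists_monotone_Icc_subset_open_cover_Icc hab
    (c := fun x : M => (Icc a b).domRestrict γ ⁻¹' N x)
    (fun x => (hNo x).preimage hcont.domRestrict)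
    (fun u _ => mem_iUnion.2 ⟨γ u, hN _⟩)
  have key : ∀ n, (γ (t n) ∈ L → γ a ∈ L) ∧ (γ (t n) ∈ closure L → γ a ∈ closure L) := by
    intro n
    induction n with
    | zero => rw [ht0]; exact ⟨id, id⟩
    | succ n ih =>
      rcases (htm n.le_succ).eq_or_lt with h | h
      · rwa [← h]
      · obtain ⟨x, hx⟩ := ht n
        have := hNL x L hL γ (t n) (t (n + 1)) h (hγ.mono (t n).2.1 h (t (n + 1)).2.2)
          (fun u hu => hx (a := ⟨u, (t n).2.1.trans hu.1, hu.2.trans (t (n + 1)).2.2⟩) hu)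
        exact ⟨fun h1 => ih.1 (this.1 h1), fun h1 => ih.2 (this.2 h1)⟩
  have := key m
  rwa [hm m le_rfl] at this

end PushUp

end Spacetimes

end

noncomputable section

set_option maxSynthPendingDepth 3

namespace Spacetimes

/-! ### Future-infinite causal curves leave small neighbourhoods -/

section Transport

variable {E : Type*} [NormedAddCommGroup E] [NormedSpace ℝ E] [FiniteDimensional ℝ E]
  {G : E → E →L[ℝ] E →L[ℝ] ℝ} {U : Set E}

/-- Parallel transport is governed by a linear equation with locally bounded coefficients. -/
lemma IsLorentzMetricOn.exists_transport_bound (hG : IsLorentzMetricOn G U) {y₀ : E}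
    (hy₀ : y₀ ∈ U) : ∃ C ≥ 0, ∀ᶠ y in 𝓝 y₀, ∀ u ξ a : E,
      (∀ w, G y a w + christoffelOf G y u ξ w = 0) → ‖a‖ ≤ C * ‖u‖ * ‖ξ‖ := by
  obtain ⟨A, hA⟩ := (hG.lorentz y₀ hy₀).exists_equiv
  have hGc : ContinuousAt G y₀ := hG.contDiffOn.continuousOn.continuousAt (hG.isOpen.mem_nhds hy₀)
  have hDc : ContinuousAt (fderiv ℝ G) y₀ :=
    (hG.contDiffOn.continuousOn_fderiv_of_isOpen hG.isOpen (by simp)).continuousAt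
      (hG.isOpen.mem_nhds hy₀)
  set N : ℝ := ‖(A.symm : (E →L[ℝ] ℝ) →L[ℝ] E)‖ with hN
  have hN0 : 0 ≤ N := norm_nonneg _
  set K : ℝ := ‖fderiv ℝ G y₀‖ + 1 with hK
  have hK0 : 0 < K := by positivity
  refine ⟨3 * N * K, by positivity, ?_⟩
  have h1 : ∀ᶠ y in 𝓝 y₀, ‖G y - G y₀‖ < 1 / (2 * N + 1) := by
    have := hGc.eventually (Metric.ball_mem_nhds (G y₀) (show (0:ℝ) < 1 / (2 * N + 1) by positivity))
    filter_upwards [this] with y hy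
    rwa [← dist_eq_norm]
  have h2 : ∀ᶠ y in 𝓝 y₀, ‖fderiv ℝ G y‖ < K :=
    hDc.norm.eventually_lt_const (lt_add_one _)
  filter_upwards [h1, h2] with y hy1 hy2 u ξ a h
  have hb : ‖G y a‖ ≤ 3 / 2 * K * ‖u‖ * ‖ξ‖ := by
    refine ContinuousLinearMap.opNorm_le_bound _ (by positivity) fun w => ?_
    have e1 : G y a w = -christoffelOf G y u ξ w := by linarith [h w]
    have hD : ∀ p q r : E, ‖fderiv ℝ G y p q r‖ ≤ K * (‖p‖ * ‖q‖ * ‖r‖) := by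
      intro p q r
      have h3 := (fderiv ℝ G y p q).le_opNorm r
      have h4 := (fderiv ℝ G y p).le_opNorm q
      have h5 := (fderiv ℝ G y).le_opNorm p
      calc ‖fderiv ℝ G y p q r‖ ≤ ((‖fderiv ℝ G y‖ * ‖p‖) * ‖q‖) * ‖r‖ := by
            refine h3.trans (mul_le_mul_of_nonneg_right (h4.trans ?_) (norm_nonneg _))
            exact mul_le_mul_of_nonneg_right h5 (norm_nonneg _)
        _ = ‖fderiv ℝ G y‖ * (‖p‖ * ‖q‖ * ‖r‖) := by ring
        _ ≤ _ := mul_le_mul_of_nonneg_right hy2.le (by positivity)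
    rw [e1, norm_neg, christoffelOf, norm_mul]
    have h6 := norm_sub_le (fderiv ℝ G y u ξ w + fderiv ℝ G y ξ u w) (fderiv ℝ G y w u ξ)
    have h7 := norm_add_le (fderiv ℝ G y u ξ w) (fderiv ℝ G y ξ u w)
    have h8 := hD u ξ w
    have h9 := hD ξ u w
    have h10 := hD w u ξ
    have : ‖(1 / 2 : ℝ)‖ = 1 / 2 := by norm_num
    rw [this]
    nlinarith
  have hAa : ‖a‖ ≤ N * ‖G y₀ a‖ := by
    have := (A.symm : (E →L[ℝ] ℝ) →L[ℝ] E).le_opNorm (A a)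
    have hA' : A a = G y₀ a := by rw [← hA]; rfl
    rwa [ContinuousLinearEquiv.coe_coe, A.symm_apply_apply, hA'] at this
  have hdiff : ‖G y₀ a‖ ≤ ‖G y a‖ + 1 / (2 * N + 1) * ‖a‖ := by
    have h3 : ‖(G y - G y₀) a‖ ≤ 1 / (2 * N + 1) * ‖a‖ :=
      ((G y - G y₀).le_opNorm a).trans (mul_le_mul_of_nonneg_right hy1.le (norm_nonneg _))
    have h4 : G y₀ a = G y a - (G y - G y₀) a := by simp
    rw [h4]
    exact (norm_sub_le _ _).trans (by linarith)
  have h5 : N * (1 / (2 * N + 1)) ≤ 1 / 2 := by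
    rw [mul_one_div, div_le_div_iff₀ (by positivity) (by norm_num)]; linarith
  have h6 : ‖a‖ ≤ N * ‖G y a‖ + 1 / 2 * ‖a‖ :=
    calc ‖a‖ ≤ N * (‖G y a‖ + 1 / (2 * N + 1) * ‖a‖) :=
          hAa.trans (mul_le_mul_of_nonneg_left hdiff hN0)
      _ = N * ‖G y a‖ + (N * (1 / (2 * N + 1))) * ‖a‖ := by ring
      _ ≤ _ := by gcongr
  have h7 := mul_le_mul_of_nonneg_left hb hN0
  nlinarith

end Transport

lemma le_of_hasDerivAt_nonneg_off_finite (B : Finset ℝ) {f : ℝ → ℝ} {a b : ℝ} (hab : a ≤ b)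
    (hc : ContinuousOn f (Icc a b))
    (hd : ∀ t ∈ Ioo a b, t ∉ B → ∃ f' ≥ 0, HasDerivAt f f' t) : f a ≤ f b := by
  induction B using Finset.induction_on generalizing a b with
  | empty =>
    refine monotoneOn_of_deriv_nonneg (convex_Icc a b) hc ?_ ?_ (left_mem_Icc.2 hab)
      (right_mem_Icc.2 hab) hab <;> rw [interior_Icc]
    · intro t ht
      obtain ⟨f', -, h⟩ := hd t ht (Finset.notMem_empty t)
      exact h.differentiableAt.differentiableWithinAt
    · intro t ht
      obtain ⟨f', h0, h⟩ := hd t ht (Finset.notMem_empty t)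
      rwa [h.deriv]
  | insert p B _ ih =>
    by_cases hp : p ∈ Ioo a b
    · refine (ih hp.1.le (hc.mono (Icc_subset_Icc_right hp.2.le)) fun t ht htB => ?_).trans
        (ih hp.2.le (hc.mono (Icc_subset_Icc_left hp.1.le)) fun t ht htB => ?_)
      · exact hd t ⟨ht.1, ht.2.trans hp.2⟩ (by simp [htB, ht.2.ne])
      · exact hd t ⟨hp.1.trans ht.1, ht.2⟩ (by simp [htB, ht.1.ne'])
    · refine ih hab hc fun t ht htB => hd t ht ?_
      simp only [Finset.mem_insert, not_or]
      exact ⟨fun h => hp (h ▸ ht), htB⟩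

lemma monotoneOn_of_hasDerivWithinAt_Ici_nonneg {f : ℝ → ℝ} {a b : ℝ}
    (hc : ContinuousOn f (Icc a b))
    (hd : ∀ t ∈ Ico a b, ∃ f' ≥ 0, HasDerivWithinAt f f' (Ici t) t) : MonotoneOn f (Icc a b) := by
  choose! f' h0 h using hd
  intro x hx y hy hxy
  have := image_le_of_deriv_right_le_deriv_boundary (f := fun t => -f t) (f' := fun t => -f' t)
    (a := x) (b := y) (B := fun _ => -f x) (B' := fun _ => 0)
    (hc.neg.mono (Icc_subset_Icc hx.1 hy.2))
    (fun t ht => (h t ⟨hx.1.trans ht.1, ht.2.trans_le hy.2⟩).neg) le_rfl continuousOn_const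
    (fun t _ => hasDerivWithinAt_const _ _ _)
    (fun t ht => neg_nonpos.2 (h0 t ⟨hx.1.trans ht.1, ht.2.trans_le hy.2⟩))
    (right_mem_Icc.2 hxy)
  exact neg_le_neg_iff.1 this

/-- The integral of a function that is dominated by the derivative of a bounded monotone function
is finite. -/
lemma setLIntegral_ne_top_of_le_deriv {s : Set ℝ} (hs : s.OrdConnected) {t₀ : ℝ}
    {h : ℝ → ℝ} {D C : ℝ} (hC : 0 ≤ C) (hmono : ∀ b ∈ s, t₀ ≤ b → MonotoneOn h (Icc t₀ b))
    (hbd : ∀ b ∈ s, t₀ ≤ b → h b - h t₀ ≤ D) {f : ℝ → ENNReal}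
    (hf : ∀ b ∈ s, ∀ t ∈ Ioo t₀ b, f t ≤ ENNReal.ofReal (C * deriv h t)) :
    ∫⁻ t in s ∩ Ici t₀, f t ≠ ⊤ := by
  let ι := {q : ℚ // t₀ < (q : ℝ) ∧ (q : ℝ) ∈ s}
  have hpart : ∀ b ∈ s, t₀ < b → ∫⁻ t in Ioo t₀ b, f t ≤ ENNReal.ofReal (C * D) := by
    intro b hb htb
    have hm := hmono b hb htb.le
    have hm' : MonotoneOn h (uIcc t₀ b) := by rwa [uIcc_of_le htb.le]
    have hint := hm'.intervalIntegrable_deriv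
    have hmem := hm'.intervalIntegral_deriv_mem_uIcc
    have h0 : 0 ≤ h b - h t₀ :=
      sub_nonneg.2 (hm (left_mem_Icc.2 htb.le) (right_mem_Icc.2 htb.le) htb.le)
    rw [uIcc_of_le h0, intervalIntegral.integral_of_le htb.le, integral_Ioc_eq_integral_Ioo] at hmem
    have hint' : IntegrableOn (deriv h) (Ioo t₀ b) :=
      ((intervalIntegrable_iff_integrableOn_Ioc_of_le htb.le).1 hint).mono_set Ioo_subset_Ioc_self
    have hnn : 0 ≤ᵐ[volume.restrict (Ioo t₀ b)] fun t => C * deriv h t := by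
      filter_upwards [ae_restrict_mem measurableSet_Ioo] with t ht
      refine mul_nonneg hC ?_
      have hd : derivWithin h (Icc t₀ b) t = deriv h t :=
        derivWithin_of_mem_nhds (Icc_mem_nhds ht.1 ht.2)
      rw [← hd]
      exact hm.derivWithin_nonneg
    calc ∫⁻ t in Ioo t₀ b, f t ≤ ∫⁻ t in Ioo t₀ b, ENNReal.ofReal (C * deriv h t) :=
          setLIntegral_mono' measurableSet_Ioo (hf b hb)
      _ = ENNReal.ofReal (∫ t in Ioo t₀ b, C * deriv h t) :=
          (ofReal_integral_eq_lintegral_ofReal (hint'.const_mul C) hnn).symm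
      _ ≤ _ := by
          refine ENNReal.ofReal_le_ofReal ?_
          rw [integral_const_mul]
          exact mul_le_mul_of_nonneg_left (hmem.2.trans (hbd b hb htb.le)) hC
  have hsub : (s ∩ Ici t₀ : Set ℝ) ≤ᵐ[volume] ⋃ q : ι, Ioo t₀ (q.1 : ℝ) := by
    have hnull : volume ({t₀} ∪ {t | IsGreatest s t} : Set ℝ) = 0 := by
      have h2 : {t | IsGreatest s t}.Subsingleton := fun a ha b hb => ha.unique hb
      exact measure_union_null (measure_singleton _) (h2.measure_zero volume)
    have hae : ∀ᵐ t ∂(volume : Measure ℝ), t ∉ ({t₀} ∪ {t | IsGreatest s t} : Set ℝ) :=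
      measure_eq_zero_iff_ae_notMem.1 hnull
    filter_upwards [hae] with t ht hts
    simp only [mem_union, mem_singleton_iff, mem_ofPred_eq, not_or] at ht
    have h1 : t₀ < t := lt_of_le_of_ne hts.2 (Ne.symm ht.1)
    obtain ⟨u, hu, htu⟩ : ∃ u ∈ s, t < u := by
      by_contra! hcon
      exact ht.2 ⟨hts.1, hcon⟩
    obtain ⟨q, hq1, hq2⟩ := exists_rat_btwn htu
    exact mem_iUnion.2 ⟨⟨q, h1.trans hq1, hs.out hts.1 hu ⟨hq1.le, hq2.le⟩⟩, h1, hq1⟩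
  have hdir : Directed (· ⊆ ·) fun q : ι => Ioo t₀ (q.1 : ℝ) := by
    intro p q
    rcases le_total (p.1 : ℝ) (q.1 : ℝ) with hpq | hpq
    · exact ⟨q, Ioo_subset_Ioo_right hpq, subset_rfl⟩
    · exact ⟨p, subset_rfl, Ioo_subset_Ioo_right hpq⟩
  refine ne_top_of_le_ne_top (ENNReal.ofReal_ne_top (r := C * D))
    ((lintegral_mono_set' hsub).trans ?_)
  rw [setLIntegral_iUnion_of_directed _ hdir]
  exact iSup_le fun q => hpart q.1 q.2.2 q.2.1

end Spacetimes

end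

noncomputable section

namespace Spacetimes

section Escape

variable {d : ℕ} {M : Type*} [TopologicalSpace M] [ChartedSpace (Coord d) M]
  [IsManifold (𝓡 d) ∞ M] {g : LorentzStructure d M}

lemma chartDeriv_injective (x₀ : M) {x : M} (hx : x ∈ (extChartAt (𝓡 d) x₀).source)
    {v : TangentSpace (𝓡 d) x} (hv : chartDeriv x₀ x v = 0) : v = 0 := by
  obtain ⟨y, hy, rfl⟩ : ∃ y ∈ (extChartAt (𝓡 d) x₀).target, (extChartAt (𝓡 d) x₀).symm y = x :=
    ⟨_, (extChartAt (𝓡 d) x₀).map_source hx, (extChartAt (𝓡 d) x₀).left_inv hx⟩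
  rw [← chartSymmDeriv_chartDeriv x₀ hy v, hv, map_zero]

lemma continuousOn_chartDeriv_comp (x₀ : M) {γ : ℝ → M} {V : ∀ t, TangentSpace (𝓡 d) (γ t)}
    {s : Set ℝ} (h : ContinuousOn (fun t => (⟨γ t, V t⟩ : TangentBundle (𝓡 d) M)) s)
    (hs : ∀ t ∈ s, γ t ∈ (extChartAt (𝓡 d) x₀).source) :
    ContinuousOn (fun t => chartDeriv x₀ (γ t) (V t)) s :=
  ContinuousOn.comp (g := fun p : TangentBundle (𝓡 d) M => chartDeriv x₀ p.1 p.2)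
    (continuousOn_chartDeriv x₀) h hs

/-- Growth estimate for solutions of a linear equation along a curve of bounded length. -/
lemma norm_sq_mul_exp_le {E : Type*} [NormedAddCommGroup E] [InnerProductSpace ℝ E] {c ξ : ℝ → E}
    {ℓ : E →L[ℝ] ℝ} {k C a b : ℝ} {B : Set ℝ} (hk : 0 < k) (hC : 0 ≤ C) (hab : a ≤ b)
    (hB : (B ∩ Icc a b).Finite) (hc : ContinuousOn c (Icc a b)) (hξ : ContinuousOn ξ (Icc a b))
    (h : ∀ t ∈ Ioo a b, t ∉ B → ∃ c' ξ', HasDerivAt c c' t ∧ HasDerivAt ξ ξ' t ∧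
      k * ‖c'‖ ≤ ℓ c' ∧ ‖ξ'‖ ≤ C * ‖c'‖ * ‖ξ t‖) :
    ‖ξ a‖ ^ 2 * Real.exp (2 * C / k * ℓ (c a)) ≤ ‖ξ b‖ ^ 2 * Real.exp (2 * C / k * ℓ (c b)) := by
  refine le_of_hasDerivAt_nonneg_off_finite hB.toFinset
    (f := fun t => ‖ξ t‖ ^ 2 * Real.exp (2 * C / k * ℓ (c t))) hab ?_ fun t ht htB => ?_
  · exact (hξ.norm.pow 2).mul (Real.continuous_exp.comp_continuousOn
      (continuousOn_const.mul (ℓ.continuous.comp_continuousOn hc)))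
  · obtain ⟨c', ξ', hc1, hξ1, hcausal, hnorm⟩ :=
      h t ht fun h => htB (by simpa using ⟨h, ht.1.le, ht.2.le⟩)
    have h1 := hξ1.norm_sq
    set q : ℝ := 2 * C / k with hq
    have hq0 : 0 ≤ q := by positivity
    have h2 : HasDerivAt (fun τ => q * ℓ (c τ)) (q * ℓ c') t :=
      (ℓ.hasFDerivAt.comp_hasDerivAt t hc1).const_mul q
    refine ⟨_, ?_, h1.mul h2.exp⟩
    have h3 : |inner ℝ (ξ t) ξ'| ≤ ‖ξ t‖ * ‖ξ'‖ := abs_real_inner_le_norm _ _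
    have h4 := mul_le_mul_of_nonneg_left hnorm (norm_nonneg (ξ t))
    have h5 : 2 * C * ‖c'‖ ≤ q * ℓ c' := by
      have := mul_le_mul_of_nonneg_left hcausal hq0
      have e1 : q * (k * ‖c'‖) = 2 * C * ‖c'‖ := by rw [hq]; field_simp
      linarith
    have h6 := mul_le_mul_of_nonneg_left h5 (sq_nonneg ‖ξ t‖)
    have h7 : 0 ≤ 2 * inner ℝ (ξ t) ξ' + ‖ξ t‖ ^ 2 * (q * ℓ c') := by
      nlinarith [(abs_le.1 h3).1]
    have := mul_nonneg h7 (Real.exp_pos (q * ℓ (c t))).le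
    nlinarith

lemma norm_le_of_growth {E : Type*} [NormedAddCommGroup E] [NormedSpace ℝ E]
    {u x y : E} {m q D l l' : ℝ} (hm : 0 < m) (hq : 0 ≤ q) (hD : 0 ≤ D) (hl : l' - l ≤ D)
    (hux : ‖u‖ ≤ m * ‖x‖) (h : ‖x‖ ^ 2 * Real.exp (q * l) ≤ ‖y‖ ^ 2 * Real.exp (q * l')) :
    ‖u‖ ≤ m * Real.exp (q * D) * ‖y‖ := by
  have h2 : Real.exp (q * l') ≤ Real.exp (q * l) * Real.exp (q * D) := by
    rw [← Real.exp_add, Real.exp_le_exp, ← mul_add]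
    exact mul_le_mul_of_nonneg_left (by linarith) hq
  have h3 : 1 ≤ Real.exp (q * D) := Real.one_le_exp (by positivity)
  have h4 : ‖x‖ ^ 2 ≤ ‖y‖ ^ 2 * Real.exp (q * D) := by
    refine le_of_mul_le_mul_right ?_ (Real.exp_pos (q * l))
    calc _ ≤ _ := h
      _ ≤ ‖y‖ ^ 2 * (Real.exp (q * l) * Real.exp (q * D)) := by gcongr
      _ = _ := by ring
  have h5 : ‖x‖ ≤ ‖y‖ * Real.exp (q * D) := by
    refine le_of_pow_le_pow_left₀ two_ne_zero (by positivity) ?_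
    rw [mul_pow]
    refine h4.trans (mul_le_mul_of_nonneg_left ?_ (by positivity))
    nlinarith
  calc ‖u‖ ≤ m * ‖x‖ := hux
    _ ≤ m * (‖y‖ * Real.exp (q * D)) := by gcongr
    _ = _ := by ring

/-- A parallel frame along a causal curve in a small ball is bounded below. -/
lemma IsCausalCurve.exists_frame_bound {γ : ℝ → M} {s : Set ℝ} (hγ : IsCausalCurve g γ s)
    {e : ∀ t : ℝ, Coord d ≃L[ℝ] TangentSpace (𝓡 d) (γ t)}
    (hpar : ∀ u : Coord d, IsParallelAlong g γ s (fun t => e t u)) (x₀ : M)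
    {t₀ : ℝ} (ht₀ : t₀ ∈ s) (hin : ∀ t ∈ s, t₀ ≤ t → γ t ∈ (extChartAt (𝓡 d) x₀).source)
    {k C D : ℝ} {ℓ : Coord d →L[ℝ] ℝ} (hk : 0 < k) (hC : 0 ≤ C) (hD : 0 ≤ D)
    (hℓ : ∀ t ∈ s, t₀ ≤ t → ∀ v ∈ causalCone (coordMetric g x₀ (extChartAt (𝓡 d) x₀ (γ t)))
      (coordFuture g x₀ (extChartAt (𝓡 d) x₀ (γ t))), k * ‖v‖ ≤ ℓ v)
    (htrans : ∀ t ∈ s, t₀ ≤ t → ∀ u ξ a : Coord d,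
      (∀ w, coordMetric g x₀ (extChartAt (𝓡 d) x₀ (γ t)) a w +
        christoffelOf (coordMetric g x₀) (extChartAt (𝓡 d) x₀ (γ t)) u ξ w = 0) →
      ‖a‖ ≤ C * ‖u‖ * ‖ξ‖)
    (hbd : ∀ t ∈ s, t₀ ≤ t →
      ℓ (extChartAt (𝓡 d) x₀ (γ t)) - ℓ (extChartAt (𝓡 d) x₀ (γ t₀)) ≤ D) :
    ∃ Q ≥ 0, ∀ t ∈ s, t₀ ≤ t → ∀ v : TangentSpace (𝓡 d) (γ t),
      ‖(e t).symm v‖ ≤ Q * ‖chartDeriv x₀ (γ t) v‖ := by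
  set c : ℝ → Coord d := fun τ => extChartAt (𝓡 d) x₀ (γ τ) with hc
  obtain ⟨m, hm, hlow⟩ : ∃ m > 0, ∀ u : Coord d, ‖u‖ ≤ m * ‖chartDeriv x₀ (γ t₀) (e t₀ u)‖ := by
    set A : Coord d →L[ℝ] Coord d :=
      (chartDeriv x₀ (γ t₀)).comp (e t₀ : Coord d →L[ℝ] TangentSpace (𝓡 d) (γ t₀)) with hA
    have hker : LinearMap.ker (A : Coord d →ₗ[ℝ] Coord d) = ⊥ := by
      rw [LinearMap.ker_eq_bot']
      intro u hu
      have := chartDeriv_injective x₀ (hin t₀ ht₀ le_rfl) hu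
      exact (e t₀).map_eq_zero_iff.1 this
    obtain ⟨m, hm, h⟩ := LinearMap.exists_antilipschitzWith _ hker
    refine ⟨m, hm, fun u => ?_⟩
    have := h.le_mul_dist u 0
    rw [map_zero, dist_zero_right, dist_zero_right] at this
    exact this
  refine ⟨m * Real.exp (2 * C / k * D), by positivity, fun b hb htb v => ?_⟩
  have hsub : Icc t₀ b ⊆ s := hγ.1.out ht₀ hb
  obtain ⟨u, rfl⟩ := (e b).surjective v
  rw [ContinuousLinearEquiv.symm_apply_apply]
  obtain ⟨hVc, B, hB, hode⟩ := hpar u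
  refine norm_le_of_growth hm (by positivity) hD (hbd b hb htb) (hlow u)
    (norm_sq_mul_exp_le (c := c) (ξ := fun t => chartDeriv x₀ (γ t) (e t u)) hk hC htb
      (hB t₀ b hsub) ((continuousOn_extChartAt x₀).comp (hγ.2.1.mono hsub)
        fun t ht => hin t (hsub ht) ht.1) (continuousOn_chartDeriv_comp x₀ (hVc.mono hsub)
        fun t ht => hin t (hsub ht) ht.1) fun t ht htB => ?_)
  have hts := hsub (Ioo_subset_Icc_self ht)
  have hint : t ∈ interior s :=
    mem_interior_iff_mem_nhds.2 (mem_of_superset (Icc_mem_nhds ht.1 ht.2) hsub)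
  have hsrc := hin t hts ht.1.le
  obtain ⟨hdc, hdξ, heq⟩ := hode t ⟨hint, htB⟩ x₀ (by rwa [extChartAt_source] at hsrc)
  refine ⟨_, _, hdc.hasDerivAt, hdξ.hasDerivAt, ?_, htrans t hts ht.1.le _ _ _ heq⟩
  obtain ⟨c'', h1, h2⟩ := hγ.exists_right_deriv x₀ ht.2 (hγ.1.out hts hb) hsrc
  have h3 := (uniqueDiffWithinAt_Ici t).eq_deriv _ hdc.hasDerivAt.hasDerivWithinAt h2
  rw [h3]
  exact hℓ t hts ht.1.le c'' h1

/-- The part of a causal curve that lies near `x₀` has no future-infinite affine parameter. -/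
theorem exists_ball_escape (g : LorentzStructure d M) (x₀ : M) :
    ∃ ρ > 0, ∀ (γ : ℝ → M) (s : Set ℝ), IsCausalCurve g γ s → IsFutureInfinite g γ s →
      ∀ t₀ ∈ s, ∃ t ∈ s, t₀ ≤ t ∧ ¬ (γ t ∈ (extChartAt (𝓡 d) x₀).source ∧
        extChartAt (𝓡 d) x₀ (γ t) ∈ Metric.ball (extChartAt (𝓡 d) x₀ x₀) ρ) := by
  have hG := isOrientedLorentzOn_coord g x₀
  set y₀ := extChartAt (𝓡 d) x₀ x₀ with hy₀def
  have hy₀ : y₀ ∈ (extChartAt (𝓡 d) x₀).target := mem_extChartAt_target x₀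
  obtain ⟨k, hk, hcone⟩ := hG.exists_time_function hy₀
  obtain ⟨C, hC, htrans⟩ := hG.toIsLorentzMetricOn.exists_transport_bound hy₀
  set ℓ : Coord d →L[ℝ] ℝ := -coordMetric g x₀ y₀ (coordFuture g x₀ y₀) with hℓ
  obtain ⟨ρ, hρ, hball⟩ := Metric.eventually_nhds_iff_ball.1 (hcone.and htrans)
  refine ⟨ρ, hρ, fun γ s hγ hinf t₀ ht₀ => ?_⟩
  by_contra! hin
  obtain ⟨e, hpar, hint⟩ := hinf
  have hin' : ∀ t ∈ s, t₀ ≤ t → γ t ∈ (extChartAt (𝓡 d) x₀).source :=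
    fun t ht htt => (hin t ht htt).1
  set c : ℝ → Coord d := fun τ => extChartAt (𝓡 d) x₀ (γ τ) with hc
  have hsub : ∀ b ∈ s, Icc t₀ b ⊆ s := fun b hb => hγ.1.out ht₀ hb
  have hcc : ∀ b ∈ s, ContinuousOn c (Icc t₀ b) := fun b hb =>
    (continuousOn_extChartAt x₀).comp (hγ.2.1.mono (hsub b hb))
      fun t ht => hin' t (hsub b hb ht) ht.1
  have hright : ∀ b ∈ s, ∀ t ∈ Ico t₀ b, ∃ c', k * ‖c'‖ ≤ ℓ c' ∧ HasDerivWithinAt c c' (Ici t) t := by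
    intro b hb t ht
    have hts := hsub b hb (Ico_subset_Icc_self ht)
    obtain ⟨c', h1, h2⟩ := hγ.exists_right_deriv x₀ ht.2 (hγ.1.out hts hb) (hin' t hts ht.1)
    exact ⟨c', (hball _ (hin t hts ht.1).2).1 c' h1, h2⟩
  have hmono : ∀ b ∈ s, t₀ ≤ b → MonotoneOn (fun t => ℓ (c t)) (Icc t₀ b) := by
    intro b hb _
    refine monotoneOn_of_hasDerivWithinAt_Ici_nonneg (ℓ.continuous.comp_continuousOn (hcc b hb))
      fun t ht => ?_
    obtain ⟨c', h1, h2⟩ := hright b hb t ht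
    exact ⟨ℓ c', (mul_nonneg hk.le (norm_nonneg _)).trans h1,
      ℓ.hasFDerivAt.comp_hasDerivWithinAt t h2⟩
  set D : ℝ := ‖ℓ‖ * (2 * ρ) with hD
  have hbd : ∀ b ∈ s, t₀ ≤ b → ℓ (c b) - ℓ (c t₀) ≤ D := by
    intro b hb htb
    rw [← map_sub]
    refine (le_abs_self _).trans ((ℓ.le_opNorm _).trans ?_)
    refine mul_le_mul_of_nonneg_left ?_ (norm_nonneg _)
    rw [← dist_eq_norm]
    have h1 := Metric.mem_ball.1 (hin b hb htb).2
    have h2 := Metric.mem_ball'.1 (hin t₀ ht₀ le_rfl).2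
    linarith [dist_triangle (c b) y₀ (c t₀)]
  obtain ⟨Q, hQ0, hframe⟩ := hγ.exists_frame_bound hpar x₀ ht₀ hin' hk hC
    (show 0 ≤ D by positivity) (fun t ht htt => (hball _ (hin t ht htt).2).1)
    (fun t ht htt => (hball _ (hin t ht htt).2).2) hbd
  refine setLIntegral_ne_top_of_le_deriv hγ.1 (t₀ := t₀) (h := fun t => ℓ (c t)) (D := D)
    (C := Q / k) (by positivity) hmono hbd (fun b hb t ht => ?_) (hint t₀ ht₀)
  have hts := hsub b hb (Ioo_subset_Icc_self ht)
  have hnhds : s ∈ 𝓝 t := mem_of_superset (Icc_mem_nhds ht.1 ht.2) (hsub b hb)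
  by_cases hmd : MDifferentiableWithinAt 𝓘(ℝ, ℝ) (𝓡 d) γ s t
  · have h1 := (hasDerivWithinAt_chart x₀ hmd (hin' t hts ht.1.le)).hasDerivAt hnhds
    set v : TangentSpace (𝓡 d) (γ t) := velocity γ s t with hv
    have h2 : k * ‖chartDeriv x₀ (γ t) v‖ ≤ ℓ (chartDeriv x₀ (γ t) v) := by
      obtain ⟨c'', h3, h4⟩ := hright b hb t ⟨ht.1.le, ht.2⟩
      rwa [(uniqueDiffWithinAt_Ici t).eq_deriv _ h1.hasDerivWithinAt h4]
    have h5 : deriv (fun t => ℓ (c t)) t = ℓ (chartDeriv x₀ (γ t) v) :=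
      (ℓ.hasFDerivAt.comp_hasDerivAt t h1).deriv
    have h6 := hframe t hts ht.1.le v
    rw [← ofReal_norm, h5]
    refine ENNReal.ofReal_le_ofReal (h6.trans ?_)
    rw [div_mul_eq_mul_div, le_div_iff₀ hk]
    nlinarith
  · have h1 : velocity (d := d) γ s t = 0 := by
      rw [velocity, mfderivWithin_zero_of_not_mdifferentiableWithinAt hmd]; rfl
    rw [h1]
    simp

end Escape

end Spacetimes

end

noncomputable section

set_option maxSynthPendingDepth 3

namespace Spacetimes

/-! ### Causal geodesics of the flow -/

namespace LocalGeodesicFlow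

variable {E : Type*} [NormedAddCommGroup E] [NormedSpace ℝ E] [FiniteDimensional ℝ E]
  {G : E → E →L[ℝ] E →L[ℝ] ℝ} {U : Set E} {y₀ : E} {κ : ℝ} {Φ : LocalGeodesicFlow G U y₀ κ}

lemma snd_ne_zero {z : E × E} (hz : z ∈ Metric.closedBall (y₀, (0 : E)) (Φ.R / 2))
    (hz0 : z.2 ≠ 0) {t : ℝ} (ht : t ∈ Icc 0 Φ.τ) : (Φ.Z z t).2 ≠ 0 := by
  intro h
  have hmem := Φ.mem z hz
  have hsub : Icc 0 t ⊆ Icc 0 Φ.τ := Icc_subset_Icc_right ht.2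
  have h0 : geodesicField G (Φ.Z z t) = 0 := by simp [geodesicField, h, spray_zero]
  have hEq := ODE_solution_unique_of_mem_Icc_left (v := fun _ => geodesicField G)
    (s := fun _ => Metric.closedBall (y₀, (0 : E)) Φ.R) (K := Φ.K) (f := Φ.Z z)
    (g := fun _ => Φ.Z z t) (a := 0) (b := t) (fun _ _ => Φ.lipschitz)
    ((continuousOn hz).mono hsub)
    (fun s hs => (Φ.deriv z hz s (hsub (Ioc_subset_Icc_self hs))).mono_of_mem_nhdsWithin
      (mem_of_superset (Icc_mem_nhdsLE hs.1) (Icc_subset_Icc_right (hs.2.trans ht.2))))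
    (fun s hs => hmem s (hsub (Ioc_subset_Icc_self hs))) continuousOn_const
    (fun s _ => by rw [h0]; exact hasDerivWithinAt_const ..) (fun _ _ => hmem t ht) rfl
  have h1 := hEq (left_mem_Icc.2 ht.1)
  rw [Φ.init z hz] at h1
  exact hz0 (by rw [h1]; exact h)

lemma mem_causalCone {F : E → E} (hG : IsOrientedLorentzOn G F U) {z : E × E}
    (hz : z ∈ Metric.closedBall (y₀, (0 : E)) (Φ.R / 2)) (hzt : z.2 ∈ causalCone (G z.1) (F z.1))
    {t : ℝ} (ht : t ∈ Icc 0 Φ.τ) :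
    (Φ.Z z t).2 ∈ causalCone (G (Φ.Z z t).1) (F (Φ.Z z t).1) := by
  have hen : ∀ t ∈ Icc 0 Φ.τ, G (Φ.Z z t).1 (Φ.Z z t).2 (Φ.Z z t).2 ≤ 0 := fun t ht => by
    rw [energy_eq hG.toIsLorentzMetricOn hz ht]; exact hzt.1
  have hz0 : z.2 ≠ 0 := by
    intro h
    have := hzt.2
    rw [h] at this
    simp at this
  refine ⟨hen t ht, ?_⟩
  have hmaps : MapsTo (fun t => (Φ.Z z t).1) (Icc 0 Φ.τ) U := fun t ht => fst_mem hz ht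
  have hc : ContinuousOn (fun t => G (Φ.Z z t).1 (Φ.Z z t).2 (F (Φ.Z z t).1)) (Icc 0 Φ.τ) :=
    ((hG.contDiffOn.continuousOn.comp (continuousOn hz).fst hmaps).clm_apply
      (continuousOn hz).snd).clm_apply
      (hG.future_continuousOn.comp (continuousOn hz).fst hmaps)
  by_contra! h
  have h0 : G (Φ.Z z 0).1 (Φ.Z z 0).2 (F (Φ.Z z 0).1) ≤ 0 := by
    rw [Φ.init z hz]; exact hzt.2.le
  obtain ⟨s, hs, hs0⟩ := intermediate_value_Icc ht.1 (hc.mono (Icc_subset_Icc_right ht.2)) ⟨h0, h⟩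
  have hs' : s ∈ Icc 0 Φ.τ := Icc_subset_Icc_right ht.2 hs
  have hsU := fst_mem hz hs'
  exact (hG.lorentz _ hsU).ne_zero_of_causal (hG.future_timelike _ hsU)
    (snd_ne_zero hz hz0 hs') (hen s hs') hs0

end LocalGeodesicFlow

lemma contDiffOn_one_of_hasDerivWithinAt {E : Type*} [NormedAddCommGroup E] [NormedSpace ℝ E]
    {σ σ' : ℝ → E} {a b : ℝ} (hab : a < b)
    (hd : ∀ t ∈ Icc a b, HasDerivWithinAt σ (σ' t) (Icc a b) t) (hc : ContinuousOn σ' (Icc a b)) :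
    ContDiffOn ℝ 1 σ (Icc a b) := by
  rw [contDiffOn_one_iff_derivWithin (uniqueDiffOn_Icc hab)]
  exact ⟨fun t ht => (hd t ht).differentiableWithinAt,
    hc.congr fun t ht => (hd t ht).derivWithin (uniqueDiffOn_Icc hab t ht)⟩

section Local

variable {d : ℕ} {M : Type*} [TopologicalSpace M] [ChartedSpace (Coord d) M]
  [IsManifold (𝓡 d) ∞ M] {g : LorentzStructure d M}

/-- A `C¹` coordinate curve with causal velocity is a causal curve. -/
lemma isC1Causal_of_coord (x₀ : M) {σ σ' : ℝ → Coord d} {a b : ℝ} (hab : a < b)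
    (hT : ∀ t ∈ Icc a b, σ t ∈ (extChartAt (𝓡 d) x₀).target)
    (hd : ∀ t ∈ Icc a b, HasDerivWithinAt σ (σ' t) (Icc a b) t) (hσ' : ContinuousOn σ' (Icc a b))
    (hc : ∀ t ∈ Icc a b, σ' t ∈ causalCone (coordMetric g x₀ (σ t)) (coordFuture g x₀ (σ t))) :
    IsC1Causal g (fun t => (extChartAt (𝓡 d) x₀).symm (σ t)) a b := by
  refine ⟨(contMDiffOn_extChartAt_symm (I := 𝓡 d) (n := 1) x₀).comp
    (contDiffOn_one_of_hasDerivWithinAt hab hd hσ').contMDiffOn hT, fun t ht => ?_⟩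
  have htT := hT t ht
  rw [velocity_eq_of_hasDerivWithinAt x₀ (uniqueDiffOn_Icc hab t ht) (hd t ht) htT,
    ← chartDeriv_mem_causalCone_iff g x₀ ((extChartAt (𝓡 d) x₀).map_target htT),
    chartDeriv_chartSymmDeriv x₀ htT, (extChartAt (𝓡 d) x₀).right_inv htT]
  exact hc t ht

/-- Short timelike coordinate segments that end in the closure of a past set start in it. -/
lemma IsPastSet.exists_segment {L : Set M} (hL : IsPastSet g L) (x₀ : M) {y₀ e : Coord d}
    (hy₀ : y₀ ∈ (extChartAt (𝓡 d) x₀).target)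
    (he : e ∈ timelikeCone (coordMetric g x₀ y₀) (coordFuture g x₀ y₀)) :
    ∃ η > 0, ∀ y ∈ Metric.ball y₀ η, ∀ y' ∈ Metric.ball y₀ η, ∀ s > (0 : ℝ),
      s⁻¹ • (y' - y) ∈ Metric.ball e η → (extChartAt (𝓡 d) x₀).symm y' ∈ closure L →
        (extChartAt (𝓡 d) x₀).symm y ∈ L := by
  obtain ⟨η₁, hη₁, hseg⟩ := exists_timelike_segment g x₀ hy₀ he
  obtain ⟨η₂, hη₂, hball⟩ := Metric.isOpen_iff.1 (isOpen_extChartAt_target (I := 𝓡 d) x₀) y₀ hy₀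
  refine ⟨min η₁ η₂, lt_min hη₁ hη₂, fun y hy y' hy' s hs hslope hcl => ?_⟩
  have hb1 := Metric.ball_subset_ball (x := y₀) (min_le_left η₁ η₂)
  have hy'T := hball (Metric.ball_subset_ball (min_le_right η₁ η₂) hy')
  set q := (extChartAt (𝓡 d) x₀).symm y' with hq
  have hqs : q ∈ (extChartAt (𝓡 d) x₀).source := (extChartAt (𝓡 d) x₀).map_target hy'T
  have hφ := continuousAt_extChartAt' (I := 𝓡 d) hqs
  have hval : extChartAt (𝓡 d) x₀ q = y' := (extChartAt (𝓡 d) x₀).right_inv hy'T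
  have hev1 : ∀ᶠ x in 𝓝 q, s⁻¹ • (extChartAt (𝓡 d) x₀ x - y) ∈ Metric.ball e η₁ := by
    have : ContinuousAt (fun x => s⁻¹ • (extChartAt (𝓡 d) x₀ x - y)) q :=
      (hφ.sub continuousAt_const).const_smul s⁻¹
    refine this.eventually (Metric.isOpen_ball.mem_nhds ?_)
    simp only [hval]
    exact Metric.ball_subset_ball (min_le_left _ _) hslope
  have hev2 : ∀ᶠ x in 𝓝 q, extChartAt (𝓡 d) x₀ x ∈ Metric.ball y₀ η₁ :=
    hφ.eventually (Metric.isOpen_ball.mem_nhds (by rw [hval]; exact hb1 hy'))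
  have hev3 : ∀ᶠ x in 𝓝 q, x ∈ (extChartAt (𝓡 d) x₀).source :=
    (isOpen_extChartAt_source x₀).mem_nhds hqs
  obtain ⟨x, ⟨h1, h2, h3⟩, h4⟩ := mem_closure_iff_nhds.1 hcl _ (hev1.and (hev2.and hev3))
  have h5 := hseg y (hb1 hy) _ h2 s hs h1
  rw [(extChartAt (𝓡 d) x₀).left_inv h3] at h5
  exact hL.down _ _ h5 h4

/-- A set lies in the closure of its chronological past. -/
lemma subset_closure_pastOf (g : LorentzStructure d M) (W : Set M) : W ⊆ closure (pastOf g W) := by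
  intro x hx
  have hG := isOrientedLorentzOn_coord g x
  set y₀ := extChartAt (𝓡 d) x x with hy₀def
  have hy₀ : y₀ ∈ (extChartAt (𝓡 d) x).target := mem_extChartAt_target x
  have he := hG.future_mem hy₀
  set e := coordFuture g x y₀
  obtain ⟨η, hη, hseg⟩ := exists_timelike_segment g x hy₀ he
  have hlim : Tendsto (fun s : ℝ => y₀ - s • e) (𝓝[>] 0) (𝓝 y₀) := by
    have : Continuous fun s : ℝ => y₀ - s • e := by fun_prop
    exact (by simpa using this.tendsto 0 : Tendsto _ _ _).mono_left nhdsWithin_le_nhds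
  have hlim2 : Tendsto (fun s : ℝ => (extChartAt (𝓡 d) x).symm (y₀ - s • e)) (𝓝[>] 0) (𝓝 x) := by
    have := (continuousAt_extChartAt_symm (I := 𝓡 d) x).tendsto.comp hlim
    rwa [← hy₀def, hy₀def, extChartAt_to_inv] at this
  refine mem_closure_of_tendsto hlim2 ?_
  filter_upwards [hlim.eventually (Metric.ball_mem_nhds y₀ hη), self_mem_nhdsWithin] with s h1 h2
  have h3 := hseg _ h1 y₀ (Metric.mem_ball_self hη) s h2 (by
    rw [sub_sub_cancel, smul_smul, inv_mul_cancel₀ (ne_of_gt h2), one_smul]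
    exact Metric.mem_ball_self hη)
  rw [hy₀def, extChartAt_to_inv] at h3
  exact mem_iUnion₂.2 ⟨x, hx, h3⟩

/-- Before a curve leaves a compact set with open core it meets the boundary. -/
lemma exists_first_exit {γ : ℝ → M} {a b : ℝ} {N : Set M} (hN : IsOpen N)
    (hγ : ContinuousOn γ (Icc a b)) (ha : γ a ∈ N) (hb : ∃ t ∈ Icc a b, γ t ∉ N) :
    ∃ t ∈ Ioc a b, γ t ∉ N ∧ γ t ∈ closure N ∧ ∀ u ∈ Ico a t, γ u ∈ N := by
  obtain ⟨t₁, ht₁, hbN⟩ := hb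
  set Z := Icc a b ∩ γ ⁻¹' Nᶜ with hZ
  have hZc : IsClosed Z := hγ.preimage_isClosed_of_isClosed isClosed_Icc hN.isClosed_compl
  have hZne : Z.Nonempty := ⟨t₁, ht₁, hbN⟩
  have hZb : BddBelow Z := ⟨a, fun t ht => ht.1.1⟩
  have hmem := hZc.csInf_mem hZne hZb
  set t := sInf Z with ht
  have hne : t ≠ a := fun h => hmem.2 (by rw [h]; exact ha)
  have hat : a < t := lt_of_le_of_ne hmem.1.1 (Ne.symm hne)
  have hbefore : ∀ u ∈ Ico a t, γ u ∈ N := by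
    intro u hu
    by_contra hcon
    exact not_le.2 hu.2 (csInf_le hZb ⟨⟨hu.1, hu.2.le.trans hmem.1.2⟩, hcon⟩)
  refine ⟨t, ⟨hat, hmem.1.2⟩, hmem.2, ?_, hbefore⟩
  have h1 : ContinuousWithinAt γ (Ico a t) t :=
    (hγ t hmem.1).mono (Ico_subset_Icc_self.trans (Icc_subset_Icc_right hmem.1.2))
  have h2 : t ∈ closure (Ico a t) := by
    rw [closure_Ico hat.ne]; exact right_mem_Icc.2 hat.le
  exact closure_mono (image_subset_iff.2 hbefore) (h1.mem_closure_image h2)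

end Local

end Spacetimes

end

noncomputable section

set_option maxSynthPendingDepth 3

namespace Spacetimes

section Local

variable {d : ℕ} {M : Type*} [TopologicalSpace M] [ChartedSpace (Coord d) M]

/-- The inverse image in `M` of a coordinate ball. -/
def chartBall (d : ℕ) {M : Type*} [TopologicalSpace M] [ChartedSpace (Coord d) M] (x₀ : M) (r : ℝ) : Set M :=
  (extChartAt (𝓡 d) x₀).source ∩
    extChartAt (𝓡 d) x₀ ⁻¹' Metric.ball (extChartAt (𝓡 d) x₀ x₀) r

lemma isOpen_chartBall (x₀ : M) (r : ℝ) : IsOpen (chartBall d x₀ r) :=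
  (continuousOn_extChartAt (I := 𝓡 d) x₀).isOpen_inter_preimage (isOpen_extChartAt_source x₀)
    Metric.isOpen_ball

lemma mem_chartBall_self (x₀ : M) {r : ℝ} (hr : 0 < r) : x₀ ∈ chartBall d x₀ r :=
  ⟨mem_extChartAt_source x₀, Metric.mem_ball_self hr⟩

lemma closure_chartBall_subset [T2Space M] (x₀ : M) {r : ℝ}
    (hr : Metric.closedBall (extChartAt (𝓡 d) x₀ x₀) r ⊆ (extChartAt (𝓡 d) x₀).target) :
    closure (chartBall d x₀ r) ⊆ (extChartAt (𝓡 d) x₀).source ∩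
      extChartAt (𝓡 d) x₀ ⁻¹' Metric.closedBall (extChartAt (𝓡 d) x₀ x₀) r := by
  set K := (extChartAt (𝓡 d) x₀).symm '' Metric.closedBall (extChartAt (𝓡 d) x₀ x₀) r with hK
  have hKc : IsCompact K := (isCompact_closedBall _ _).image_of_continuousOn
    ((continuousOn_extChartAt_symm x₀).mono hr)
  have h1 : chartBall d x₀ r ⊆ K := fun x hx =>
    ⟨_, Metric.ball_subset_closedBall hx.2, (extChartAt (𝓡 d) x₀).left_inv hx.1⟩
  refine (closure_minimal h1 hKc.isClosed).trans ?_
  rintro _ ⟨z, hz, rfl⟩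
  refine ⟨(extChartAt (𝓡 d) x₀).map_target (hr hz), ?_⟩
  rwa [mem_preimage, (extChartAt (𝓡 d) x₀).right_inv (hr hz)]

variable [IsManifold (𝓡 d) ∞ M] {g : LorentzStructure d M}

/-- A causal curve that starts in the timelike future of a point stays there until it leaves a small
ball. -/
lemma IsCausalCurve.stay_or_exit [T2Space M] {x₀ : M} {κ : ℝ}
    (Φ : LocalGeodesicFlow (coordMetric g x₀) (extChartAt (𝓡 d) x₀).target
      (extChartAt (𝓡 d) x₀ x₀) κ) (hκ0 : 0 ≤ κ) (hκ : κ ≤ 1 / 2) {y : Coord d} {r : ℝ}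
    (hr : r ≤ Φ.τ * Φ.R / 8)
    (hy : y ∈ Metric.closedBall (extChartAt (𝓡 d) x₀ x₀) (Φ.τ * Φ.R / 8)) {γ : ℝ → M} {a b : ℝ}
    (hab : a ≤ b) (hγ : IsCausalCurve g γ (Icc a b)) (ha : γ a ∈ chartBall d x₀ r)
    (haI : extChartAt (𝓡 d) x₀ (γ a) ∈ Φ.timelikeImage (coordFuture g x₀) y) :
    ((∀ t ∈ Icc a b, γ t ∈ chartBall d x₀ r) ∧
      extChartAt (𝓡 d) x₀ (γ b) ∈ Φ.timelikeImage (coordFuture g x₀) y) ∨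
    ∃ t ∈ Ioc a b, γ t ∈ (extChartAt (𝓡 d) x₀).source ∧
      dist (extChartAt (𝓡 d) x₀ (γ t)) (extChartAt (𝓡 d) x₀ x₀) = r ∧
      extChartAt (𝓡 d) x₀ (γ t) ∈ Φ.timelikeImage (coordFuture g x₀) y := by
  have hG := isOrientedLorentzOn_coord g x₀
  have hτ := Φ.τ_pos
  have hR := Φ.R_pos
  have hτ1 := Φ.τ_le
  have hrT : Metric.closedBall (extChartAt (𝓡 d) x₀ x₀) r ⊆ (extChartAt (𝓡 d) x₀).target :=
    (Metric.closedBall_subset_closedBall (by nlinarith)).trans Φ.ball_subset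
  have key : ∀ t ∈ Icc a b, (∀ u ∈ Icc a t, γ u ∈ (extChartAt (𝓡 d) x₀).source ∧
      extChartAt (𝓡 d) x₀ (γ u) ∈ Metric.closedBall (extChartAt (𝓡 d) x₀ x₀) r) →
      extChartAt (𝓡 d) x₀ (γ t) ∈ Φ.timelikeImage (coordFuture g x₀) y := by
    intro t ht hu
    refine LocalGeodesicFlow.propagate (c := fun u => extChartAt (𝓡 d) x₀ (γ u))
      hG.toIsLorentzMetricOn hG.future_continuousOn hG.future_timelike hκ0 hκ hy ht.1 ?_ ?_ ?_ haI
    · exact (continuousOn_extChartAt x₀).comp (hγ.2.1.mono (Icc_subset_Icc_right ht.2))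
        fun u h => (hu u h).1
    · exact fun u h => Metric.closedBall_subset_closedBall hr (hu u h).2
    · exact fun u h => hγ.exists_right_deriv x₀ (h.2.trans_le ht.2) (Icc_subset_Icc_left h.1)
        (hu u (Ico_subset_Icc_self h)).1
  by_cases hex : ∃ t ∈ Icc a b, γ t ∉ chartBall d x₀ r
  · obtain ⟨t, ht, hout, hcl, hin⟩ := exists_first_exit (isOpen_chartBall x₀ r) hγ.2.1 ha hex
    have hcl' := closure_chartBall_subset x₀ hrT hcl
    refine Or.inr ⟨t, ht, hcl'.1, le_antisymm hcl'.2 ?_, key t (Ioc_subset_Icc_self ht) ?_⟩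
    · by_contra! h
      exact hout ⟨hcl'.1, h⟩
    · intro u hu
      rcases hu.2.eq_or_lt with rfl | h
      · exact hcl'
      · have := hin u ⟨hu.1, h⟩
        exact ⟨this.1, Metric.ball_subset_closedBall this.2⟩
  · push Not at hex
    refine Or.inl ⟨hex, key b (right_mem_Icc.2 hab) fun u hu => ?_⟩
    exact ⟨(hex u hu).1, Metric.ball_subset_closedBall (hex u hu).2⟩

/-- From each point of the past of a future-infinite worldline in a small ball a causal curve in
the closure of the past leaves the ball. -/
lemma exists_exit_point [T2Space M] {x₀ : M} {κ : ℝ}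
    (Φ : LocalGeodesicFlow (coordMetric g x₀) (extChartAt (𝓡 d) x₀).target
      (extChartAt (𝓡 d) x₀ x₀) κ) (hκ0 : 0 ≤ κ) (hκ : κ ≤ 1 / 2) {r : ℝ}
    (hr : r ≤ Φ.τ * Φ.R / 8)
    (hesc : ∀ (γ : ℝ → M) (s : Set ℝ), IsCausalCurve g γ s → IsFutureInfinite g γ s →
      ∀ t₀ ∈ s, ∃ t ∈ s, t₀ ≤ t ∧ γ t ∉ chartBall d x₀ r) {W : Set M}
    (hW : IsFutureInfiniteWorldline g W) {x : M} (hx : x ∈ pastOf g W)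
    (hxr : x ∈ chartBall d x₀ r) {y : Coord d}
    (hy : y ∈ Metric.closedBall (extChartAt (𝓡 d) x₀ x₀) (Φ.τ * Φ.R / 8))
    (hxy : extChartAt (𝓡 d) x₀ x ∈ Φ.timelikeImage (coordFuture g x₀) y) :
    ∃ z ∈ Φ.timelikeImage (coordFuture g x₀) y, z ∈ (extChartAt (𝓡 d) x₀).target ∧
      dist z (extChartAt (𝓡 d) x₀ x₀) = r ∧
      (extChartAt (𝓡 d) x₀).symm z ∈ closure (pastOf g W) := by
  obtain ⟨γ, s, -, hγ, hinf, rfl⟩ := hW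
  obtain ⟨w, ⟨t₁, ht₁, rfl⟩, σ, a, b, hab, hσ, rfl, hσb, -⟩ := mem_iUnion₂.1 hx
  suffices h : ∃ q ∈ (extChartAt (𝓡 d) x₀).source,
      dist (extChartAt (𝓡 d) x₀ q) (extChartAt (𝓡 d) x₀ x₀) = r ∧
      extChartAt (𝓡 d) x₀ q ∈ Φ.timelikeImage (coordFuture g x₀) y ∧
      q ∈ closure (pastOf g (γ '' s)) by
    obtain ⟨q, h1, h2, h3, h4⟩ := h
    exact ⟨extChartAt (𝓡 d) x₀ q, h3, (extChartAt (𝓡 d) x₀).map_source h1, h2, by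
      rwa [(extChartAt (𝓡 d) x₀).left_inv h1]⟩
  rcases IsCausalCurve.stay_or_exit Φ hκ0 hκ hr hy hab.le hσ.isCausalCurve hxr hxy with
    ⟨h1, h2⟩ | ⟨t, ht, h1, h2, h3⟩
  · rw [hσb] at h2
    have h3 := h1 b (right_mem_Icc.2 hab.le)
    rw [hσb] at h3
    obtain ⟨t₂, ht₂, h12, hout⟩ := hesc γ s hγ hinf t₁ ht₁
    have hsub : Icc t₁ t₂ ⊆ s := hγ.1.out ht₁ ht₂
    rcases IsCausalCurve.stay_or_exit Φ hκ0 hκ hr hy h12 (IsCurveIn.mono hγ hsub ordConnected_Icc)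
      h3 h2 with ⟨h4, -⟩ | ⟨t, ht, h4, h5, h6⟩
    · exact absurd (h4 t₂ (right_mem_Icc.2 h12)) hout
    · exact ⟨_, h4, h5, h6,
        subset_closure_pastOf g _ (mem_image_of_mem γ (hsub (Ioc_subset_Icc_self ht)))⟩
  · refine ⟨_, h1, h2, h3, ?_⟩
    rcases ht.2.eq_or_lt with rfl | h
    · rw [hσb]
      exact subset_closure_pastOf g _ (mem_image_of_mem γ ht₁)
    · refine subset_closure (mem_iUnion₂.2 ⟨γ t₁, mem_image_of_mem γ ht₁, ?_⟩)
      have := TimelikeJoined.of_curve h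
        (IsCurveIn.mono hσ (Icc_subset_Icc_left ht.1.le) ordConnected_Icc)
      rwa [hσb] at this

/-- Through each point of the horizon of a future-infinite worldline, a short null geodesic runs in
the closure of the past of the worldline. -/
theorem exists_null_germ [T2Space M] {W : Set M} (hW : IsFutureInfiniteWorldline g W) {p : M}
    (hp : p ∈ horizon g W) : ∃ τ > 0, ∃ α : ℝ → Coord d × Coord d,
      (∀ t ∈ Icc 0 τ, (α t).1 ∈ (extChartAt (𝓡 d) p).target ∧
        HasDerivWithinAt α (geodesicField (coordMetric g p) (α t)) (Icc 0 τ) t ∧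
        (extChartAt (𝓡 d) p).symm (α t).1 ∈ closure (pastOf g W)) ∧
      (α 0).1 = extChartAt (𝓡 d) p p ∧
      (α 0).2 ∈ causalCone (coordMetric g p (extChartAt (𝓡 d) p p))
        (coordFuture g p (extChartAt (𝓡 d) p p)) ∧
      coordMetric g p (extChartAt (𝓡 d) p p) (α 0).2 (α 0).2 = 0 := by
  have hL := isPastSet_pastOf g W
  have hpcl : p ∈ closure (pastOf g W) := frontier_subset_closure hp
  have hpL : p ∉ pastOf g W := fun h => by
    have := hp.2
    rw [hL.isOpen.interior_eq] at this
    exact this h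
  have hG := isOrientedLorentzOn_coord g p
  obtain ⟨ρ, hρ, hesc⟩ := exists_ball_escape g p
  set y₀ := extChartAt (𝓡 d) p p with hy₀def
  have hy₀ : y₀ ∈ (extChartAt (𝓡 d) p).target := mem_extChartAt_target p
  have he := hG.future_mem hy₀
  obtain ⟨η, hη, hball⟩ := hG.exists_timelike_ball hy₀ he
  set e := coordFuture g p y₀ with hedef
  obtain ⟨κ, hκ0, hκ, hκη⟩ : ∃ κ : ℝ, 0 < κ ∧ κ ≤ 1 / 2 ∧ 2 * κ * ‖e‖ < η := by
    refine ⟨min (1 / 2) (η / (2 * (‖e‖ + 1))), lt_min (by norm_num) (by positivity),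
      min_le_left _ _, ?_⟩
    have h1 : min (1 / 2) (η / (2 * (‖e‖ + 1))) ≤ η / (2 * (‖e‖ + 1)) := min_le_right _ _
    have h2 : 2 * (η / (2 * (‖e‖ + 1))) * (‖e‖ + 1) = η := by field_simp
    have h3 : 0 < η / (2 * (‖e‖ + 1)) := by positivity
    nlinarith [norm_nonneg e]
  obtain ⟨Φ, -⟩ := hG.toIsLorentzMetricOn.exists_localGeodesicFlow hy₀ hκ0 one_pos
  have hτ := Φ.τ_pos
  have hR := Φ.R_pos
  have hτ1 := Φ.τ_le
  obtain ⟨r, hr0, hr, hrρ⟩ : ∃ r : ℝ, 0 < r ∧ r ≤ Φ.τ * Φ.R / 8 ∧ r ≤ ρ :=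
    ⟨min (Φ.τ * Φ.R / 8) ρ, lt_min (by positivity) hρ, min_le_left _ _, min_le_right _ _⟩
  have hτR : Φ.τ * Φ.R / 8 ≤ Φ.R / 2 := by nlinarith
  have hesc' : ∀ (γ : ℝ → M) (s : Set ℝ), IsCausalCurve g γ s → IsFutureInfinite g γ s →
      ∀ t₀ ∈ s, ∃ t ∈ s, t₀ ≤ t ∧ γ t ∉ chartBall d p r := by
    intro γ s h1 h2 t₀ ht₀
    obtain ⟨t, ht, htt, hn⟩ := hesc γ s h1 h2 t₀ ht₀
    exact ⟨t, ht, htt, fun h => hn ⟨h.1, Metric.ball_subset_ball hrρ h.2⟩⟩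
  -- approximating base points and exit points
  have happ : ∀ ε > 0, ∃ y v, dist y y₀ < ε ∧ y ∈ Metric.closedBall y₀ (Φ.R / 2) ∧
      y ∈ Metric.ball y₀ η ∧ v ∈ Metric.closedBall (0 : Coord d) (Φ.R / 2) ∧
      v ∈ timelikeCone (coordMetric g p y) (coordFuture g p y) ∧
      dist (Φ.exp y v) y₀ = r ∧ Φ.exp y v ∈ (extChartAt (𝓡 d) p).target ∧
      (extChartAt (𝓡 d) p).symm (Φ.exp y v) ∈ closure (pastOf g W) := by
    intro ε hε
    set ε' := min (min ε η) (min r (Φ.τ * Φ.R / 8)) with hε'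
    have hε'0 : 0 < ε' := lt_min (lt_min hε hη) (lt_min hr0 (by positivity))
    obtain ⟨x, hx, hxL⟩ := mem_closure_iff_nhds.1 hpcl _
      ((isOpen_chartBall (d := d) p (ε' / 2)).mem_nhds (mem_chartBall_self p (half_pos hε'0)))
    obtain ⟨δ, hδ, hδ1, hδ2⟩ : ∃ δ > 0, δ * ‖e‖ < ε' / 2 ∧ δ * ‖e‖ ≤ Φ.τ * Φ.R / 4 := by
      refine ⟨min (ε' / 2) (Φ.τ * Φ.R / 4) / (‖e‖ + 1), by positivity, ?_, ?_⟩
      · rw [div_mul_eq_mul_div, div_lt_iff₀ (by positivity)]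
        have := min_le_left (ε' / 2) (Φ.τ * Φ.R / 4)
        nlinarith [norm_nonneg e]
      · rw [div_mul_eq_mul_div, div_le_iff₀ (by positivity)]
        have := min_le_right (ε' / 2) (Φ.τ * Φ.R / 4)
        have : 0 < Φ.τ * Φ.R := by positivity
        nlinarith [norm_nonneg e]
    set y := extChartAt (𝓡 d) p x - δ • e with hydef
    have hyε : dist y y₀ < ε' := by
      have h1 : dist y (extChartAt (𝓡 d) p x) = δ * ‖e‖ := by
        rw [dist_eq_norm, hydef, sub_sub_cancel_left, norm_neg, norm_smul,
          Real.norm_of_nonneg hδ.le]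
      have h2 : dist (extChartAt (𝓡 d) p x) y₀ < ε' / 2 := hx.2
      linarith [dist_triangle y (extChartAt (𝓡 d) p x) y₀]
    have l1 : ε' ≤ ε := (min_le_left _ _).trans (min_le_left _ _)
    have l2 : ε' ≤ η := (min_le_left _ _).trans (min_le_right _ _)
    have l3 : ε' ≤ r := (min_le_right _ _).trans (min_le_left _ _)
    have l4 : ε' ≤ Φ.τ * Φ.R / 8 := (min_le_right _ _).trans (min_le_right _ _)
    have hyR : y ∈ Metric.closedBall y₀ (Φ.R / 2) := (hyε.le.trans l4).trans hτR
    have hyη : y ∈ Metric.ball y₀ η := hyε.trans_le l2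
    have hxI := LocalGeodesicFlow.mem_timelikeImage (Φ := Φ) hκ0.le hκ
      (fun y hy => (hball y hy).2) hκη hδ hyR hyη hδ2
    rw [hydef, sub_add_cancel, ← hydef] at hxI
    obtain ⟨z, ⟨v, ⟨hv1, hv2⟩, rfl⟩, hzT, hzr, hzL⟩ := exists_exit_point Φ hκ0.le hκ hr hesc' hW hxL
      ⟨hx.1, Metric.ball_subset_ball (by linarith) hx.2⟩ (hyε.le.trans l4) hxI
    exact ⟨y, v, hyε.trans_le l1, hyR, hyη, hv1, hv2, hzr, hzT, hzL⟩
  choose Y V hY hYR hYη hV hVt hVr hVT hVL using fun n : ℕ =>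
    happ (1 / ((n : ℝ) + 1)) (by positivity)
  have hYlim : Tendsto Y atTop (𝓝 y₀) := by
    rw [tendsto_iff_dist_tendsto_zero]
    exact squeeze_zero (fun _ => dist_nonneg) (fun n => (hY n).le)
      tendsto_one_div_add_atTop_nhds_zero_nat
  obtain ⟨w, hw, φ, hφ, hwlim⟩ := (isCompact_closedBall (0 : Coord d) (Φ.R / 2)).tendsto_subseq hV
  have hYlim' : Tendsto (Y ∘ φ) atTop (𝓝 y₀) := hYlim.comp hφ.tendsto_atTop
  have hy₀R : y₀ ∈ Metric.closedBall y₀ (Φ.R / 2) := Metric.mem_closedBall_self (by positivity)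
  have hexp : Tendsto (fun n => Φ.exp (Y (φ n)) (V (φ n))) atTop (𝓝 (Φ.exp y₀ w)) := by
    rw [tendsto_iff_dist_tendsto_zero]
    refine squeeze_zero (fun _ => dist_nonneg)
      (fun n => LocalGeodesicFlow.dist_exp_le (hYR _) (hV _) hy₀R hw) ?_
    have := (hYlim'.prodMk_nhds hwlim).dist (tendsto_const_nhds (x := (y₀, w)))
    rw [dist_self] at this
    simpa using this.const_mul 2
  have hdist : dist (Φ.exp y₀ w) y₀ = r := by
    have h1 := hexp.dist (tendsto_const_nhds (x := y₀))
    simp only [hVr] at h1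
    exact tendsto_nhds_unique h1 tendsto_const_nhds
  have hw0 : w ≠ 0 := by
    rintro rfl
    rw [LocalGeodesicFlow.exp_zero hy₀R, dist_self] at hdist
    exact hr0.ne hdist
  have hwc : w ∈ causalCone (coordMetric g p y₀) (coordFuture g p y₀) :=
    hG.mem_causalCone_of_limit hy₀ hw0 hYlim' hwlim fun n => hVt _
  have hz := mk_mem_closedBall hy₀R hw
  have hqT : Φ.exp y₀ w ∈ (extChartAt (𝓡 d) p).target :=
    LocalGeodesicFlow.fst_mem hz ⟨hτ.le, le_rfl⟩
  have hqL : (extChartAt (𝓡 d) p).symm (Φ.exp y₀ w) ∈ closure (pastOf g W) :=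
    isClosed_closure.mem_of_tendsto
      (((continuousOn_extChartAt_symm p).continuousAt
        ((isOpen_extChartAt_target p).mem_nhds hqT)).tendsto.comp hexp)
      (Eventually.of_forall fun n => hVL _)
  set α := Φ.Z (y₀, w) with hα
  have hα0 : α 0 = (y₀, w) := Φ.init _ hz
  have hT : ∀ t ∈ Icc 0 Φ.τ, (α t).1 ∈ (extChartAt (𝓡 d) p).target := fun t ht =>
    LocalGeodesicFlow.fst_mem hz ht
  have hd : ∀ t ∈ Icc 0 Φ.τ, HasDerivWithinAt (fun t => (α t).1) (α t).2 (Icc 0 Φ.τ) t :=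
    fun t ht => hasDerivWithinAt_fst (Φ.deriv _ hz t ht)
  have hC1 : IsC1Causal g (fun t => (extChartAt (𝓡 d) p).symm (α t).1) 0 Φ.τ :=
    isC1Causal_of_coord p hτ hT hd (LocalGeodesicFlow.continuousOn hz).snd
      fun t ht => LocalGeodesicFlow.mem_causalCone hG hz hwc ht
  have hcl : ∀ t ∈ Icc 0 Φ.τ, (extChartAt (𝓡 d) p).symm (α t).1 ∈ closure (pastOf g W) := by
    intro t ht
    rcases ht.2.eq_or_lt with h | h
    · rw [h]; exact hqL
    · exact (hL.of_causal h.le (hC1.mono ht.1 h le_rfl)).2 hqL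
  refine ⟨Φ.τ, hτ, α, fun t ht => ⟨hT t ht, Φ.deriv _ hz t ht, hcl t ht⟩, by rw [hα0],
    by rw [hα0]; exact hwc, ?_⟩
  rw [hα0]
  by_contra hnull
  have hwt : w ∈ timelikeCone (coordMetric g p y₀) (coordFuture g p y₀) :=
    ⟨lt_of_le_of_ne hwc.1 hnull, hwc.2⟩
  obtain ⟨η', hη', hseg⟩ := hL.exists_segment p hy₀ hwt
  have hd0 : HasDerivWithinAt (fun t => (α t).1) w (Ici 0) 0 := by
    have := hasDerivWithinAt_Ici_of_Icc (hd 0 ⟨le_rfl, hτ.le⟩) le_rfl hτ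
    rwa [hα0] at this
  have hev1 : ∀ᶠ t in 𝓝[>] (0 : ℝ), (t - 0)⁻¹ • ((α t).1 - (α 0).1) ∈ Metric.ball w η' :=
    (tendsto_slope_of_hasDerivWithinAt hd0).eventually (Metric.ball_mem_nhds w hη')
  have hev2 : ∀ᶠ t in 𝓝[>] (0 : ℝ), (α t).1 ∈ Metric.ball y₀ η' := by
    have := (hd0.continuousWithinAt.mono Ioi_subset_Ici_self).tendsto
    rw [hα0] at this
    exact this.eventually (Metric.ball_mem_nhds y₀ hη')
  obtain ⟨t, h1, h2, h3⟩ := (hev1.and (hev2.and (Ioo_mem_nhdsGT hτ))).exists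
  rw [hα0, sub_zero] at h1
  have := hseg y₀ (Metric.mem_ball_self hη') _ h2 t h3.1 h1 (hcl t (Ioo_subset_Icc_self h3))
  rw [hy₀def, extChartAt_to_inv] at this
  exact hpL this

end Local

end Spacetimes

end

noncomputable section

set_option maxSynthPendingDepth 3

namespace Spacetimes

section Global

variable {d : ℕ} {M : Type*} [TopologicalSpace M] [ChartedSpace (Coord d) M]
  [IsManifold (𝓡 d) ∞ M] {g : LorentzStructure d M}

lemma coordMetric_chartDeriv_of_mem (g : LorentzStructure d M) (x₀ : M) {x : M}
    (hx : x ∈ (extChartAt (𝓡 d) x₀).source) (v w : TangentSpace (𝓡 d) x) :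
    coordMetric g x₀ (extChartAt (𝓡 d) x₀ x) (chartDeriv x₀ x v) (chartDeriv x₀ x w) =
      g.metric x v w := by
  obtain ⟨y, hy, rfl⟩ : ∃ y ∈ (extChartAt (𝓡 d) x₀).target, (extChartAt (𝓡 d) x₀).symm y = x :=
    ⟨_, (extChartAt (𝓡 d) x₀).map_source hx, (extChartAt (𝓡 d) x₀).left_inv hx⟩
  rw [(extChartAt (𝓡 d) x₀).right_inv hy, coordMetric_chartDeriv g x₀ hy]

lemma chartDeriv_surjective (x₀ : M) {x : M} (hx : x ∈ (extChartAt (𝓡 d) x₀).source) (w : Coord d) :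
    ∃ v : TangentSpace (𝓡 d) x, chartDeriv x₀ x v = w := by
  obtain ⟨y, hy, rfl⟩ : ∃ y ∈ (extChartAt (𝓡 d) x₀).target, (extChartAt (𝓡 d) x₀).symm y = x :=
    ⟨_, (extChartAt (𝓡 d) x₀).map_source hx, (extChartAt (𝓡 d) x₀).left_inv hx⟩
  exact ⟨_, chartDeriv_chartSymmDeriv x₀ hy w⟩

lemma IsNullGeodesic.isC1Causal {γ : ℝ → M} {s : Set ℝ} (hγ : IsNullGeodesic g γ s) {a b : ℝ}
    (hab : a < b) (hs : Icc a b ⊆ s) : IsC1Causal g γ a b := by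
  refine ⟨(hγ.1.1.mono hs).of_le one_le_two, fun t ht => ?_⟩
  rw [velocity_eq_of_subset ((hγ.1.1.mdifferentiableOn two_ne_zero) t (hs ht)) hs
    (uniqueDiffOn_Icc hab t ht)]
  exact ⟨(hγ.2 t (hs ht)).1.le, (hγ.2 t (hs ht)).2⟩

/-- A geodesic solves the first-order geodesic system in a chart. -/
lemma IsGeodesic.hasDerivWithinAt_chart {γ : ℝ → M} {s : Set ℝ} (hγ : IsGeodesic g γ s)
    (hs : UniqueDiffOn ℝ s) (x₀ : M) {t : ℝ} (ht : t ∈ s)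
    (hx : γ t ∈ (extChartAt (𝓡 d) x₀).source) :
    HasDerivWithinAt (fun τ => (extChartAt (𝓡 d) x₀ (γ τ),
        derivWithin (fun τ => extChartAt (𝓡 d) x₀ (γ τ)) s τ))
      (geodesicField (coordMetric g x₀) (extChartAt (𝓡 d) x₀ (γ t),
        derivWithin (fun τ => extChartAt (𝓡 d) x₀ (γ τ)) s t)) s t := by
  set c : ℝ → Coord d := fun τ => extChartAt (𝓡 d) x₀ (γ τ) with hc
  have hx' : γ t ∈ (chartAt (Coord d) x₀).source := by rwa [extChartAt_source] at hx
  have h1 : ContDiffWithinAt ℝ 2 c s t :=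
    ((contMDiffAt_extChartAt' (I := 𝓡 d) (n := 2) hx').comp_contMDiffWithinAt t
      (hγ.1 t ht)).contDiffWithinAt
  have h2 : ContDiffWithinAt ℝ 1 (derivWithin c s) s t :=
    h1.derivWithin hs (by norm_num) ht
  have h3 := (h1.differentiableWithinAt two_ne_zero).hasDerivWithinAt
  have h4 := (h2.differentiableWithinAt one_ne_zero).hasDerivWithinAt
  have h5 : derivWithin (derivWithin c s) s t = spray (coordMetric g x₀) (c t) (derivWithin c s t) :=
    (isOrientedLorentzOn_coord g x₀).toIsLorentzMetricOn.eq_spray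
      ((extChartAt (𝓡 d) x₀).map_source hx) (hγ.2 t ht x₀ hx')
  rw [h5] at h4
  exact h3.prodMk h4

/-- Local uniqueness of geodesics, up to affine reparametrization. -/
lemma IsGeodesic.exists_eq_flow {γ : ℝ → M} (hγ : IsGeodesic g γ (Ici 0)) (x₀ : M) {T k τ : ℝ}
    (hT : 0 ≤ T) (hx : γ T ∈ (extChartAt (𝓡 d) x₀).source) (hk : 0 < k) (hτ : 0 < τ)
    {α : ℝ → Coord d × Coord d} (hα : ∀ t ∈ Icc 0 τ,
      HasDerivWithinAt α (geodesicField (coordMetric g x₀) (α t)) (Icc 0 τ) t)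
    (hα1 : (α 0).1 = extChartAt (𝓡 d) x₀ (γ T))
    (hα2 : derivWithin (fun τ => extChartAt (𝓡 d) x₀ (γ τ)) (Ici 0) T = k • (α 0).2) :
    ∃ ε > T, ∀ t ∈ Icc T ε, k * (t - T) ∈ Icc 0 τ ∧
      γ t = (extChartAt (𝓡 d) x₀).symm (α (k * (t - T))).1 := by
  have hG := isOrientedLorentzOn_coord g x₀
  set c : ℝ → Coord d := fun τ => extChartAt (𝓡 d) x₀ (γ τ) with hc
  set Ψ : ℝ → Coord d × Coord d := fun t => (c t, derivWithin c (Ici 0) t) with hΨ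
  set b : ℝ := T + τ / k with hb
  have hTb : T < b := by rw [hb]; linarith [div_pos hτ hk]
  set A : Coord d × Coord d →L[ℝ] Coord d × Coord d :=
    (ContinuousLinearMap.fst ℝ (Coord d) (Coord d)).prod
      (k • ContinuousLinearMap.snd ℝ (Coord d) (Coord d)) with hA
  set β : ℝ → Coord d × Coord d := fun t => A (α (k * (t - T))) with hβ
  have hmaps : MapsTo (fun t => k * (t - T)) (Icc T b) (Icc 0 τ) := by
    intro t ht
    refine ⟨mul_nonneg hk.le (sub_nonneg.2 ht.1), ?_⟩
    have h1 : t - T ≤ τ / k := by linarith [ht.2]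
    have := mul_le_mul_of_nonneg_left h1 hk.le
    rwa [mul_div_cancel₀ _ hk.ne'] at this
  have hβd : ∀ t ∈ Icc T b, HasDerivWithinAt β (geodesicField (coordMetric g x₀) (β t))
      (Icc T b) t := by
    intro t ht
    have h1 : HasDerivWithinAt (fun t => k * (t - T)) k (Icc T b) t := by
      simpa using ((hasDerivWithinAt_id t (Icc T b)).sub_const T).const_mul k
    have h2 := (hα _ (hmaps ht)).scomp t h1 hmaps
    have h3 := A.hasFDerivAt.comp_hasDerivWithinAt t h2
    refine h3.congr_deriv ?_
    simp only [hβ, hA, geodesicField, ContinuousLinearMap.prod_apply,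
      ContinuousLinearMap.coe_fst', ContinuousLinearMap.coe_snd', Prod.smul_mk, smul_apply,
      spray_smul, smul_smul]
  have hβT : β T = Ψ T := by
    simp only [hβ, hΨ, hA, sub_self, mul_zero, ContinuousLinearMap.prod_apply,
      ContinuousLinearMap.coe_fst', ContinuousLinearMap.coe_snd', smul_apply, hα1, hα2]
    rfl
  have hΨd : ∀ t, 0 ≤ t → γ t ∈ (extChartAt (𝓡 d) x₀).source →
      HasDerivWithinAt Ψ (geodesicField (coordMetric g x₀) (Ψ t)) (Ici 0) t := fun t ht hts =>
    hγ.hasDerivWithinAt_chart (uniqueDiffOn_Ici 0) x₀ ht hts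
  have hcd : ContDiffAt ℝ 1 (geodesicField (coordMetric g x₀)) (Ψ T) :=
    (hG.toIsLorentzMetricOn.contDiffOn_geodesicField.contDiffAt
      ((hG.isOpen.prod isOpen_univ).mem_nhds
        ⟨(extChartAt (𝓡 d) x₀).map_source hx, mem_univ _⟩)).of_le (by simp)
  obtain ⟨K, S, hS, hlip⟩ := hcd.exists_lipschitzOnWith
  have hsubT : Ici T ⊆ Ici 0 := Ici_subset_Ici.2 hT
  have hev1 : ∀ᶠ t in 𝓝[≥] T, Ψ t ∈ S :=
    ((hΨd T hT hx).continuousWithinAt.mono hsubT).eventually hS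
  have hev2 : ∀ᶠ t in 𝓝[≥] T, β t ∈ S := by
    have h := hβd T (left_mem_Icc.2 hTb.le)
    have h1 : ContinuousWithinAt β (Ici T) T :=
      (hasDerivWithinAt_Ici_of_Icc h le_rfl hTb).continuousWithinAt
    exact h1.eventually (by rw [hβT]; exact hS)
  have hev3 : ∀ᶠ t in 𝓝[≥] T, γ t ∈ (extChartAt (𝓡 d) x₀).source :=
    ((hγ.1.continuousOn T hT).mono hsubT).eventually
      ((isOpen_extChartAt_source x₀).mem_nhds hx)
  obtain ⟨ε, hε, hsub⟩ := mem_nhdsGE_iff_exists_Icc_subset.1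
    ((hev1.and (hev2.and hev3)).and (Icc_mem_nhdsGE hTb))
  have hEq := ODE_solution_unique_of_mem_Icc_right
    (v := fun _ => geodesicField (coordMetric g x₀)) (s := fun _ => S) (K := K) (f := Ψ) (g := β)
    (a := T) (b := ε) (fun _ _ => hlip)
    (fun t ht => ((hΨd t (hT.trans ht.1) (hsub ht).1.2.2).continuousWithinAt).mono
      fun u hu => hT.trans hu.1)
    (fun t ht => (hΨd t (hT.trans ht.1) (hsub (Ico_subset_Icc_self ht)).1.2.2).mono
      (Ici_subset_Ici.2 (hT.trans ht.1)))
    (fun t ht => (hsub (Ico_subset_Icc_self ht)).1.1)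
    (fun t ht => (hβd t (hsub ht).2).continuousWithinAt.mono fun u hu => (hsub hu).2)
    (fun t ht => (hβd t (hsub (Ico_subset_Icc_self ht)).2).mono_of_mem_nhdsWithin
      (mem_of_superset (Icc_mem_nhdsGE (ht.2.trans_le (hsub (right_mem_Icc.2 hε.le)).2.2))
        (Icc_subset_Icc_left ht.1)))
    (fun t ht => (hsub (Ico_subset_Icc_self ht)).1.2.1) hβT.symm
  refine ⟨ε, hε, fun t ht => ⟨hmaps (hsub ht).2, ?_⟩⟩
  have h1 : c t = (α (k * (t - T))).1 := congrArg Prod.fst (hEq ht)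
  rw [← h1, hc]
  exact ((extChartAt (𝓡 d) x₀).left_inv (hsub ht).1.2.2).symm

/-- Two causal geodesics in the closure of a past set that meet at a corner start in the set. -/
lemma IsPastSet.corner {L : Set M} (hL : IsPastSet g L) {γ : ℝ → M} {T τ : ℝ} (hT : 0 < T)
    (hτ : 0 < τ) {a w : Coord d} {σ : ℝ → Coord d}
    (hγ : HasDerivAt (fun t => extChartAt (𝓡 d) (γ T) (γ t)) a T)
    (hγc : ContinuousAt γ T)
    (hσ : HasDerivWithinAt σ w (Icc 0 τ) 0) (hσ0 : σ 0 = extChartAt (𝓡 d) (γ T) (γ T))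
    (hσL : ∀ t ∈ Icc 0 τ, (extChartAt (𝓡 d) (γ T)).symm (σ t) ∈ closure L)
    (haw : a + w ∈ timelikeCone (coordMetric g (γ T) (extChartAt (𝓡 d) (γ T) (γ T)))
      (coordFuture g (γ T) (extChartAt (𝓡 d) (γ T) (γ T)))) :
    ∃ t ∈ Ioo 0 T, γ t ∈ L := by
  set x₀ := γ T with hx₀
  set y₀ := extChartAt (𝓡 d) x₀ x₀ with hy₀def
  obtain ⟨η, hη, hseg⟩ := hL.exists_segment x₀ (mem_extChartAt_target x₀) haw
  have hlin : HasDerivAt (fun s : ℝ => T - s) (-1) 0 := by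
    simpa using (hasDerivAt_id (0 : ℝ)).const_sub T
  have hγ' : HasDerivAt (fun s : ℝ => extChartAt (𝓡 d) x₀ (γ (T - s))) (-a) 0 := by
    have h1 : HasDerivAt (fun t => extChartAt (𝓡 d) x₀ (γ t)) a (T - 0) := by rwa [sub_zero]
    have := h1.scomp (0 : ℝ) hlin
    rwa [neg_one_smul] at this
  have hσ' : HasDerivWithinAt σ w (Ici 0) 0 := hasDerivWithinAt_Ici_of_Icc hσ le_rfl hτ
  have hdiff := hσ'.sub hγ'.hasDerivWithinAt
  have hev1 := (tendsto_slope_of_hasDerivWithinAt hdiff).eventually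
    (Metric.ball_mem_nhds _ hη)
  have hlim : Tendsto (fun s : ℝ => T - s) (𝓝[>] 0) (𝓝 T) := by
    have := hlin.continuousAt.tendsto
    rw [sub_zero] at this
    exact this.mono_left nhdsWithin_le_nhds
  have hev2 : ∀ᶠ s in 𝓝[>] (0 : ℝ), extChartAt (𝓡 d) x₀ (γ (T - s)) ∈ Metric.ball y₀ η :=
    (hγ.continuousAt.tendsto.comp hlim).eventually (Metric.ball_mem_nhds _ hη)
  have hev3 : ∀ᶠ s in 𝓝[>] (0 : ℝ), σ s ∈ Metric.ball y₀ η := by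
    have := (hσ'.continuousWithinAt.mono Ioi_subset_Ici_self).tendsto
    rw [hσ0] at this
    exact this.eventually (Metric.ball_mem_nhds y₀ hη)
  have hev4 : ∀ᶠ s in 𝓝[>] (0 : ℝ), γ (T - s) ∈ (extChartAt (𝓡 d) x₀).source :=
    (hγc.tendsto.comp hlim).eventually (extChartAt_source_mem_nhds x₀)
  obtain ⟨s, h1, h2, h3, h4, h5⟩ :=
    (hev1.and (hev2.and (hev3.and (hev4.and (Ioo_mem_nhdsGT (lt_min hτ hT)))))).exists
  have h5T := h5.2.trans_le (min_le_right τ T)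
  refine ⟨T - s, ⟨by linarith, by linarith [h5.1]⟩, ?_⟩
  have h6 := hseg _ h2 _ h3 s h5.1 (by
    have e1 : w - -a = a + w := by abel
    have e2 : σ 0 - extChartAt (𝓡 d) x₀ (γ (T - 0)) = 0 := by rw [sub_zero, hσ0, sub_self]
    rw [e1] at h1
    simp only [Pi.sub_apply] at h1
    rwa [e2, sub_zero, sub_zero] at h1)
    (hσL s ⟨h5.1.le, (h5.2.trans_le (min_le_left τ T)).le⟩)
  rwa [(extChartAt (𝓡 d) x₀).left_inv h4] at h6

/-- Through each point of the horizon of a future-infinite worldline in a future null geodesically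
complete spacetime there passes a future-infinite null geodesic in the horizon. -/
theorem hasFutureInfiniteNullGeodesic [T2Space M] (hcomplete : FutureNullComplete g) {W : Set M}
    (hW : IsFutureInfiniteWorldline g W) {p : M} (hp : p ∈ horizon g W) :
    HasFutureInfiniteNullGeodesic g (horizon g W) p := by
  have hL := isPastSet_pastOf g W
  have hfr : horizon g W = closure (pastOf g W) \ pastOf g W := hL.isOpen.frontier_eq
  obtain ⟨τ, hτ, α, hα, hα1, hα2, hα3⟩ := exists_null_germ hW hp
  have hps := mem_extChartAt_source (I := 𝓡 d) p
  obtain ⟨v, hv⟩ := chartDeriv_surjective p hps (α 0).2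
  have hvn : v ∈ futureNull g p := by
    refine ⟨?_, ((chartDeriv_mem_causalCone_iff g p hps v).1 (by rwa [hv])).2⟩
    rw [← coordMetric_chartDeriv_of_mem g p hps, hv, hα3]
  obtain ⟨γ, hγ, h0⟩ := hcomplete p v hvn
  have hγ0 : γ 0 = p := congrArg (fun z : TangentBundle (𝓡 d) M => z.1) h0
  have hdw : ∀ T, 0 ≤ T → ∀ x₀ : M, γ T ∈ (extChartAt (𝓡 d) x₀).source →
      HasDerivWithinAt (fun τ => extChartAt (𝓡 d) x₀ (γ τ))
        (chartDeriv x₀ (γ T) (velocity γ (Ici 0) T)) (Ici 0) T := fun T hT x₀ hx =>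
    hasDerivWithinAt_chart x₀ (hγ.1.1.mdifferentiableOn two_ne_zero T hT) hx
  have hnotL : ∀ t, 0 ≤ t → γ t ∉ pastOf g W := by
    intro t ht h
    have hpL : p ∉ pastOf g W := by rw [hfr] at hp; exact hp.2
    rcases ht.eq_or_lt with rfl | ht
    · exact hpL (hγ0 ▸ h)
    · exact hpL (hγ0 ▸ (hL.of_causal ht.le (hγ.isC1Causal ht Icc_subset_Ici_self)).1 h)
  have hcl : ∀ t, 0 ≤ t → γ t ∈ closure (pastOf g W) := by
    by_contra! hcon
    obtain ⟨t₁, ht₁, hout⟩ := hcon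
    set A := Icc 0 t₁ ∩ γ ⁻¹' closure (pastOf g W) with hA
    have hAc : IsClosed A := (hγ.1.1.continuousOn.mono Icc_subset_Ici_self).preimage_isClosed_of_isClosed
      isClosed_Icc isClosed_closure
    have hAne : A.Nonempty := ⟨0, left_mem_Icc.2 ht₁, by
      rw [mem_preimage, hγ0]; exact frontier_subset_closure hp⟩
    have hAb : BddAbove A := ⟨t₁, fun t ht => ht.1.2⟩
    have hTA := hAc.csSup_mem hAne hAb
    set T := sSup A with hTdef
    have hTt : T < t₁ := lt_of_le_of_ne hTA.1.2 fun h => hout (h ▸ hTA.2)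
    -- a short extension of the geodesic leads to a contradiction
    have hext : ∀ (x₀ : M) (k τ : ℝ) (β : ℝ → Coord d × Coord d),
        γ T ∈ (extChartAt (𝓡 d) x₀).source → 0 < k → 0 < τ →
        (∀ t ∈ Icc 0 τ, (β t).1 ∈ (extChartAt (𝓡 d) x₀).target ∧
          HasDerivWithinAt β (geodesicField (coordMetric g x₀) (β t)) (Icc 0 τ) t ∧
          (extChartAt (𝓡 d) x₀).symm (β t).1 ∈ closure (pastOf g W)) →
        (β 0).1 = extChartAt (𝓡 d) x₀ (γ T) →
        chartDeriv x₀ (γ T) (velocity γ (Ici 0) T) = k • (β 0).2 → False := by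
      intro x₀ k τ β hx hk hτ hβ hβ1 hβ2
      have hd := (hdw T hTA.1.1 x₀ hx).derivWithin (uniqueDiffOn_Ici 0 T hTA.1.1)
      obtain ⟨ε, hε, heq⟩ := hγ.1.exists_eq_flow x₀ hTA.1.1 hx hk hτ (fun t ht => (hβ t ht).2.1) hβ1
        (hd.trans hβ2)
      have hmem : min ε t₁ ∈ A := by
        refine ⟨⟨hTA.1.1.trans (le_min hε.le hTt.le), min_le_right _ _⟩, ?_⟩
        obtain ⟨h1, h2⟩ := heq (min ε t₁) ⟨le_min hε.le hTt.le, min_le_left _ _⟩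
        rw [mem_preimage, h2]
        exact (hβ _ h1).2.2
      exact not_lt.2 (le_csSup hAb hmem) (lt_min hε hTt)
    rcases hTA.1.1.eq_or_lt with hT0 | hT0
    · refine hext p 1 τ α (by rw [← hT0, hγ0]; exact hps) one_pos hτ hα
        (by rw [hα1, ← hT0, hγ0]) ?_
      rw [one_smul, ← hv, ← hT0]
      exact congrArg (fun z : TangentBundle (𝓡 d) M => chartDeriv p z.1 z.2) h0
    · obtain ⟨τ', hτ', β, hβ, hβ1, hβ2, -⟩ := exists_null_germ hW
        (show γ T ∈ horizon g W by rw [hfr]; exact ⟨hTA.2, hnotL T hT0.le⟩)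
      have hqs := mem_extChartAt_source (I := 𝓡 d) (γ T)
      have hGy := (isOrientedLorentzOn_coord g (γ T))
      have hyT := mem_extChartAt_target (I := 𝓡 d) (γ T)
      set a : Coord d := chartDeriv (γ T) (γ T) (velocity (d := d) γ (Ici 0) T) with ha
      have hac : a ∈ causalCone (coordMetric g (γ T) (extChartAt (𝓡 d) (γ T) (γ T)))
          (coordFuture g (γ T) (extChartAt (𝓡 d) (γ T) (γ T))) :=
        (chartDeriv_mem_causalCone_iff g (γ T) hqs _).2
          ⟨(hγ.2 T hT0.le).1.le, (hγ.2 T hT0.le).2⟩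
      by_cases hprop : ∃ k : ℝ, 0 < k ∧ (β 0).2 = k • a
      · obtain ⟨k, hk, hka⟩ := hprop
        refine hext (γ T) k⁻¹ τ' β hqs (inv_pos.2 hk) hτ' hβ hβ1 ?_
        rw [hka, smul_smul, inv_mul_cancel₀ hk.ne', one_smul]
      · push Not at hprop
        have hsum := (hGy.lorentz _ hyT).add_mem_timelikeCone (hGy.future_timelike _ hyT) hac hβ2
          hprop
        have hmem : Ici (0 : ℝ) ∈ 𝓝 T := Ici_mem_nhds hT0
        have h0τ : (0 : ℝ) ∈ Icc 0 τ' := ⟨le_rfl, hτ'.le⟩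
        obtain ⟨t, ht, htL⟩ := hL.corner hT0 hτ' ((hdw T hT0.le _ hqs).hasDerivAt hmem)
          ((hγ.1.1.continuousOn T hT0.le).continuousAt hmem)
          (hasDerivWithinAt_fst (hβ 0 h0τ).2.1) hβ1 (fun t ht => (hβ t ht).2.2) hsum
        exact hnotL t ht.1.le htL
  refine ⟨γ, Ici 0, ordConnected_Ici, not_bddAbove_Ici 0, hγ, ⟨0, self_mem_Ici, hγ0⟩, ?_⟩
  rintro _ ⟨t, ht, rfl⟩
  rw [hfr]
  exact ⟨hcl t ht, hnotL t ht⟩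

end Global

end Spacetimes

end
theorem mainTheorem6 {d : ℕ} (hd : 2 ≤ d) {M : Type*} [TopologicalSpace M]
    [ChartedSpace (Spacetimes.Coord d) M] [IsManifold (𝓡 d) ∞ M] [T2Space M]
    [SecondCountableTopology M] [ConnectedSpace M]
    (g : Spacetimes.LorentzStructure d M) (hstable : Spacetimes.StablyCausal g)
    (hcomplete : Spacetimes.FutureNullComplete g) :
    -- every point of a causal horizon lies on a future-infinite null geodesic in the horizon
    (∀ W : Set M, Spacetimes.IsFutureInfiniteWorldline g W → ∀ p ∈ Spacetimes.horizon g W,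
      Spacetimes.HasFutureInfiniteNullGeodesic g (Spacetimes.horizon g W) p) ∧
    -- the final hypothesis of the GSL always holds
    (∀ W a b : Set M, Spacetimes.IsGSLPair g W a b → Spacetimes.GeneratorCondition g W a b) ∧
    -- the GSL is equivalent to its restatement without that hypothesis
    (∀ (R : Set (Set M)) (S : Set M → ℝ),
      Spacetimes.GSL g R S ↔ Spacetimes.SimplifiedGSL g R S) := by
  have h1 : ∀ W : Set M, Spacetimes.IsFutureInfiniteWorldline g W →
      ∀ p ∈ Spacetimes.horizon g W,
        Spacetimes.HasFutureInfiniteNullGeodesic g (Spacetimes.horizon g W) p :=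
    fun W hW p hp => Spacetimes.hasFutureInfiniteNullGeodesic hcomplete hW hp
  have h2 : ∀ W a b : Set M, Spacetimes.IsGSLPair g W a b →
      Spacetimes.GeneratorCondition g W a b :=
    fun W a b h p hp => h1 W h.1 p (h.2.2.1.2.2 hp.1)
  exact ⟨h1, h2, fun R S => ⟨fun h W a ha b hb hab => h W a ha b hb hab (h2 W a b hab),
    fun h W a ha b hb hab _ => h W a ha b hb hab⟩⟩
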